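/- Let $k\neq 0$ be a commutative ring, $\Gamma$ an abelian group, and $I$ a non-empty finite set. Let $g_i\in\Gamma$ and let $\chi_i:\Gamma\to k^\times$ be homomorphisms ($i\in I$); put $q_{ij}=\chi_j(g_i)$. Fix a partition $I=I_1\sqcup\dots\sqcup I_N$ into non-empty subsets, and write $|i|=r$ if $i\in I_r$; assume that $q_{ij}q_{ji}=1$ whenever $|i|\neq|j|$. Put $\Theta=\{(i,j)\in I\times I: |i|>|j|\}$ and $\Xi=\{(i,j)\in\Theta:\chi_i\chi_j=1\}$. Let $V$ be the free $k$-module with basis $(x_i)_{i\in I}$, made into a Yetter–Drinfeld module over $\Gamma$ in which $x_i$ has degree $g_i$ and $g\,x_i=\chi_i(g)x_i$; its braiding is $x_i\otimes x_j\mapsto q_{ij}\,x_j\otimes x_i$, so that the group algebra $kB_l$ of the braid group $B_l$ acts on $V^{\otimes l}$. The tensor algebra $TV$ is a braided Hopf algebra in which the $x_i$ are primitive. Let $F$ be its bosonization, that is, the Hopf algebra which as an algebra is the smash product of $TV$ and $k\Gamma$ (so $g x_i=\chi_i(g)x_i g$), with $\Delta(x_i)=x_i\otimes 1+g_i\otimes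 x_i$ and $\Delta(g)=g\otimes g$; it is graded by word length, $k\Gamma$ being its component of degree $0$. Write $(\mathrm{ad}_c x_i)(x_j)=x_ix_j-q_{ij}x_jx_i$. Let $\mathcal R\subset TV$ be a set of elements of the form $\xi(x_{i_1}\otimes\dots\otimes x_{i_l})$ with $l\ge 2$, $\xi\in kB_l$, $|i_1|=\dots=|i_l|$, having a chain of subsets $\emptyset=\mathcal R_{(0)}\subset\dots\subset\mathcal R_{(L)}=\mathcal R$ $(L\geq 0)$ such that, for $0<h\le L$, each element of $\mathcal R_{(h)}$ is primitive in $TV$ modulo the ideal $(\mathcal R_{(h-1)})$. Let $\lambda=(\lambda_{ij})\in k^{\Xi}$, extended by $\lambda_{ij}=0$ for $(i,j)\in\Theta\setminus\Xi$. Define the quotients of $F$ by two-sided ideals $$H^0=F/\big(\mathcal R,\ (\mathrm{ad}_c x_i)(x_j)\big),\qquad A(\lambda)=F/\big(\mathcal R,\ (\mathrm{ad}_c x_i)(x_j)-\lambda_{ij}g_ig_j\big),\qquad H^\lambda=F/\big(\mathcal R,\ (\mathrm{ad}_c x_i)(x_j)-\lambda_{ij}(g_ig_j-1)\big),$$ with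 $(i,j)$ ranging over $\Theta$ in each case. Then $H^0$ is a graded Hopf algebra, $H^\lambda$ is a Hopf algebra, and the coproduct of $F$ induces algebra maps $A(\lambda)\to H^0\otimes A(\lambda)$ and $A(\lambda)\to A(\lambda)\otimes H^\lambda$ which make $A(\lambda)$ an $(H^0,H^\lambda)$-bicomodule algebra. Give $A(\lambda)$ and $H^\lambda$ the filtrations that are the images of the filtration of $F$ by degree ($F_n$ is the sum of the components of degree $\le n$), and let $\mathrm{gr}\,A(\lambda)$ and $\mathrm{gr}\,H^\lambda$ be the associated graded algebras. The epimorphisms of graded algebras $F\to\mathrm{gr}\,A(\lambda)$ and $F\to\mathrm{gr}\,H^\lambda$ induced by the quotient maps factor through natural maps of graded algebras $H^0\to\mathrm{gr}\,A(\lambda)$ and $H^0\to\mathrm{gr}\,H^\lambda$. For a Hopf algebra $H$, a left $H$-cleft object is a left $H$-comodule algebra $A$ which admits a convolution-invertible left $H$-colinear map $H\to A$ and for which $k$ maps isomorphically onto the subalgebra $\{a\in A:\rho(a)=1\otimes a\}$ of coinvariants, $\rho$ being the coaction; right cleft objects are defined symmetrically. For Hopf algebras $L$ and $H$, an $(L,H)$-bicleft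 object is an $(L,H)$-bicomodule algebra that is both a left $L$-cleft and a right $H$-cleft object. **Proposition 4.4.** The coproduct and the counit of $H^\lambda$ are filtered and induce on the graded algebra $\mathrm{gr}\,H^\lambda$ the structure of a Hopf algebra, and the two coactions on $A(\lambda)$ are filtered and induce coactions $\mathrm{gr}\,A(\lambda)\to H^0\otimes\mathrm{gr}\,A(\lambda)$ and $\mathrm{gr}\,A(\lambda)\to\mathrm{gr}\,A(\lambda)\otimes\mathrm{gr}\,H^\lambda$. Moreover: (1) With these coactions, $\mathrm{gr}\,A(\lambda)$ is an $(H^0,\mathrm{gr}\,H^\lambda)$-bicleft object. (2) The natural map $H^0\to\mathrm{gr}\,A(\lambda)$ is an isomorphism of graded algebras. (3) The natural map $H^0\to\mathrm{gr}\,H^\lambda$ is an isomorphism of graded Hopf algebras. -/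

import Mathlib

open scoped TensorProduct

noncomputable section

namespace LiftedHopf

universe u v w

/-- A Yetter--Drinfeld module `V = {x i, g i, χ i}` over an abelian group `Γ`, with basis
`(x i)` indexed by `I`, together with an (ordered) partition of `I` into `N` non-empty blocks
`I_r = {i | block i = r}` such that `q i j * q j i = 1` for `i`, `j` in distinct blocks, where
`q i j = χ j (g i)`. -/
structure Datum (k : Type u) (Γ : Type v) (I : Type w) [CommRing k] [CommGroup Γ] where
  g : I → Γ
  χ : I → Γ →* kˣ
  N : ℕ
  block : I → Fin N
  block_surjective : Function.Surjective block
  disconnected : ∀ i j, block i ≠ block j → χ j (g i) * χ i (g j) = 1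

namespace Datum

variable {k : Type u} {Γ : Type v} {I : Type w} [CommRing k] [CommGroup Γ]

/-- The braiding matrix `q i j = χ j (g i)`. -/
def q (D : Datum k Γ I) (i j : I) : kˣ := D.χ j (D.g i)

/-- The tensor algebra `TV` of the free module `V` with basis `(x i)`. -/
def TV (_D : Datum k Γ I) : Type (max u w) := FreeAlgebra k I

variable (D : Datum k Γ I)

instance : Ring D.TV := inferInstanceAs (Ring (FreeAlgebra k I))
instance : Algebra k D.TV := inferInstanceAs (Algebra k (FreeAlgebra k I))

/-- The basis element `x i` of `V`, in `TV`. -/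
def x (i : I) : D.TV := FreeAlgebra.ι k i

/-- The universal property of `TV`. -/
def liftTV {B : Type*} [Ring B] [Algebra k B] (f : I → B) : D.TV →ₐ[k] B :=
  FreeAlgebra.lift k f

theorem liftTV_x {B : Type*} [Ring B] [Algebra k B] (f : I → B) (i : I) :
    D.liftTV f (D.x i) = f i :=
  FreeAlgebra.lift_ι_apply f i

theorem TV_induction {p : D.TV → Prop} (halg : ∀ c : k, p (algebraMap k D.TV c))
    (hx : ∀ i, p (D.x i)) (hmul : ∀ a b, p a → p b → p (a * b))
    (hadd : ∀ a b, p a → p b → p (a + b)) (a : D.TV) : p a :=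
  FreeAlgebra.induction k I (motive := p) halg hx hmul hadd a

variable {D} in
theorem TV_hom_ext {B : Type*} [Ring B] [Algebra k B] {f f' : D.TV →ₐ[k] B}
    (h : ∀ i, f (D.x i) = f' (D.x i)) : f = f' :=
  FreeAlgebra.hom_ext (funext h)

/-- The action of `g : Γ` on `TV`, by the algebra automorphism with `x i ↦ χ i (g) x i`. -/
def act (g : Γ) : D.TV →ₐ[k] D.TV := D.liftTV fun i => (D.χ i g : k) • D.x i

theorem act_x (g : Γ) (i : I) : D.act g (D.x i) = (D.χ i g : k) • D.x i := D.liftTV_x _ i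

theorem act_one : D.act 1 = AlgHom.id k D.TV :=
  TV_hom_ext fun i => by simp [act_x]

theorem act_mul (g h : Γ) : D.act (g * h) = (D.act g).comp (D.act h) :=
  TV_hom_ext fun i => by simp [act_x, smul_smul, mul_comm]

instance : MulSemiringAction Γ D.TV where
  smul g a := D.act g a
  one_smul a := by change D.act 1 a = a; rw [act_one]; rfl
  mul_smul g h a := by change D.act (g * h) a = D.act g (D.act h a); rw [act_mul]; rfl
  smul_zero g := map_zero (D.act g)
  smul_add g := map_add (D.act g)
  smul_one g := map_one (D.act g)
  smul_mul g := map_mul (D.act g)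

theorem smul_def (g : Γ) (a : D.TV) : g • a = D.act g a := rfl

theorem smul_x (g : Γ) (i : I) : g • D.x i = (D.χ i g : k) • D.x i := D.act_x g i

instance : SMulCommClass Γ k D.TV where
  smul_comm g c a := map_smul (D.act g) c a

/-- The bosonization `F` of `TV` by `Γ`: as an algebra, the smash product of `TV` and `k Γ`
(with product `(a g) (b h) = (a (g • b)) (g h)`). Its Hopf algebra structure is given below. -/
def F : Type (max u v w) := SkewMonoidAlgebra D.TV Γ

instance : Ring D.F := inferInstanceAs (Ring (SkewMonoidAlgebra D.TV Γ))
instance : Algebra k D.F := inferInstanceAs (Algebra k (SkewMonoidAlgebra D.TV Γ))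

/-- The inclusion of `TV` in `F`. -/
def ofTV : D.TV →ₐ[k] D.F where
  toRingHom := (SkewMonoidAlgebra.singleOneRingHom : D.TV →+* SkewMonoidAlgebra D.TV Γ)
  commutes' _ := rfl

/-- The inclusion of `Γ` in `F`. -/
def ofΓ : Γ →* D.F := SkewMonoidAlgebra.of D.TV Γ

/-- The element `x i` of `F`. -/
def X (i : I) : D.F := D.ofTV (D.x i)

theorem single_eq (g : Γ) (a : D.TV) :
    (SkewMonoidAlgebra.single g a : SkewMonoidAlgebra D.TV Γ) = (D.ofTV a * D.ofΓ g : D.F) := by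
  have h := SkewMonoidAlgebra.single_mul_single (k := D.TV) (a₁ := (1 : Γ)) (a₂ := g)
    (b₁ := a) (b₂ := 1)
  rw [one_mul, one_smul, mul_one] at h
  exact h.symm

theorem ofΓ_mul_ofTV (g : Γ) (a : D.TV) : D.ofΓ g * D.ofTV a = D.ofTV (g • a) * D.ofΓ g := by
  rw [← single_eq]
  have h := SkewMonoidAlgebra.single_mul_single (k := D.TV) (a₁ := g) (a₂ := (1 : Γ))
    (b₁ := 1) (b₂ := a)
  rw [one_mul, mul_one] at h
  exact h

theorem ofΓ_mul_X (g : Γ) (i : I) : D.ofΓ g * D.X i = (D.χ i g : k) • (D.X i * D.ofΓ g) := by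
  rw [X, ofΓ_mul_ofTV, smul_x, map_smul, smul_mul_assoc]

theorem F_induction {p : D.F → Prop} (halg : ∀ c : k, p (algebraMap k D.F c))
    (hX : ∀ i, p (D.X i)) (hg : ∀ g, p (D.ofΓ g)) (hmul : ∀ a b, p a → p b → p (a * b))
    (hadd : ∀ a b, p a → p b → p (a + b)) (a : D.F) : p a := by
  refine SkewMonoidAlgebra.induction_on (k := D.TV) (G := Γ) (p := p) a ?_ ?_ ?_
  · have h := halg 0
    rw [map_zero] at h
    exact h
  · intro g a
    rw [single_eq]
    refine hmul _ _ ?_ (hg g)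
    refine D.TV_induction (p := fun a => p (D.ofTV a)) ?_ hX ?_ ?_ a
    · intro c; simpa using halg c
    · intro a b ha hb; simpa using hmul _ _ ha hb
    · intro a b ha hb; simpa using hadd _ _ ha hb
  · exact fun a b => hadd a b

variable {D} in
theorem F_hom_ext {B : Type*} [Semiring B] [Algebra k B] {f f' : D.F →ₐ[k] B}
    (hX : ∀ i, f (D.X i) = f' (D.X i)) (hg : ∀ g, f (D.ofΓ g) = f' (D.ofΓ g)) : f = f' := by
  ext a
  refine D.F_induction (p := fun a => f a = f' a) (by simp) hX hg ?_ ?_ a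
  · intro a b ha hb; simp [ha, hb]
  · intro a b ha hb; simp [ha, hb]

/-- Algebra maps out of `F`, from images of the `x i` and of `Γ`. -/
def liftF {B : Type*} [Ring B] [Algebra k B] (f : I → B) (γ : Γ →* B)
    (h : ∀ g i, γ g * f i = (D.χ i g : k) • (f i * γ g)) : D.F →ₐ[k] B :=
  SkewMonoidAlgebra.liftNCAlgHom (D.liftTV f) γ (by
    intro a g
    refine D.TV_induction
      (p := fun a => D.liftTV f (g • a) * γ g = γ g * D.liftTV f a) ?_ ?_ ?_ ?_ a
    · intro c; simp [Algebra.commutes]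
    · intro i; simp [smul_x, liftTV_x, h]
    · intro a b ha hb
      simp only [smul_def, map_mul] at *
      rw [mul_assoc, hb, ← mul_assoc, ha, mul_assoc]
    · intro a b ha hb
      simp only [smul_def, map_add, add_mul, mul_add] at *
      rw [ha, hb])

section liftF
variable {B : Type*} [Ring B] [Algebra k B] (f : I → B) (γ : Γ →* B)
    (h : ∀ g i, γ g * f i = (D.χ i g : k) • (f i * γ g))

theorem liftF_ofTV (a : D.TV) : D.liftF f γ h (D.ofTV a) = D.liftTV f a := by
  change SkewMonoidAlgebra.liftNC _ _ (SkewMonoidAlgebra.single _ _) = _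
  rw [SkewMonoidAlgebra.liftNC_single]; simp

theorem liftF_X (i : I) : D.liftF f γ h (D.X i) = f i := by
  rw [X, liftF_ofTV, liftTV_x]

theorem liftF_ofΓ (g : Γ) : D.liftF f γ h (D.ofΓ g) = γ g := by
  change SkewMonoidAlgebra.liftNC _ _ (SkewMonoidAlgebra.single _ _) = _
  rw [SkewMonoidAlgebra.liftNC_single]; simp

end liftF

/-- The homomorphism `g ↦ g ⊗ g`. -/
def diagΓ : Γ →* D.F ⊗[k] D.F where
  toFun g := D.ofΓ g ⊗ₜ D.ofΓ g
  map_one' := by simp [Algebra.TensorProduct.one_def]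
  map_mul' g h := by simp

theorem diagΓ_apply (g : Γ) : D.diagΓ g = D.ofΓ g ⊗ₜ D.ofΓ g := rfl

/-- The coproduct of `F`: the algebra map with `x i ↦ x i ⊗ 1 + g i ⊗ x i` and `g ↦ g ⊗ g`. -/
def comulF : D.F →ₐ[k] D.F ⊗[k] D.F :=
  D.liftF (fun i => D.X i ⊗ₜ 1 + D.ofΓ (D.g i) ⊗ₜ D.X i) D.diagΓ (by
    intro g i
    simp only [diagΓ_apply, mul_add, add_mul, smul_add,
      Algebra.TensorProduct.tmul_mul_tmul, mul_one, one_mul, ofΓ_mul_X, ← TensorProduct.smul_tmul',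
      TensorProduct.tmul_smul]
    rw [← map_mul, ← map_mul, mul_comm g])

/-- The trivial homomorphism, giving the counit on `Γ`. -/
def counitF : D.F →ₐ[k] k := D.liftF (fun _ => 0) 1 (by simp)

/-- The antipode of `F` as an anti-homomorphism: `x i ↦ -(g i)⁻¹ x i` and `g ↦ g⁻¹`. -/
def antipodeF : D.F →ₐ[k] D.Fᵐᵒᵖ :=
  D.liftF (fun i => MulOpposite.op (-(D.ofΓ (D.g i)⁻¹ * D.X i)))
    { toFun := fun g => MulOpposite.op (D.ofΓ g⁻¹)
      map_one' := by simp
      map_mul' := fun g h => by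
        rw [← MulOpposite.op_mul, ← map_mul, mul_inv] ; rw [mul_comm] }
    (by
      intro g i
      simp only [MonoidHom.coe_mk, OneHom.coe_mk]
      rw [← MulOpposite.op_mul, ← MulOpposite.op_mul, ← MulOpposite.op_smul]
      congr 1
      simp only [mul_neg, neg_mul, smul_neg]
      congr 1
      rw [← mul_assoc, ← map_mul, mul_comm g⁻¹, map_mul, mul_assoc, mul_assoc, D.ofΓ_mul_X g⁻¹,
        mul_smul_comm, smul_smul]
      simp)

theorem comulF_X (i : I) : D.comulF (D.X i) = D.X i ⊗ₜ 1 + D.ofΓ (D.g i) ⊗ₜ D.X i :=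
  D.liftF_X _ _ _ i
theorem comulF_ofΓ (g : Γ) : D.comulF (D.ofΓ g) = D.ofΓ g ⊗ₜ D.ofΓ g := D.liftF_ofΓ _ _ _ g
theorem counitF_X (i : I) : D.counitF (D.X i) = 0 := D.liftF_X _ _ _ i
theorem counitF_ofΓ (g : Γ) : D.counitF (D.ofΓ g) = 1 := D.liftF_ofΓ _ _ _ g
theorem antipodeF_X (i : I) :
    D.antipodeF (D.X i) = MulOpposite.op (-(D.ofΓ (D.g i)⁻¹ * D.X i)) := D.liftF_X _ _ _ i
theorem antipodeF_ofΓ (g : Γ) : D.antipodeF (D.ofΓ g) = MulOpposite.op (D.ofΓ g⁻¹) :=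
  D.liftF_ofΓ _ _ _ g

instance : Bialgebra k D.F := Bialgebra.ofAlgHom D.comulF D.counitF
  (F_hom_ext
    (fun i => by
      simp [comulF_X, comulF_ofΓ, TensorProduct.tmul_add, TensorProduct.add_tmul,
        Algebra.TensorProduct.one_def, add_assoc])
    (fun g => by simp [comulF_ofΓ]))
  (F_hom_ext
    (fun i => by simp [comulF_X, counitF_X, counitF_ofΓ])
    (fun g => by simp [comulF_ofΓ, counitF_ofΓ]))
  (F_hom_ext
    (fun i => by simp [comulF_X, counitF_X])
    (fun g => by simp [comulF_ofΓ, counitF_ofΓ]))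

theorem comul_eq (a : D.F) : Coalgebra.comul (R := k) a = D.comulF a := rfl
theorem counit_eq (a : D.F) : Coalgebra.counit (R := k) a = D.counitF a := rfl

/-- The antipode of `F`, as a linear map. -/
def S : D.F →ₗ[k] D.F := (MulOpposite.opLinearEquiv k).symm.toLinearMap ∘ₗ D.antipodeF.toLinearMap

theorem S_apply (a : D.F) : D.S a = (D.antipodeF a).unop := rfl

theorem S_mul (a b : D.F) : D.S (a * b) = D.S b * D.S a := by simp [S_apply]
theorem S_algebraMap (c : k) : D.S (algebraMap k D.F c) = algebraMap k D.F c := by simp [S_apply]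
theorem S_one : D.S 1 = 1 := by simp [S_apply]
theorem S_X (i : I) : D.S (D.X i) = -(D.ofΓ (D.g i)⁻¹ * D.X i) := by simp [S_apply, antipodeF_X]
theorem S_ofΓ (g : Γ) : D.S (D.ofΓ g) = D.ofΓ g⁻¹ := by simp [S_apply, antipodeF_ofΓ]

theorem S_left (a : D.F) :
    LinearMap.mul' k D.F (D.S.rTensor D.F (D.comulF a)) = algebraMap k D.F (D.counitF a) := by
  refine D.F_induction (p := fun a => LinearMap.mul' k D.F (D.S.rTensor D.F (D.comulF a)) =
    algebraMap k D.F (D.counitF a)) ?_ ?_ ?_ ?_ ?_ a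
  · intro c
    simp [Algebra.TensorProduct.algebraMap_apply, S_algebraMap]
  · intro i
    simp [comulF_X, counitF_X, S_X, S_ofΓ]
  · intro g
    simp [comulF_ofΓ, counitF_ofΓ, S_ofΓ, ← map_mul]
  · intro a b ha hb
    have key : ∀ t u : D.F ⊗[k] D.F, LinearMap.mul' k D.F (D.S.rTensor D.F t) =
        algebraMap k D.F (D.counitF a) → LinearMap.mul' k D.F (D.S.rTensor D.F (t * u)) =
        D.counitF a • LinearMap.mul' k D.F (D.S.rTensor D.F u) := by
      intro t u ht
      induction u using TensorProduct.induction_on with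
      | zero => simp
      | add u v hu hv => simp only [mul_add, map_add, hu, hv, smul_add]
      | tmul b c =>
        have : LinearMap.mul' k D.F (D.S.rTensor D.F (t * b ⊗ₜ c)) =
            D.S b * LinearMap.mul' k D.F (D.S.rTensor D.F t) * c := by
          clear ht
          induction t using TensorProduct.induction_on with
          | zero => simp
          | add u v hu hv => simp only [add_mul, map_add, hu, hv, mul_add]
          | tmul d e => simp [S_mul, mul_assoc]
        rw [this, ht, ← Algebra.commutes, Algebra.smul_def, mul_assoc]
        simp
    rw [map_mul, key _ _ ha, hb, map_mul, map_mul, Algebra.smul_def]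
  · intro a b ha hb
    simp only [map_add, ha, hb]

theorem S_right (a : D.F) :
    LinearMap.mul' k D.F (D.S.lTensor D.F (D.comulF a)) = algebraMap k D.F (D.counitF a) := by
  refine D.F_induction (p := fun a => LinearMap.mul' k D.F (D.S.lTensor D.F (D.comulF a)) =
    algebraMap k D.F (D.counitF a)) ?_ ?_ ?_ ?_ ?_ a
  · intro c
    simp [Algebra.TensorProduct.algebraMap_apply, S_one]
  · intro i
    simp [comulF_X, counitF_X, S_X, S_one, ← mul_assoc, ← map_mul]
  · intro g
    simp [comulF_ofΓ, counitF_ofΓ, S_ofΓ, ← map_mul]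
  · intro a b ha hb
    have key : ∀ t u : D.F ⊗[k] D.F, LinearMap.mul' k D.F (D.S.lTensor D.F u) =
        algebraMap k D.F (D.counitF b) → LinearMap.mul' k D.F (D.S.lTensor D.F (t * u)) =
        D.counitF b • LinearMap.mul' k D.F (D.S.lTensor D.F t) := by
      intro t u ht
      induction t using TensorProduct.induction_on with
      | zero => simp
      | add u v hu hv => simp only [add_mul, map_add, hu, hv, smul_add]
      | tmul b c =>
        have : LinearMap.mul' k D.F (D.S.lTensor D.F (b ⊗ₜ c * u)) =
            b * LinearMap.mul' k D.F (D.S.lTensor D.F u) * D.S c := by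
          clear ht
          induction u using TensorProduct.induction_on with
          | zero => simp
          | add u v hu hv => simp only [add_mul, map_add, hu, hv, mul_add]
          | tmul d e => simp [S_mul, mul_assoc]
        rw [this, ht, ← Algebra.commutes, Algebra.smul_def, mul_assoc]
        simp
    rw [map_mul, key _ _ hb, ha, map_mul, map_mul, Algebra.smul_def, Algebra.commutes]
  · intro a b ha hb
    simp only [map_add, ha, hb]

instance : HopfAlgebra k D.F where
  antipode := D.S
  mul_antipode_rTensor_comul := LinearMap.ext D.S_left
  mul_antipode_lTensor_comul := LinearMap.ext D.S_right

theorem antipode_eq (a : D.F) : HopfAlgebra.antipode k a = D.S a := rfl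

/-! ### The braided Hopf algebra `TV` and the relators -/

/-- Left multiplication by the primitive element `x i ⊗ 1 + 1 ⊗ x i` in the braided tensor product
`TV ⊗ TV`, whose product is `(a ⊗ b) (c ⊗ d) = a (|b| • c) ⊗ b d`; that is,
`a ⊗ b ↦ (x i) a ⊗ b + (g i • a) ⊗ (x i) b`. -/
def brMulPrim (i : I) : Module.End k (D.TV ⊗[k] D.TV) :=
  TensorProduct.map (LinearMap.mulLeft k (D.x i)) LinearMap.id +
    TensorProduct.map (D.act (D.g i)).toLinearMap (LinearMap.mulLeft k (D.x i))

/-- The braided coproduct of `TV`: the algebra map from `TV` to the braided tensor product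
`TV ⊗ TV` for which every `x i` is primitive. -/
def brComul : D.TV →ₗ[k] D.TV ⊗[k] D.TV :=
  (LinearMap.applyₗ (1 ⊗ₜ 1)) ∘ₗ (D.liftTV D.brMulPrim).toLinearMap

/-- The (two-sided) ideal of `TV` generated by a subset. -/
def idealTV (s : Set D.TV) : Ideal D.TV := (TwoSidedIdeal.span s).asIdeal

instance (s : Set D.TV) : (D.idealTV s).IsTwoSided :=
  inferInstanceAs (TwoSidedIdeal.span s).asIdeal.IsTwoSided

/-- `y` is primitive modulo the ideal `(s)` in `TV`: its class in `TV / (s)` satisfies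
`Δ y = y ⊗ 1 + 1 ⊗ y`. -/
def IsPrimitiveMod (s : Set D.TV) (y : D.TV) : Prop :=
  TensorProduct.map (Ideal.Quotient.mkₐ k (D.idealTV s)).toLinearMap
      (Ideal.Quotient.mkₐ k (D.idealTV s)).toLinearMap (D.brComul y) =
    Ideal.Quotient.mkₐ k (D.idealTV s) y ⊗ₜ 1 + 1 ⊗ₜ Ideal.Quotient.mkₐ k (D.idealTV s) y

/-- The action of the `s`-th generator of the braid group `B_l` on `V ^ ⊗ l` (the free module on
the words `w : Fin l → I`), i.e. the braiding `x i ⊗ x j ↦ q i j x j ⊗ x i` in the places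
`s`, `s + 1`. -/
def braidGen (l s : ℕ) (h : s + 1 < l) : Module.End k ((Fin l → I) →₀ k) :=
  Finsupp.linearCombination k fun w =>
    Finsupp.single (w ∘ Equiv.swap ⟨s, by omega⟩ ⟨s + 1, h⟩)
      (D.q (w ⟨s, by omega⟩) (w ⟨s + 1, h⟩) : k)

/-- The action of the inverse of the `s`-th generator of `B_l` on `V ^ ⊗ l`. -/
def braidGenInv (l s : ℕ) (h : s + 1 < l) : Module.End k ((Fin l → I) →₀ k) :=
  Finsupp.linearCombination k fun w =>
    Finsupp.single (w ∘ Equiv.swap ⟨s, by omega⟩ ⟨s + 1, h⟩)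
      (((D.q (w ⟨s + 1, h⟩) (w ⟨s, by omega⟩))⁻¹ : kˣ) : k)

theorem braidGen_mul_braidGenInv (l s : ℕ) (h : s + 1 < l) :
    D.braidGen l s h * D.braidGenInv l s h = 1 := by
  refine Finsupp.lhom_ext fun w c => ?_
  have : (w ∘ Equiv.swap (⟨s, by omega⟩ : Fin l) ⟨s + 1, h⟩) ∘
      Equiv.swap (⟨s, by omega⟩ : Fin l) ⟨s + 1, h⟩ = w := by
    ext a; simp
  rw [Module.End.mul_apply, Module.End.one_apply]
  simp only [braidGen, braidGenInv, Finsupp.linearCombination_single, Finsupp.smul_single,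
    smul_eq_mul, Function.comp_apply, Equiv.swap_apply_left, Equiv.swap_apply_right, this]
  rw [mul_assoc, ← Units.val_mul]
  simp

theorem braidGenInv_mul_braidGen (l s : ℕ) (h : s + 1 < l) :
    D.braidGenInv l s h * D.braidGen l s h = 1 := by
  refine Finsupp.lhom_ext fun w c => ?_
  have : (w ∘ Equiv.swap (⟨s, by omega⟩ : Fin l) ⟨s + 1, h⟩) ∘
      Equiv.swap (⟨s, by omega⟩ : Fin l) ⟨s + 1, h⟩ = w := by
    ext a; simp
  rw [Module.End.mul_apply, Module.End.one_apply]
  simp only [braidGen, braidGenInv, Finsupp.linearCombination_single, Finsupp.smul_single,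
    smul_eq_mul, Function.comp_apply, Equiv.swap_apply_left, Equiv.swap_apply_right, this]
  rw [mul_assoc, ← Units.val_mul]
  simp

/-- The image of the group algebra `k B_l` in the endomorphism algebra of `V ^ ⊗ l`. -/
def braidAlg (l : ℕ) : Subalgebra k (Module.End k ((Fin l → I) →₀ k)) :=
  Algebra.adjoin k {c | ∃ s h, c = D.braidGen l s h ∨ c = D.braidGenInv l s h}

/-- The word `x (w 0) x (w 1) ⋯ x (w (l - 1))` in `TV`. -/
def word {l : ℕ} (w : Fin l → I) : D.TV := (List.ofFn fun s => D.x (w s)).prod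

/-- The inclusion of `V ^ ⊗ l` in `TV`. -/
def tensorPow (l : ℕ) : ((Fin l → I) →₀ k) →ₗ[k] D.TV :=
  Finsupp.linearCombination k fun w => D.word w

/-- The braided commutator `(ad x i) (x j) = x i x j - q i j x j x i` in `TV`. -/
def ad (i j : I) : D.TV := D.x i * D.x j - (D.q i j : k) • (D.x j * D.x i)

end Datum

/-- A set `R` of relators in `TV`, of the form `ξ (x i₁ ⊗ ⋯ ⊗ x iₗ)` with `l ≥ 2`, `ξ ∈ k B_l` and
`i₁, …, iₗ` in one block, with a finite filtration
`∅ = R_(0) ⊆ R_(1) ⊆ ⋯ ⊆ R_(L) = R` such that every element of `R_(h)` is primitive modulo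
`(R_(h - 1))`. -/
structure Relators {k : Type u} {Γ : Type v} {I : Type w} [CommRing k] [CommGroup Γ]
    (D : Datum k Γ I) where
  carrier : Set D.TV
  form : ∀ y ∈ carrier, ∃ (l : ℕ) (w : Fin l → I), 2 ≤ l ∧ (∀ s t, D.block (w s) = D.block (w t)) ∧
    ∃ ξ ∈ D.braidAlg l, y = D.tensorPow l (ξ (Finsupp.single w 1))
  primitive : ∃ (L : ℕ) (Rh : ℕ → Set D.TV), Rh 0 = ∅ ∧ Rh L = carrier ∧
    (∀ h < L, Rh h ⊆ Rh (h + 1)) ∧ ∀ h < L, ∀ y ∈ Rh (h + 1), D.IsPrimitiveMod (Rh h) y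

namespace Datum

variable {k : Type u} {Γ : Type v} {I : Type w} [CommRing k] [CommGroup Γ] (D : Datum k Γ I)

/-! Elements homogeneous of degree `l` in `ℕ` and `g` in `Γ`. -/

/-- The span of the words of length `l` whose `Γ`-degree is `g`. -/
def homog (l : ℕ) (g : Γ) : Submodule k D.TV :=
  Submodule.span k {a | ∃ w : Fin l → I, (List.ofFn fun s => D.g (w s)).prod = g ∧ a = D.word w}

theorem prod_swap {l : ℕ} (w : Fin l → I) (a b : Fin l) :
    (List.ofFn fun s => D.g ((w ∘ Equiv.swap a b) s)).prod = (List.ofFn fun s => D.g (w s)).prod := by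
  rw [List.prod_ofFn, List.prod_ofFn]
  exact Equiv.prod_comp (Equiv.swap a b) fun s => D.g (w s)

theorem tensorPow_mem_homog {l : ℕ} (w : Fin l → I) {ξ : Module.End k ((Fin l → I) →₀ k)}
    (hξ : ξ ∈ D.braidAlg l) :
    D.tensorPow l (ξ (Finsupp.single w 1)) ∈
      D.homog l (List.ofFn fun s => D.g (w s)).prod := by
  set g := (List.ofFn fun s => D.g (w s)).prod with hg
  let M : Submodule k ((Fin l → I) →₀ k) :=
    Submodule.span k {v | ∃ w' : Fin l → I, (List.ofFn fun s => D.g (w' s)).prod = g ∧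
      v = Finsupp.single w' 1}
  have hM : ∀ ξ ∈ D.braidAlg l, ∀ v ∈ M, ξ v ∈ M := by
    intro ξ hξ
    induction hξ using Algebra.adjoin_induction with
    | mem c hc =>
      intro v hv
      induction hv using Submodule.span_induction with
      | zero => simp
      | add a b _ _ ha hb => rw [map_add]; exact M.add_mem ha hb
      | smul r a _ ha => rw [map_smul]; exact M.smul_mem _ ha
      | mem v hv =>
        obtain ⟨w', hw', rfl⟩ := hv
        obtain ⟨s, h, rfl | rfl⟩ := hc
        all_goals
          simp only [braidGen, braidGenInv, Finsupp.linearCombination_single, one_smul]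
          rw [← mul_one (Units.val _), ← smul_eq_mul, ← Finsupp.smul_single]
          refine M.smul_mem _ (Submodule.subset_span ⟨_, ?_, rfl⟩)
          rw [prod_swap, hw']
    | algebraMap r => intro v hv; exact M.smul_mem r hv
    | add a b _ _ ha hb => intro v hv; exact M.add_mem (ha v hv) (hb v hv)
    | mul a b _ _ ha hb => intro v hv; exact ha _ (hb v hv)
  have h1 : ξ (Finsupp.single w 1) ∈ M := hM ξ hξ _ (Submodule.subset_span ⟨w, rfl, rfl⟩)
  revert h1
  generalize ξ (Finsupp.single w 1) = v
  intro hv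
  induction hv using Submodule.span_induction with
  | zero => simp
  | add a b _ _ ha hb => rw [map_add]; exact Submodule.add_mem _ ha hb
  | smul r a _ ha => rw [map_smul]; exact Submodule.smul_mem _ _ ha
  | mem v hv =>
    obtain ⟨w', hw', rfl⟩ := hv
    refine Submodule.subset_span ⟨w', hw', ?_⟩
    simp [tensorPow]

theorem exists_mem_homog (R : Relators D) {y : D.TV} (hy : y ∈ R.carrier) :
    ∃ l g, 2 ≤ l ∧ y ∈ D.homog l g := by
  obtain ⟨l, w, hl, -, ξ, hξ, rfl⟩ := R.form y hy
  exact ⟨l, _, hl, D.tensorPow_mem_homog w hξ⟩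

theorem counitF_homog {l : ℕ} {g : Γ} (hl : 2 ≤ l) {y : D.TV} (hy : y ∈ D.homog l g) :
    D.counitF (D.ofTV y) = 0 := by
  induction hy using Submodule.span_induction with
  | zero => simp
  | add a b _ _ ha hb => simp [ha, hb]
  | smul r a _ ha => simp [ha]
  | mem v hv =>
    obtain ⟨w, -, rfl⟩ := hv
    obtain ⟨m, rfl⟩ : ∃ m, l = m + 1 := ⟨l - 1, by omega⟩
    have := D.counitF_X (w 0)
    simp only [X] at this
    simp [word, List.ofFn_succ, this]

section key

variable {B C : Type*} [Ring B] [Algebra k B] [Ring C] [Algebra k C]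
  (f : D.F →ₐ[k] B) (f' : D.F →ₐ[k] C)

/-- The composite of the `Γ`-coaction of `TV` with `f ⊗ f'`. -/
def theta : D.TV →ₐ[k] B ⊗[k] C := D.liftTV fun i => f (D.ofΓ (D.g i)) ⊗ₜ f' (D.X i)

theorem theta_homog {l : ℕ} {g : Γ} {y : D.TV} (hy : y ∈ D.homog l g) :
    D.theta f f' y = f (D.ofΓ g) ⊗ₜ f' (D.ofTV y) := by
  induction hy using Submodule.span_induction with
  | zero => simp
  | add a b _ _ ha hb => simp [ha, hb, TensorProduct.tmul_add]
  | smul r a _ ha => simp [ha]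
  | mem v hv =>
    obtain ⟨w, hw, rfl⟩ := hv
    subst hw
    unfold word
    induction l with
    | zero => simp [Algebra.TensorProduct.one_def]
    | succ l ih =>
      simp only [List.ofFn_succ, List.prod_cons, map_mul]
      rw [ih (fun s => w s.succ), theta, liftTV_x, Algebra.TensorProduct.tmul_mul_tmul]
      rfl

/-- The map `a ⊗ b ↦ f (a |b|) ⊗ f' b`. -/
def psi : D.TV ⊗[k] D.TV →ₗ[k] B ⊗[k] C :=
  LinearMap.mul' k _ ∘ₗ TensorProduct.map
    ((Algebra.TensorProduct.includeLeft.comp (f.comp D.ofTV)).toLinearMap)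
    (D.theta f f').toLinearMap

theorem psi_tmul (a b : D.TV) :
    D.psi f f' (a ⊗ₜ b) = (f (D.ofTV a) ⊗ₜ 1) * D.theta f f' b := by
  simp [psi]

theorem map_comulF_ofTV (a : D.TV) :
    Algebra.TensorProduct.map f f' (D.comulF (D.ofTV a)) = D.psi f f' (D.brComul a) := by
  have key : ∀ a t, D.psi f f' (D.liftTV D.brMulPrim a t) =
      Algebra.TensorProduct.map f f' (D.comulF (D.ofTV a)) * D.psi f f' t := by
    intro a
    refine D.TV_induction (p := fun a => ∀ t, D.psi f f' (D.liftTV D.brMulPrim a t) =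
      Algebra.TensorProduct.map f f' (D.comulF (D.ofTV a)) * D.psi f f' t) ?_ ?_ ?_ ?_ a
    · intro c t
      rw [Algebra.algebraMap_eq_smul_one]
      simp only [map_smul, map_one, LinearMap.smul_apply, Module.End.one_apply, smul_mul_assoc,
        one_mul]
    · intro i t
      rw [liftTV_x]
      change _ = Algebra.TensorProduct.map f f' (D.comulF (D.X i)) * _
      rw [comulF_X]
      induction t using TensorProduct.induction_on with
      | zero => simp
      | add u v hu hv => simp only [map_add, hu, hv, mul_add]
      | tmul a b =>
        have h1 : f (D.ofTV (D.act (D.g i) a)) * f (D.ofΓ (D.g i)) =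
            f (D.ofΓ (D.g i)) * f (D.ofTV a) := by
          rw [← map_mul, ← map_mul, ofΓ_mul_ofTV]; rfl
        have h2 : D.theta f f' (D.x i) = f (D.ofΓ (D.g i)) ⊗ₜ f' (D.X i) := D.liftTV_x _ i
        simp only [brMulPrim, LinearMap.add_apply, TensorProduct.map_tmul, map_add, psi_tmul,
          LinearMap.mulLeft_apply, map_mul, h2, LinearMap.id_apply, AlgHom.toLinearMap_apply,
          add_mul, Algebra.TensorProduct.map_tmul, map_one, ← mul_assoc,
          Algebra.TensorProduct.tmul_mul_tmul, one_mul, mul_one, h1]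
        rfl
    · intro a b ha hb t
      rw [map_mul, Module.End.mul_apply, ha, hb, map_mul, map_mul, map_mul, mul_assoc]
    · intro a b ha hb t
      rw [map_add, LinearMap.add_apply, map_add, ha, hb, map_add, map_add, map_add, add_mul]
  have h := key a (1 ⊗ₜ 1)
  rw [psi_tmul] at h
  simp only [map_one, mul_one, ← Algebra.TensorProduct.one_def] at h
  rw [← h]
  rfl

end key

end Datum
namespace Datum

variable {k : Type u} {Γ : Type v} {I : Type w} [CommRing k] [CommGroup Γ] (D : Datum k Γ I)

theorem span_le_ker {A B : Type*} [Ring A] [Ring B] [Algebra k A] [Algebra k B] (f : A →ₐ[k] B)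
    {s : Set A} (h : ∀ a ∈ s, f a = 0) : ∀ a ∈ (TwoSidedIdeal.span s).asIdeal, f a = 0 := by
  intro a ha
  have h1 : TwoSidedIdeal.span s ≤ TwoSidedIdeal.ker f :=
    TwoSidedIdeal.span_le.2 fun b hb => (TwoSidedIdeal.mem_ker f).2 (h b hb)
  exact (TwoSidedIdeal.mem_ker f).1 (h1 (TwoSidedIdeal.mem_asIdeal.1 ha))

theorem map_comulF_primitive {B C : Type*} [Ring B] [Algebra k B] [Ring C] [Algebra k C]
    (f : D.F →ₐ[k] B) (f' : D.F →ₐ[k] C) {s : Set D.TV}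
    (hs : ∀ y ∈ s, f (D.ofTV y) = 0) (hs' : ∀ y ∈ s, f' (D.ofTV y) = 0)
    (hh : ∀ y ∈ s, ∃ l g, y ∈ D.homog l g) {y : D.TV} (hy : D.IsPrimitiveMod s y)
    {l : ℕ} {g : Γ} (hyg : y ∈ D.homog l g) :
    Algebra.TensorProduct.map f f' (D.comulF (D.ofTV y)) =
      f (D.ofTV y) ⊗ₜ 1 + f (D.ofΓ g) ⊗ₜ f' (D.ofTV y) := by
  let e1 : (D.TV ⧸ D.idealTV s) →ₐ[k] B ⊗[k] C := Ideal.Quotient.liftₐ _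
    (Algebra.TensorProduct.includeLeft.comp (f.comp D.ofTV))
    (span_le_ker _ fun a ha => by simp [hs a ha])
  let e2 : (D.TV ⧸ D.idealTV s) →ₐ[k] B ⊗[k] C := Ideal.Quotient.liftₐ _ (D.theta f f')
    (span_le_ker _ fun a ha => by
      obtain ⟨l, g, h⟩ := hh a ha
      rw [D.theta_homog f f' h, hs' a ha, TensorProduct.tmul_zero])
  have hpsi : D.psi f f' = (LinearMap.mul' k _ ∘ₗ TensorProduct.map e1.toLinearMap
      e2.toLinearMap) ∘ₗ TensorProduct.map (Ideal.Quotient.mkₐ k (D.idealTV s)).toLinearMap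
      (Ideal.Quotient.mkₐ k (D.idealTV s)).toLinearMap := by
    ext a b
    rfl
  rw [map_comulF_ofTV, hpsi, LinearMap.comp_apply, hy]
  have h1 : e1 (Ideal.Quotient.mkₐ k (D.idealTV s) y) = f (D.ofTV y) ⊗ₜ 1 := rfl
  have h2 : e2 (Ideal.Quotient.mkₐ k (D.idealTV s) y) = D.theta f f' y := rfl
  rw [D.theta_homog f f' hyg] at h2
  rw [LinearMap.comp_apply, map_add, map_add, TensorProduct.map_tmul, TensorProduct.map_tmul,
    LinearMap.mul'_apply, LinearMap.mul'_apply]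
  simp only [AlgHom.toLinearMap_apply, map_one, mul_one, one_mul, h1, h2]

/-- If algebra maps `f`, `f'` on `F` kill the relators `R`, then so does `(f ⊗ f') ∘ Δ`. -/
theorem map_comulF_relator (R : Relators D) {B C : Type*} [Ring B] [Algebra k B] [Ring C]
    [Algebra k C] (f : D.F →ₐ[k] B) (f' : D.F →ₐ[k] C)
    (hf : ∀ y ∈ R.carrier, f (D.ofTV y) = 0) (hf' : ∀ y ∈ R.carrier, f' (D.ofTV y) = 0)
    {y : D.TV} (hy : y ∈ R.carrier) :
    Algebra.TensorProduct.map f f' (D.comulF (D.ofTV y)) = 0 := by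
  obtain ⟨L, Rh, h0, hL, hmono, hp⟩ := R.primitive
  have hsub : ∀ m n, m + n = L → Rh m ⊆ R.carrier := by
    intro m n
    induction n generalizing m with
    | zero => intro h; rw [← hL, ← h]; rfl
    | succ n ih =>
      intro h
      exact (hmono m (by omega)).trans (ih (m + 1) (by omega))
  have hy' := hy
  rw [← hL] at hy'
  rcases L with _ | L
  · rw [h0] at hy'; exact hy'.elim
  · have hs := hsub L 1 rfl
    obtain ⟨l, g, -, hg⟩ := D.exists_mem_homog R hy
    rw [D.map_comulF_primitive f f' (fun y h => hf y (hs h)) (fun y h => hf' y (hs h))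
      (fun y h => ?_) (hp L (by omega) y hy') hg, hf y hy, hf' y hy]
    · simp
    · obtain ⟨l, g, -, hg⟩ := D.exists_mem_homog R (hs h)
      exact ⟨l, g, hg⟩

/-- If the algebra map `f` kills the relators, then so does `f ∘ S`. -/
theorem map_antipode_relator (R : Relators D) {B : Type*} [Ring B] [Algebra k B]
    (f : D.F →ₐ[k] B) (hf : ∀ y ∈ R.carrier, f (D.ofTV y) = 0)
    {y : D.TV} (hy : y ∈ R.carrier) : f (D.S (D.ofTV y)) = 0 := by
  obtain ⟨L, Rh, h0, hL, hmono, hp⟩ := R.primitive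
  have hsub : ∀ m n, m + n = L → Rh m ⊆ R.carrier := by
    intro m n
    induction n generalizing m with
    | zero => intro h; rw [← hL, ← h]; rfl
    | succ n ih =>
      intro h
      exact (hmono m (by omega)).trans (ih (m + 1) (by omega))
  let ψ : D.F →ₐ[k] Bᵐᵒᵖ := f.op.comp D.antipodeF
  have hψ : ∀ a, (ψ a).unop = f (D.S a) := fun a => rfl
  let μ : Bᵐᵒᵖ ⊗[k] B →ₗ[k] B :=
    LinearMap.mul' k B ∘ₗ (MulOpposite.opLinearEquiv k).symm.toLinearMap.rTensor B
  have hμ : ∀ a : D.F, μ (Algebra.TensorProduct.map ψ f (D.comulF a)) =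
      algebraMap k B (D.counitF a) := by
    intro a
    have h := congrArg f (D.S_left a)
    rw [AlgHom.commutes] at h
    rw [← h]
    generalize D.comulF a = t
    induction t using TensorProduct.induction_on with
    | zero => simp
    | add u v hu hv => simp only [map_add, hu, hv]
    | tmul a b => simp [μ, hψ]
  have main : ∀ n, n ≤ L → ∀ y ∈ Rh n, f (D.S (D.ofTV y)) = 0 := by
    intro n
    induction n with
    | zero => intro _ y hy; rw [h0] at hy; exact hy.elim
    | succ n ih =>
      intro hn y hy
      have hs := hsub n (L - n) (by omega)
      have hyR := hsub (n + 1) (L - (n + 1)) (by omega) hy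
      obtain ⟨l, g, hl, hg⟩ := D.exists_mem_homog R hyR
      have h := D.map_comulF_primitive ψ f
        (fun y h => MulOpposite.unop_injective ((hψ _).trans (ih (by omega) y h)))
        (fun y h => hf y (hs h))
        (fun y h => by
          obtain ⟨l, g, -, hg⟩ := D.exists_mem_homog R (hs h)
          exact ⟨l, g, hg⟩) (hp n (by omega) y hy) hg
      have h' := hμ (D.ofTV y)
      rw [h, hf y hyR, TensorProduct.tmul_zero, add_zero, D.counitF_homog hl hg, map_zero] at h'
      simpa [μ, hψ] using h'
  exact main L le_rfl y (by rw [hL]; exact hy)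

/-- A skew-primitive element: `Δ a = a ⊗ 1 + g ⊗ a`. -/
def IsSkewPrim (g : Γ) (a : D.F) : Prop := D.comulF a = a ⊗ₜ 1 + D.ofΓ g ⊗ₜ a

theorem IsSkewPrim.counit {D : Datum k Γ I} {g : Γ} {a : D.F} (h : D.IsSkewPrim g a) :
    D.counitF a = 0 := by
  have h1 := Coalgebra.rTensor_counit_comul (R := k) a
  rw [comul_eq, h] at h1
  have h2 := congrArg (fun t => D.counitF (TensorProduct.lid k D.F t)) h1
  simpa [counit_eq, counitF_ofΓ] using h2

theorem IsSkewPrim.antipode {D : Datum k Γ I} {g : Γ} {a : D.F} (h : D.IsSkewPrim g a) :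
    D.S a = -(D.ofΓ g⁻¹ * a) := by
  have h1 := D.S_left a
  rw [h, h.counit] at h1
  simp [S_ofΓ] at h1
  exact eq_neg_of_add_eq_zero_left h1

theorem isSkewPrim_ad {i j : I} (hij : D.block j < D.block i) :
    D.IsSkewPrim (D.g i * D.g j) (D.ofTV (D.ad i j)) := by
  have hq : (D.q i j : k) * (D.χ i (D.g j) : k) = 1 := by
    rw [← Units.val_mul]
    exact congrArg Units.val (D.disconnected i j hij.ne')
  have e : D.ofTV (D.ad i j) = D.X i * D.X j - (D.q i j : k) • (D.X j * D.X i) := by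
    simp [ad, X]
  have c1 : D.ofΓ (D.g i) * D.X j = (D.q i j : k) • (D.X j * D.ofΓ (D.g i)) := D.ofΓ_mul_X _ _
  have c2 := D.ofΓ_mul_X (D.g j) i
  unfold IsSkewPrim
  rw [e]
  simp only [map_sub, map_smul, map_mul, comulF_X, mul_add, add_mul,
    Algebra.TensorProduct.tmul_mul_tmul, mul_one, one_mul, c1, c2, smul_add,
    ← TensorProduct.smul_tmul', smul_smul, hq, one_smul, TensorProduct.sub_tmul,
    TensorProduct.tmul_sub, TensorProduct.tmul_smul]
  rw [← map_mul, ← map_mul, mul_comm (D.g j) (D.g i)]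
  abel

end Datum
/-! ### Comodule algebras and cleft objects -/

section Cleft

variable (k : Type*) [CommRing k]

/-- A left `H`-comodule algebra structure on the algebra `A`. -/
structure LeftCoaction (H A : Type*) [Ring H] [Bialgebra k H] [Ring A] [Algebra k A] where
  coact : A →ₐ[k] H ⊗[k] A
  coassoc : ∀ a, TensorProduct.assoc k H H A
      ((Coalgebra.comul (R := k) (A := H)).rTensor A (coact a)) =
    coact.toLinearMap.lTensor H (coact a)
  counit : ∀ a, TensorProduct.lid k A
      ((Coalgebra.counit (R := k) (A := H)).rTensor A (coact a)) = a

/-- A right `H`-comodule algebra structure on the algebra `A`. -/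
structure RightCoaction (A H : Type*) [Ring A] [Algebra k A] [Ring H] [Bialgebra k H] where
  coact : A →ₐ[k] A ⊗[k] H
  coassoc : ∀ a, TensorProduct.assoc k A H H (coact.toLinearMap.rTensor H (coact a)) =
    (Coalgebra.comul (R := k) (A := H)).lTensor A (coact a)
  counit : ∀ a, TensorProduct.rid k A
      ((Coalgebra.counit (R := k) (A := H)).lTensor A (coact a)) = a

variable {k}

/-- The convolution product `φ * ψ` of linear maps from a coalgebra `H` to an algebra `A`. -/
def conv {H A : Type*} [Ring H] [Bialgebra k H] [Ring A] [Algebra k A] (φ ψ : H →ₗ[k] A) :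
    H →ₗ[k] A :=
  LinearMap.mul' k A ∘ₗ TensorProduct.map φ ψ ∘ₗ Coalgebra.comul

/-- `φ` is invertible for the convolution product, whose unit is `h ↦ ε h • 1`. -/
def IsConvInvertible {H A : Type*} [Ring H] [Bialgebra k H] [Ring A] [Algebra k A]
    (φ : H →ₗ[k] A) : Prop :=
  ∃ ψ : H →ₗ[k] A, conv φ ψ = Algebra.linearMap k A ∘ₗ Coalgebra.counit ∧
    conv ψ φ = Algebra.linearMap k A ∘ₗ Coalgebra.counit

/-- `A` is a left `H`-cleft object: there is a convolution-invertible left `H`-colinear map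
`H → A`, and `k` maps isomorphically onto the subalgebra of coinvariants of `A`. -/
def LeftCoaction.IsCleftObject {H A : Type*} [Ring H] [Bialgebra k H] [Ring A] [Algebra k A]
    (ρ : LeftCoaction k H A) : Prop :=
  (∃ φ : H →ₗ[k] A, (∀ h, ρ.coact (φ h) = φ.lTensor H (Coalgebra.comul (R := k) h)) ∧
    IsConvInvertible φ) ∧
  Function.Injective (algebraMap k A) ∧
  ∀ a, ρ.coact a = 1 ⊗ₜ a ↔ a ∈ Set.range (algebraMap k A)

/-- `A` is a right `H`-cleft object. -/
def RightCoaction.IsCleftObject {A H : Type*} [Ring A] [Algebra k A] [Ring H] [Bialgebra k H]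
    (ρ : RightCoaction k A H) : Prop :=
  (∃ φ : H →ₗ[k] A, (∀ h, ρ.coact (φ h) = φ.rTensor H (Coalgebra.comul (R := k) h)) ∧
    IsConvInvertible φ) ∧
  Function.Injective (algebraMap k A) ∧
  ∀ a, ρ.coact a = a ⊗ₜ 1 ↔ a ∈ Set.range (algebraMap k A)

/-- The two coactions commute, so that `A` is an `(L, H)`-bicomodule algebra. -/
def IsBicomodule {L A H : Type*} [Ring L] [Bialgebra k L] [Ring A] [Algebra k A] [Ring H]
    [Bialgebra k H] (ρ : LeftCoaction k L A) (ρ' : RightCoaction k A H) : Prop :=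
  ∀ a, TensorProduct.assoc k L A H (ρ.coact.toLinearMap.rTensor H (ρ'.coact a)) =
    ρ'.coact.toLinearMap.lTensor L (ρ.coact a)

/-- `A` is an `(L, H)`-bicleft object: an `(L, H)`-bicomodule algebra that is a cleft object on
both sides. -/
def IsBicleftObject {L A H : Type*} [Ring L] [Bialgebra k L] [Ring A] [Algebra k A] [Ring H]
    [Bialgebra k H] (ρ : LeftCoaction k L A) (ρ' : RightCoaction k A H) : Prop :=
  IsBicomodule ρ ρ' ∧ ρ.IsCleftObject ∧ ρ'.IsCleftObject

end Cleft

/-! ### The quotients of `F` -/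

namespace Relators

variable {k : Type u} {Γ : Type v} {I : Type w} [CommRing k] [CommGroup Γ] {D : Datum k Γ I}
  (R : Relators D)

open Datum

/-- The union of `R` with the elements `(ad x i) (x j) - u i j` for `(i, j) ∈ Θ`, that is, for
`block j < block i`. -/
def rel (u : I → I → D.F) : Set D.F :=
  D.ofTV '' R.carrier ∪ {a | ∃ i j, D.block j < D.block i ∧ a = D.ofTV (D.ad i j) - u i j}

/-- The two-sided ideal of `F` generated by `R` and the elements `(ad x i) (x j) - u i j`. -/
def ideal (u : I → I → D.F) : Ideal D.F := (TwoSidedIdeal.span (R.rel u)).asIdeal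

instance (u : I → I → D.F) : (R.ideal u).IsTwoSided :=
  inferInstanceAs (TwoSidedIdeal.span (R.rel u)).asIdeal.IsTwoSided

/-- The quotient map. -/
abbrev π (u : I → I → D.F) : D.F →ₐ[k] D.F ⧸ R.ideal u := Ideal.Quotient.mkₐ k (R.ideal u)

theorem π_eq_zero {u : I → I → D.F} {a : D.F} (h : a ∈ R.rel u) : R.π u a = 0 :=
  Ideal.Quotient.eq_zero_iff_mem.2 (TwoSidedIdeal.mem_asIdeal.2 (TwoSidedIdeal.subset_span h))

theorem π_relator (u : I → I → D.F) {y : D.TV} (h : y ∈ R.carrier) :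
    R.π u (D.ofTV y) = 0 :=
  R.π_eq_zero (Or.inl ⟨y, h, rfl⟩)

theorem π_ad (u : I → I → D.F) {i j : I} (h : D.block j < D.block i) :
    R.π u (D.ofTV (D.ad i j)) = R.π u (u i j) := by
  rw [← sub_eq_zero, ← map_sub]
  exact R.π_eq_zero (Or.inr ⟨i, j, h, rfl⟩)

theorem eq_zero_of_mem_ideal {B : Type*} [Ring B] [Algebra k B] {u : I → I → D.F}
    (f : D.F →ₐ[k] B) (h1 : ∀ y ∈ R.carrier, f (D.ofTV y) = 0)
    (h2 : ∀ i j, D.block j < D.block i → f (D.ofTV (D.ad i j)) = f (u i j)) :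
    ∀ a ∈ R.ideal u, f a = 0 := by
  refine span_le_ker f ?_
  rintro a (⟨y, hy, rfl⟩ | ⟨i, j, hij, rfl⟩)
  · exact h1 y hy
  · rw [map_sub, h2 i j hij, sub_self]

/-- The coproduct of `F` induces `F / (u) → F / (v) ⊗ F / (w)` as soon as
`Δ (u i j) = v i j ⊗ 1 + g i g j ⊗ w i j` for all `(i, j) ∈ Θ`. -/
def comulQuot (u v w : I → I → D.F)
    (h : ∀ i j, D.block j < D.block i →
      D.comulF (u i j) = v i j ⊗ₜ 1 + D.ofΓ (D.g i * D.g j) ⊗ₜ w i j) :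
    (D.F ⧸ R.ideal u) →ₐ[k] (D.F ⧸ R.ideal v) ⊗[k] (D.F ⧸ R.ideal w) :=
  Ideal.Quotient.liftₐ _ ((Algebra.TensorProduct.map (R.π v) (R.π w)).comp D.comulF)
    (R.eq_zero_of_mem_ideal _
      (fun _ hy => D.map_comulF_relator R _ _ (fun _ => R.π_relator v)
        (fun _ => R.π_relator w) hy)
      (fun i j hij => by
        rw [AlgHom.comp_apply, AlgHom.comp_apply, D.isSkewPrim_ad hij, h i j hij, map_add, map_add]
        simp only [Algebra.TensorProduct.map_tmul, R.π_ad _ hij]))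

theorem comulQuot_π {u v w : I → I → D.F}
    (h : ∀ i j, D.block j < D.block i →
      D.comulF (u i j) = v i j ⊗ₜ 1 + D.ofΓ (D.g i * D.g j) ⊗ₜ w i j) (a : D.F) :
    R.comulQuot u v w h (R.π u a) =
      Algebra.TensorProduct.map (R.π v) (R.π w) (D.comulF a) := rfl

theorem isHopfIdeal {u : I → I → D.F}
    (h : ∀ i j, D.block j < D.block i → D.IsSkewPrim (D.g i * D.g j) (u i j)) :
    (R.ideal u).IsHopfIdeal k where
  counit_eq_zero := R.eq_zero_of_mem_ideal D.counitF
    (fun y hy => by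
      obtain ⟨l, g, hl, hg⟩ := D.exists_mem_homog R hy
      exact D.counitF_homog hl hg)
    (fun i j hij => by rw [(D.isSkewPrim_ad hij).counit, (h i j hij).counit])
  map_mkQ_comul_eq_zero := fun a ha => by
    have h1 : R.π u a = 0 := Ideal.Quotient.eq_zero_iff_mem.2 ha
    have h2 := R.comulQuot_π (u := u) (v := u) (w := u) h a
    rw [h1, map_zero] at h2
    exact h2.symm
  antipode_mem := fun a ha => by
    have h3 : ∀ a, D.antipodeF a = MulOpposite.op (D.S a) := fun a => rfl
    have h1 := R.eq_zero_of_mem_ideal ((R.π u).op.comp D.antipodeF)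
      (u := u)
      (fun y hy => by
        rw [AlgHom.comp_apply, h3]
        exact MulOpposite.unop_injective
          (D.map_antipode_relator R (R.π u) (fun _ => R.π_relator u) hy))
      (fun i j hij => by
        rw [AlgHom.comp_apply, AlgHom.comp_apply, h3, h3, (D.isSkewPrim_ad hij).antipode,
          (h i j hij).antipode]
        refine MulOpposite.unop_injective ?_
        change R.π u (-(_ * _)) = R.π u (-(_ * _))
        rw [map_neg, map_neg, map_mul, map_mul, R.π_ad _ hij]) a ha
    exact Ideal.Quotient.eq_zero_iff_mem.1 (congrArg MulOpposite.unop h1)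

variable (D) in
/-- The set `Ξ` of the pairs `(i, j)` with `block j < block i` and `χ i χ j = 1`. -/
def Xi : Set (I × I) := {p | D.block p.2 < D.block p.1 ∧ D.χ p.1 * D.χ p.2 = 1}

open Classical in
/-- Extension of a system of parameters `lam` on `Ξ` by zero. -/
def ext (lam : Xi D → k) (i j : I) : k := if h : (i, j) ∈ Xi D then lam ⟨(i, j), h⟩ else 0

/-- The Hopf algebra `H⁰ = F / (R⁰)`, where `R⁰` is the union of `R` with the elements
`(ad x i) (x j)`, `(i, j) ∈ Θ`. -/
abbrev H0 : Type (max u v w) := D.F ⧸ R.ideal 0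

/-- The elements `lam i j (g i) (g j)`. -/
def uA (lam : Xi D → k) (i j : I) : D.F := ext lam i j • D.ofΓ (D.g i * D.g j)

/-- The elements `lam i j (g i g j - 1)`. -/
def uH (lam : Xi D → k) (i j : I) : D.F := ext lam i j • (D.ofΓ (D.g i * D.g j) - 1)

/-- The algebra `A(lam) = F / (R(lam))`, where `R(lam)` is the union of `R` with the elements
`(ad x i) (x j) - lam i j (g i) (g j)`, `(i, j) ∈ Θ`. -/
abbrev A (lam : Xi D → k) : Type (max u v w) := D.F ⧸ R.ideal (uA lam)

/-- The Hopf algebra `H^lam = F / (R^lam)`, where `R^lam` is the union of `R` with the elements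
`(ad x i) (x j) - lam i j (g i g j - 1)`, `(i, j) ∈ Θ`. -/
abbrev Hlam (lam : Xi D → k) : Type (max u v w) := D.F ⧸ R.ideal (uH lam)

theorem isSkewPrim_uH (lam : Xi D → k) (i j : I) :
    D.IsSkewPrim (D.g i * D.g j) (uH lam i j) := by
  unfold IsSkewPrim uH
  simp only [map_smul, map_sub, comulF_ofΓ, map_one, TensorProduct.tmul_smul,
    ← TensorProduct.smul_tmul', TensorProduct.sub_tmul, TensorProduct.tmul_sub, smul_sub,
    Algebra.TensorProduct.one_def]
  abel

instance : (R.ideal 0).IsHopfIdeal k := R.isHopfIdeal fun i j _ => by simp [IsSkewPrim]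

instance (lam : Xi D → k) : (R.ideal (uH lam)).IsHopfIdeal k :=
  R.isHopfIdeal fun i j _ => isSkewPrim_uH lam i j

theorem comulQuot_coassoc {u v w v₁ v₂ t : I → I → D.F}
    (h₁ : ∀ i j, D.block j < D.block i →
      D.comulF (u i j) = v i j ⊗ₜ 1 + D.ofΓ (D.g i * D.g j) ⊗ₜ w i j)
    (h₂ : ∀ i j, D.block j < D.block i →
      D.comulF (v i j) = v₁ i j ⊗ₜ 1 + D.ofΓ (D.g i * D.g j) ⊗ₜ v₂ i j)
    (h₃ : ∀ i j, D.block j < D.block i →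
      D.comulF (u i j) = v₁ i j ⊗ₜ 1 + D.ofΓ (D.g i * D.g j) ⊗ₜ t i j)
    (h₄ : ∀ i j, D.block j < D.block i →
      D.comulF (t i j) = v₂ i j ⊗ₜ 1 + D.ofΓ (D.g i * D.g j) ⊗ₜ w i j)
    (a : D.F ⧸ R.ideal u) :
    TensorProduct.assoc k _ _ _ ((R.comulQuot v v₁ v₂ h₂).toLinearMap.rTensor _
        (R.comulQuot u v w h₁ a)) =
      (R.comulQuot t v₂ w h₄).toLinearMap.lTensor _ (R.comulQuot u v₁ t h₃ a) := by
  have key : (Algebra.TensorProduct.assoc k k k (D.F ⧸ R.ideal v₁) (D.F ⧸ R.ideal v₂)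
      (D.F ⧸ R.ideal w)).toAlgHom.comp ((Algebra.TensorProduct.map (R.comulQuot v v₁ v₂ h₂)
        (AlgHom.id k _)).comp (R.comulQuot u v w h₁)) =
      (Algebra.TensorProduct.map (AlgHom.id k _) (R.comulQuot t v₂ w h₄)).comp
        (R.comulQuot u v₁ t h₃) := by
    refine Ideal.Quotient.algHom_ext k (F_hom_ext (fun i => ?_) (fun g => ?_))
    · simp only [AlgHom.comp_apply, comulQuot_π, comulF_X, comulF_ofΓ, map_add, map_one,
        Algebra.TensorProduct.map_tmul, AlgHom.id_apply, TensorProduct.tmul_add,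
        TensorProduct.add_tmul, Algebra.TensorProduct.one_def, add_assoc, AlgEquiv.coe_toAlgHom, Algebra.TensorProduct.assoc_tmul]
    · simp only [AlgHom.comp_apply, comulQuot_π, comulF_ofΓ,
        Algebra.TensorProduct.map_tmul, AlgHom.id_apply, AlgEquiv.coe_toAlgHom, Algebra.TensorProduct.assoc_tmul]
  exact congrArg (fun f => f a) key

/-- The left `H⁰`-comodule algebra structure on `A(lam)` induced by the coproduct of `F`. -/
def coactL (lam : Xi D → k) : LeftCoaction k R.H0 (R.A lam) where
  coact := R.comulQuot (uA lam) 0 (uA lam) fun i j _ => by simp [uA, comulF_ofΓ]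
  coassoc a := R.comulQuot_coassoc _ (v₁ := 0) (v₂ := 0) (fun i j _ => by simp) _ _ a
  counit a := by
    have key : (Algebra.TensorProduct.lid k (R.A lam)).toAlgHom.comp
        ((Algebra.TensorProduct.map (Bialgebra.counitAlgHom k R.H0) (AlgHom.id k _)).comp
        (R.comulQuot (uA lam) 0 (uA lam) fun i j _ => by simp [uA, comulF_ofΓ])) =
        AlgHom.id k _ := by
      have e : ∀ a, Bialgebra.counitAlgHom k R.H0 (R.π 0 a) = D.counitF a := fun _ => rfl
      refine Ideal.Quotient.algHom_ext k (F_hom_ext (fun i => ?_) (fun g => ?_))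
      · simp only [AlgHom.comp_apply, comulQuot_π, comulF_X, map_add, map_one,
          Algebra.TensorProduct.map_tmul, AlgHom.id_apply, e, counitF_X, counitF_ofΓ,
          AlgEquiv.coe_toAlgHom, Algebra.TensorProduct.lid_tmul, zero_smul,
          one_smul, zero_add]
      · simp only [AlgHom.comp_apply, comulQuot_π, comulF_ofΓ,
          Algebra.TensorProduct.map_tmul, AlgHom.id_apply, e, counitF_ofΓ,
          AlgEquiv.coe_toAlgHom, Algebra.TensorProduct.lid_tmul, one_smul]
    exact congrArg (fun f => f a) key

/-- The right `H^lam`-comodule algebra structure on `A(lam)` induced by the coproduct of `F`. -/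
def coactR (lam : Xi D → k) : RightCoaction k (R.A lam) (R.Hlam lam) where
  coact := R.comulQuot (uA lam) (uA lam) (uH lam) fun i j _ => by
    simp [uA, uH, comulF_ofΓ, smul_sub, TensorProduct.tmul_sub, ← TensorProduct.smul_tmul']
  coassoc a := R.comulQuot_coassoc _ _ _ (fun i j _ => isSkewPrim_uH lam i j) a
  counit a := by
    have key : (Algebra.TensorProduct.rid k k (R.A lam)).toAlgHom.comp
        ((Algebra.TensorProduct.map (AlgHom.id k _) (Bialgebra.counitAlgHom k (R.Hlam lam))).comp
        (R.comulQuot (uA lam) (uA lam) (uH lam) fun i j _ => by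
          simp [uA, uH, comulF_ofΓ, smul_sub, TensorProduct.tmul_sub,
            ← TensorProduct.smul_tmul'])) =
        AlgHom.id k _ := by
      have e : ∀ a, Bialgebra.counitAlgHom k (R.Hlam lam) (R.π (uH lam) a) = D.counitF a :=
        fun _ => rfl
      refine Ideal.Quotient.algHom_ext k (F_hom_ext (fun i => ?_) (fun g => ?_))
      · simp only [AlgHom.comp_apply, comulQuot_π, comulF_X, map_add, map_one,
          Algebra.TensorProduct.map_tmul, AlgHom.id_apply, e, counitF_X,
          AlgEquiv.coe_toAlgHom, Algebra.TensorProduct.rid_tmul, zero_smul,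
          one_smul, add_zero]
      · simp only [AlgHom.comp_apply, comulQuot_π, comulF_ofΓ,
          Algebra.TensorProduct.map_tmul, AlgHom.id_apply, e, counitF_ofΓ,
          AlgEquiv.coe_toAlgHom, Algebra.TensorProduct.rid_tmul, one_smul]
    exact congrArg (fun f => f a) key

end Relators
/-! ### Filtered algebras and their associated graded algebras -/

section Filtration

/-- An increasing filtration of an algebra, indexed by `ℕ`. -/
structure AlgFiltration (k A : Type*) [CommRing k] [Ring A] [Algebra k A] where
  fil : ℕ → Submodule k A
  mono : Monotone fil
  one_mem : (1 : A) ∈ fil 0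
  mul_mem : ∀ {m n : ℕ} {a b : A}, a ∈ fil m → b ∈ fil n → a * b ∈ fil (m + n)

namespace AlgFiltration

variable {k A : Type*} [CommRing k] [Ring A] [Algebra k A] (𝓕 : AlgFiltration k A)

/-- The image filtration. -/
def map {B : Type*} [Ring B] [Algebra k B] (f : A →ₐ[k] B) : AlgFiltration k B where
  fil n := (𝓕.fil n).map f.toLinearMap
  mono _ _ h := Submodule.map_mono (𝓕.mono h)
  one_mem := ⟨1, 𝓕.one_mem, map_one f⟩
  mul_mem := by
    rintro m n _ _ ⟨a, ha, rfl⟩ ⟨b, hb, rfl⟩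
    exact ⟨a * b, 𝓕.mul_mem ha hb, map_mul f a b⟩

/-- The preceding term of the filtration: zero in degree `0`, and `fil (n - 1)` in degree `n > 0`. -/
def below : ℕ → Submodule k A
  | 0 => ⊥
  | n + 1 => 𝓕.fil n

/-- The homogeneous component `fil n / fil (n - 1)` of the associated graded algebra. -/
def Piece (n : ℕ) : Type _ := 𝓕.fil n ⧸ (𝓕.below n).submoduleOf (𝓕.fil n)

instance (n : ℕ) : AddCommGroup (𝓕.Piece n) :=
  inferInstanceAs (AddCommGroup (𝓕.fil n ⧸ (𝓕.below n).submoduleOf (𝓕.fil n)))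

instance (n : ℕ) : Module k (𝓕.Piece n) :=
  inferInstanceAs (Module k (𝓕.fil n ⧸ (𝓕.below n).submoduleOf (𝓕.fil n)))

/-- The quotient map from `fil n` to `fil n / fil (n - 1)`. -/
def toPiece (n : ℕ) : 𝓕.fil n →ₗ[k] 𝓕.Piece n := ((𝓕.below n).submoduleOf (𝓕.fil n)).mkQ

theorem toPiece_surjective (n : ℕ) : Function.Surjective (𝓕.toPiece n) :=
  Submodule.mkQ_surjective ((𝓕.below n).submoduleOf (𝓕.fil n))

theorem toPiece_eq_zero {n : ℕ} (a : 𝓕.fil n) : 𝓕.toPiece n a = 0 ↔ (a : A) ∈ 𝓕.below n := by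
  exact Submodule.Quotient.mk_eq_zero ((𝓕.below n).submoduleOf (𝓕.fil n))

theorem mul_mem_below_left {m n : ℕ} {a b : A} (ha : a ∈ 𝓕.below m) (hb : b ∈ 𝓕.fil n) :
    a * b ∈ 𝓕.below (m + n) := by
  cases m with
  | zero => rw [below, Submodule.mem_bot] at ha; simp [ha]
  | succ m =>
    have h := 𝓕.mul_mem (show a ∈ 𝓕.fil m from ha) hb
    rwa [show m + 1 + n = (m + n) + 1 by omega]

theorem mul_mem_below_right {m n : ℕ} {a b : A} (ha : a ∈ 𝓕.fil m) (hb : b ∈ 𝓕.below n) :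
    a * b ∈ 𝓕.below (m + n) := by
  cases n with
  | zero => rw [below, Submodule.mem_bot] at hb; simp [hb]
  | succ n => exact 𝓕.mul_mem ha (show b ∈ 𝓕.fil n from hb)

/-- The universal property of the components. -/
def liftPiece {n : ℕ} {B : Type*} [AddCommGroup B] [Module k B] (f : 𝓕.fil n →ₗ[k] B)
    (h : ∀ a : 𝓕.fil n, (a : A) ∈ 𝓕.below n → f a = 0) : 𝓕.Piece n →ₗ[k] B :=
  Submodule.liftQ ((𝓕.below n).submoduleOf (𝓕.fil n)) f h

theorem liftPiece_toPiece {n : ℕ} {B : Type*} [AddCommGroup B] [Module k B]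
    (f : 𝓕.fil n →ₗ[k] B) (h : ∀ a : 𝓕.fil n, (a : A) ∈ 𝓕.below n → f a = 0) (a : 𝓕.fil n) :
    𝓕.liftPiece f h (𝓕.toPiece n a) = f a := rfl

variable {𝓕} in
theorem piece_hom_ext {n : ℕ} {B : Type*} [AddCommGroup B] [Module k B] {f f' : 𝓕.Piece n →ₗ[k] B}
    (h : ∀ a, f (𝓕.toPiece n a) = f' (𝓕.toPiece n a)) : f = f' :=
  LinearMap.ext fun a => by
    obtain ⟨a, rfl⟩ := 𝓕.toPiece_surjective n a
    exact h a

/-- The multiplication `fil m × fil n → fil (m + n)`. -/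
def filMul (m n : ℕ) : 𝓕.fil m →ₗ[k] 𝓕.fil n →ₗ[k] 𝓕.fil (m + n) :=
  LinearMap.mk₂ k (fun a b => ⟨a * b, 𝓕.mul_mem a.2 b.2⟩)
    (fun _ _ _ => Subtype.ext (add_mul _ _ _)) (fun _ _ _ => Subtype.ext (smul_mul_assoc _ _ _))
    (fun _ _ _ => Subtype.ext (mul_add _ _ _)) (fun _ _ _ => Subtype.ext (mul_smul_comm _ _ _))

/-- The multiplication of homogeneous components induced by that of `A`. -/
def pieceMul (m n : ℕ) : 𝓕.Piece m →ₗ[k] 𝓕.Piece n →ₗ[k] 𝓕.Piece (m + n) :=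
  𝓕.liftPiece
    { toFun := fun a => 𝓕.liftPiece (𝓕.toPiece (m + n) ∘ₗ 𝓕.filMul m n a) (fun b hb =>
        (𝓕.toPiece_eq_zero _).2 (𝓕.mul_mem_below_right a.2 hb))
      map_add' := fun a a' => piece_hom_ext fun b => by simp [liftPiece_toPiece]
      map_smul' := fun c a => piece_hom_ext fun b => by simp [liftPiece_toPiece] }
    (fun a ha => piece_hom_ext fun b =>
      (𝓕.toPiece_eq_zero _).2 (𝓕.mul_mem_below_left ha b.2))

theorem pieceMul_toPiece {m n : ℕ} (a : 𝓕.fil m) (b : 𝓕.fil n) :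
    𝓕.pieceMul m n (𝓕.toPiece m a) (𝓕.toPiece n b) =
      𝓕.toPiece (m + n) ⟨a * b, 𝓕.mul_mem a.2 b.2⟩ := rfl

theorem mk_toPiece_eq {m n : ℕ} (h : m = n) (a : 𝓕.fil m) (b : 𝓕.fil n) (hab : (a : A) = b) :
    GradedMonoid.mk (A := 𝓕.Piece) m (𝓕.toPiece m a) = GradedMonoid.mk n (𝓕.toPiece n b) := by
  subst h
  rw [Subtype.ext hab]

instance : GradedMonoid.GMul 𝓕.Piece where
  mul a b := 𝓕.pieceMul _ _ a b

instance : GradedMonoid.GOne 𝓕.Piece where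
  one := 𝓕.toPiece 0 ⟨1, 𝓕.one_mem⟩

instance : DirectSum.GRing 𝓕.Piece where
  mul_zero a := map_zero (𝓕.pieceMul _ _ a)
  zero_mul b := by
    change 𝓕.pieceMul _ _ 0 b = 0
    rw [map_zero, LinearMap.zero_apply]
  mul_add a b c := map_add (𝓕.pieceMul _ _ a) b c
  add_mul a b c := by
    change 𝓕.pieceMul _ _ (a + b) c = _
    rw [map_add, LinearMap.add_apply]
    rfl
  one_mul := by
    rintro ⟨n, a⟩
    obtain ⟨a, rfl⟩ := 𝓕.toPiece_surjective n a
    exact 𝓕.mk_toPiece_eq (zero_add n) ⟨1 * a, 𝓕.mul_mem 𝓕.one_mem a.2⟩ a (one_mul _)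
  mul_one := by
    rintro ⟨n, a⟩
    obtain ⟨a, rfl⟩ := 𝓕.toPiece_surjective n a
    exact 𝓕.mk_toPiece_eq (add_zero n) ⟨a * 1, 𝓕.mul_mem a.2 𝓕.one_mem⟩ a (mul_one _)
  mul_assoc := by
    rintro ⟨l, a⟩ ⟨m, b⟩ ⟨n, c⟩
    obtain ⟨a, rfl⟩ := 𝓕.toPiece_surjective l a
    obtain ⟨b, rfl⟩ := 𝓕.toPiece_surjective m b
    obtain ⟨c, rfl⟩ := 𝓕.toPiece_surjective n c
    exact 𝓕.mk_toPiece_eq (add_assoc l m n)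
      ⟨a * b * c, 𝓕.mul_mem (𝓕.mul_mem a.2 b.2) c.2⟩
      ⟨a * (b * c), 𝓕.mul_mem a.2 (𝓕.mul_mem b.2 c.2)⟩ (mul_assoc _ _ _)
  natCast n := n • 𝓕.toPiece 0 ⟨1, 𝓕.one_mem⟩
  natCast_zero := zero_smul _ _
  natCast_succ n := succ_nsmul _ n
  intCast n := n • 𝓕.toPiece 0 ⟨1, 𝓕.one_mem⟩
  intCast_ofNat n := natCast_zsmul _ n
  intCast_negSucc_ofNat n := negSucc_zsmul _ n

theorem gmul_eq {m n : ℕ} (a : 𝓕.Piece m) (b : 𝓕.Piece n) :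
    GradedMonoid.GMul.mul a b = 𝓕.pieceMul m n a b := rfl

/-- The map from `k` to the zeroth component. -/
def algMap0 : k →ₗ[k] 𝓕.Piece 0 :=
  LinearMap.toSpanSingleton k _ (𝓕.toPiece 0 ⟨1, 𝓕.one_mem⟩)

theorem algMap0_apply (c : k) :
    𝓕.algMap0 c = 𝓕.toPiece 0 ⟨c • 1, Submodule.smul_mem _ c 𝓕.one_mem⟩ := rfl

instance : DirectSum.GAlgebra k 𝓕.Piece where
  toFun := 𝓕.algMap0.toAddMonoidHom
  map_one := one_smul k (𝓕.toPiece 0 ⟨1, 𝓕.one_mem⟩)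
  map_mul r s := 𝓕.mk_toPiece_eq rfl
    ⟨(r * s) • 1, Submodule.smul_mem _ _ 𝓕.one_mem⟩
    ⟨(r • 1) * (s • 1), 𝓕.mul_mem (Submodule.smul_mem _ r 𝓕.one_mem)
      (Submodule.smul_mem _ s 𝓕.one_mem)⟩ (by simp [mul_smul, smul_comm r s])
  commutes r := by
    rintro ⟨n, a⟩
    obtain ⟨a, rfl⟩ := 𝓕.toPiece_surjective n a
    exact 𝓕.mk_toPiece_eq (by rw [zero_add, add_zero])
      ⟨(r • 1) * a, 𝓕.mul_mem (Submodule.smul_mem _ r 𝓕.one_mem) a.2⟩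
      ⟨a * (r • 1), 𝓕.mul_mem a.2 (Submodule.smul_mem _ r 𝓕.one_mem)⟩ (by simp)
  smul_def r := by
    rintro ⟨n, a⟩
    obtain ⟨a, rfl⟩ := 𝓕.toPiece_surjective n a
    exact 𝓕.mk_toPiece_eq (zero_add n).symm
      ⟨r • a, Submodule.smul_mem _ r a.2⟩
      ⟨(r • 1) * a, 𝓕.mul_mem (Submodule.smul_mem _ r 𝓕.one_mem) a.2⟩ (by simp)

/-- The associated graded algebra `gr A = ⨁ n, fil n / fil (n - 1)`. -/
abbrev Gr : Type _ := DirectSum ℕ 𝓕.Piece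

/-- The symbol map `fil n → fil n / fil (n - 1) ⊆ gr A`. -/
def symbol (n : ℕ) : 𝓕.fil n →ₗ[k] 𝓕.Gr := DirectSum.lof k ℕ 𝓕.Piece n ∘ₗ 𝓕.toPiece n

/-- The homogeneous component of degree `n` of `gr A`. -/
def grDeg (n : ℕ) : Submodule k 𝓕.Gr := LinearMap.range (DirectSum.lof k ℕ 𝓕.Piece n)

theorem symbol_eq_zero {n : ℕ} (a : 𝓕.fil n) (h : (a : A) ∈ 𝓕.below n) : 𝓕.symbol n a = 0 := by
  rw [symbol, LinearMap.comp_apply, (𝓕.toPiece_eq_zero a).2 h, map_zero]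

theorem symbol_one : 𝓕.symbol 0 ⟨1, 𝓕.one_mem⟩ = 1 := rfl

theorem symbol_mul {m n : ℕ} (a : 𝓕.fil m) (b : 𝓕.fil n) :
    𝓕.symbol m a * 𝓕.symbol n b = 𝓕.symbol (m + n) ⟨a * b, 𝓕.mul_mem a.2 b.2⟩ :=
  DirectSum.of_mul_of (A := 𝓕.Piece) _ _

end AlgFiltration

/-- A module `M` with submodules `piece n` and linear maps `sym n` from them to a module `G`. It
stands for either a filtered algebra with its symbol maps to the associated graded algebra, or for
a graded algebra `M = G` with its homogeneous components. -/
structure Symbols (k M G : Type*) [CommRing k] [AddCommGroup M] [Module k M] [AddCommGroup G]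
    [Module k G] where
  piece : ℕ → Submodule k M
  sym : ∀ n, piece n →ₗ[k] G

/-- The symbol maps of a filtered algebra. -/
def AlgFiltration.symbols {k A : Type*} [CommRing k] [Ring A] [Algebra k A]
    (𝓕 : AlgFiltration k A) : Symbols k A 𝓕.Gr := ⟨𝓕.fil, 𝓕.symbol⟩

/-- A family of submodules, seen as homogeneous components. -/
def Symbols.ofGraded {k M : Type*} [CommRing k] [AddCommGroup M] [Module k M]
    (p : ℕ → Submodule k M) : Symbols k M M := ⟨p, fun n => (p n).subtype⟩

/-- The linear map `f : M → P ⊗ Q` is filtered, and `f'` is the map induced by `f` on the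
associated graded modules: every `m` in `M_n` has an image of the form `∑ t_(i, j)`, over
`i + j = n`, with `t_(i, j)` coming from `P_i ⊗ Q_j`; and for each such expression, `f'` sends the
symbol of `m` to the sum of the symbols of the `t_(i, j)`. -/
def InducesOnGr {k M P Q M' P' Q' : Type*} [CommRing k] [AddCommGroup M] [Module k M]
    [AddCommGroup P] [Module k P] [AddCommGroup Q] [Module k Q] [AddCommGroup M'] [Module k M']
    [AddCommGroup P'] [Module k P'] [AddCommGroup Q'] [Module k Q']
    (sM : Symbols k M M') (sP : Symbols k P P') (sQ : Symbols k Q Q')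
    (f : M →ₗ[k] P ⊗[k] Q) (f' : M' →ₗ[k] P' ⊗[k] Q') : Prop :=
  ∀ n (m : sM.piece n),
    (∃ t : ∀ p : Finset.HasAntidiagonal.antidiagonal n, sP.piece p.1.1 ⊗[k] sQ.piece p.1.2,
      f m = ∑ p, TensorProduct.map (sP.piece p.1.1).subtype (sQ.piece p.1.2).subtype (t p)) ∧
    ∀ t : ∀ p : Finset.HasAntidiagonal.antidiagonal n, sP.piece p.1.1 ⊗[k] sQ.piece p.1.2,
      f m = ∑ p, TensorProduct.map (sP.piece p.1.1).subtype (sQ.piece p.1.2).subtype (t p) →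
      f' (sM.sym n m) = ∑ p, TensorProduct.map (sP.sym p.1.1) (sQ.sym p.1.2) (t p)

/-- A Hopf algebra structure on a given algebra. -/
structure HopfStr (k A : Type*) [CommRing k] [Ring A] [Algebra k A] where
  comul : A →ₐ[k] A ⊗[k] A
  counit : A →ₐ[k] k
  antipode : A →ₗ[k] A
  coassoc : (Algebra.TensorProduct.assoc k k k A A A).toAlgHom.comp
      ((Algebra.TensorProduct.map comul (.id k A)).comp comul) =
    (Algebra.TensorProduct.map (.id k A) comul).comp comul
  counit_left : (Algebra.TensorProduct.map counit (.id k A)).comp comul =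
    (Algebra.TensorProduct.lid k A).symm
  counit_right : (Algebra.TensorProduct.map (.id k A) counit).comp comul =
    (Algebra.TensorProduct.rid k k A).symm
  antipode_left : ∀ a, LinearMap.mul' k A (antipode.rTensor A (comul a)) =
    algebraMap k A (counit a)
  antipode_right : ∀ a, LinearMap.mul' k A (antipode.lTensor A (comul a)) =
    algebraMap k A (counit a)

/-- The corresponding Mathlib Hopf algebra. -/
abbrev HopfStr.toHopfAlgebra {k A : Type*} [CommRing k] [Ring A] [Algebra k A]
    (𝓗 : HopfStr k A) : HopfAlgebra k A where
  __ := Bialgebra.ofAlgHom 𝓗.comul 𝓗.counit 𝓗.coassoc 𝓗.counit_left 𝓗.counit_right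
  antipode := 𝓗.antipode
  mul_antipode_rTensor_comul := LinearMap.ext 𝓗.antipode_left
  mul_antipode_lTensor_comul := LinearMap.ext 𝓗.antipode_right

end Filtration
/-! ### The gradings and filtrations of `F` and its quotients -/

namespace Datum

variable {k : Type u} {Γ : Type v} {I : Type w} [CommRing k] [CommGroup Γ] (D : Datum k Γ I)

/-- The homogeneous component of degree `n` of the graded Hopf algebra `F`, spanned by the elements
`a g` with `a` a word of length `n` in the `x i` and `g : Γ`. -/
def deg (n : ℕ) : Submodule k D.F :=
  Submodule.span k {a | ∃ (w : Fin n → I) (g : Γ), a = D.ofTV (D.word w) * D.ofΓ g}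

theorem act_word (g : Γ) {n : ℕ} (w : Fin n → I) : ∃ c : k, g • D.word w = c • D.word w := by
  unfold word
  induction n with
  | zero => exact ⟨1, by simp⟩
  | succ n ih =>
    obtain ⟨c, hc⟩ := ih fun s => w s.succ
    refine ⟨(D.χ (w 0) g : k) * c, ?_⟩
    simp only [List.ofFn_succ, List.prod_cons]
    rw [smul_mul', hc, smul_x, smul_mul_smul_comm]

theorem word_mul_word {m n : ℕ} (w : Fin m → I) (w' : Fin n → I) :
    D.word w * D.word w' = D.word (Fin.append w w') := by
  unfold word
  rw [← List.prod_append, ← List.ofFn_fin_append]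
  congr 2
  ext s
  refine Fin.addCases (fun i => ?_) (fun i => ?_) s <;> simp

theorem deg_mul {m n : ℕ} {a b : D.F} (ha : a ∈ D.deg m) (hb : b ∈ D.deg n) :
    a * b ∈ D.deg (m + n) := by
  induction ha using Submodule.span_induction with
  | zero => simp
  | add a a' _ _ h h' => rw [add_mul]; exact Submodule.add_mem _ h h'
  | smul r a _ h => rw [smul_mul_assoc]; exact Submodule.smul_mem _ _ h
  | mem a ha =>
    induction hb using Submodule.span_induction with
    | zero => simp
    | add b b' _ _ h h' => rw [mul_add]; exact Submodule.add_mem _ h h'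
    | smul r b _ h => rw [mul_smul_comm]; exact Submodule.smul_mem _ _ h
    | mem b hb =>
      obtain ⟨w, g, rfl⟩ := ha
      obtain ⟨w', g', rfl⟩ := hb
      obtain ⟨c, hc⟩ := D.act_word g w'
      have : D.ofTV (D.word w) * D.ofΓ g * (D.ofTV (D.word w') * D.ofΓ g') =
          c • (D.ofTV (D.word (Fin.append w w')) * D.ofΓ (g * g')) := by
        rw [mul_assoc, ← mul_assoc (D.ofΓ g), ofΓ_mul_ofTV, hc, map_smul, ← word_mul_word,
          map_mul, map_mul]
        simp only [smul_mul_assoc, mul_smul_comm, mul_assoc]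
      rw [this]
      exact Submodule.smul_mem _ _ (Submodule.subset_span ⟨_, _, rfl⟩)

theorem ofΓ_mem_deg (g : Γ) : D.ofΓ g ∈ D.deg 0 :=
  Submodule.subset_span ⟨Fin.elim0, g, by simp [word]⟩

theorem one_mem_deg : (1 : D.F) ∈ D.deg 0 := by
  have := D.ofΓ_mem_deg 1
  rwa [map_one] at this

theorem X_mem_deg (i : I) : D.X i ∈ D.deg 1 :=
  Submodule.subset_span ⟨fun _ => i, 1, by simp [word, X]⟩

/-- The filtration of `F` induced by its grading: `F_n` is the sum of the components of degree
`≤ n`. -/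
def filF : AlgFiltration k D.F where
  fil n := ⨆ (m : ℕ) (_ : m ≤ n), D.deg m
  mono n n' h := iSup_mono fun m => iSup_mono' fun hm => ⟨hm.trans h, le_rfl⟩
  one_mem := Submodule.mem_iSup_of_mem 0 (Submodule.mem_iSup_of_mem le_rfl D.one_mem_deg)
  mul_mem := by
    intro m n a b ha hb
    have h : (⨆ (i : ℕ) (_ : i ≤ m), D.deg i) * (⨆ (j : ℕ) (_ : j ≤ n), D.deg j) ≤
        ⨆ (l : ℕ) (_ : l ≤ m + n), D.deg l := by
      simp only [Submodule.iSup_mul, Submodule.mul_iSup]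
      refine iSup_le fun j => iSup_le fun hj => iSup_le fun i => iSup_le fun hi => ?_
      rw [Submodule.mul_le]
      intro a ha b hb
      exact Submodule.mem_iSup_of_mem (i + j) (Submodule.mem_iSup_of_mem (by omega)
        (D.deg_mul ha hb))
    exact h (Submodule.mul_mem_mul ha hb)

theorem deg_le_fil {m n : ℕ} (h : m ≤ n) : D.deg m ≤ D.filF.fil n :=
  fun _ ha => Submodule.mem_iSup_of_mem m (Submodule.mem_iSup_of_mem h ha)

end Datum

namespace Relators

variable {k : Type u} {Γ : Type v} {I : Type w} [CommRing k] [CommGroup Γ] {D : Datum k Γ I}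
  (R : Relators D)

open Datum

/-- The filtration of a quotient of `F` induced by that of `F`. -/
def filt (u : I → I → D.F) : AlgFiltration k (D.F ⧸ R.ideal u) := D.filF.map (R.π u)

/-- The homogeneous component of degree `n` of the graded Hopf algebra `H⁰`. -/
def H0deg (n : ℕ) : Submodule k R.H0 := (D.deg n).map (R.π 0).toLinearMap

theorem π_mem_filt (u : I → I → D.F) {n : ℕ} {a : D.F} (ha : a ∈ D.deg n) :
    R.π u a ∈ (R.filt u).fil n := ⟨a, D.deg_le_fil le_rfl ha, rfl⟩

theorem symbol_congr {B : Type*} [Ring B] [Algebra k B] (𝓕 : AlgFiltration k B) {n : ℕ}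
    {a b : 𝓕.fil n} (h : (a : B) = b) : 𝓕.symbol n a = 𝓕.symbol n b := by
  rw [Subtype.ext h]

/-- The epimorphism of graded algebras `F → gr (F / (u))` induced by the epimorphism of filtered
algebras `F → F / (u)`; see `grπ_apply`. -/
def grπ (u : I → I → D.F) : D.F →ₐ[k] (R.filt u).Gr :=
  D.liftF (fun i => (R.filt u).symbol 1 ⟨R.π u (D.X i), R.π_mem_filt u (D.X_mem_deg i)⟩)
    { toFun := fun g => (R.filt u).symbol 0 ⟨R.π u (D.ofΓ g), R.π_mem_filt u (D.ofΓ_mem_deg g)⟩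
      map_one' := by
        rw [← AlgFiltration.symbol_one]
        exact symbol_congr _ (by simp)
      map_mul' := fun g h => by
        rw [AlgFiltration.symbol_mul]
        exact symbol_congr _ (by simp) }
    (by
      intro g i
      change (R.filt u).symbol 0 _ * (R.filt u).symbol 1 _ =
        _ • ((R.filt u).symbol 1 _ * (R.filt u).symbol 0 _)
      rw [AlgFiltration.symbol_mul, AlgFiltration.symbol_mul, ← map_smul]
      refine symbol_congr _ ?_
      change R.π u _ * R.π u _ = _ • (R.π u _ * R.π u _)
      rw [← map_mul, ← map_mul, ofΓ_mul_X, map_smul])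

theorem grπ_X (u : I → I → D.F) (i : I) : R.grπ u (D.X i) =
    (R.filt u).symbol 1 ⟨R.π u (D.X i), R.π_mem_filt u (D.X_mem_deg i)⟩ := D.liftF_X _ _ _ i

theorem grπ_ofΓ (u : I → I → D.F) (g : Γ) : R.grπ u (D.ofΓ g) =
    (R.filt u).symbol 0 ⟨R.π u (D.ofΓ g), R.π_mem_filt u (D.ofΓ_mem_deg g)⟩ := D.liftF_ofΓ _ _ _ g

theorem word_mem_deg {n : ℕ} (w : Fin n → I) : D.ofTV (D.word w) ∈ D.deg n :=
  Submodule.subset_span ⟨w, 1, by simp⟩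

theorem grπ_word (u : I → I → D.F) {n : ℕ} (w : Fin n → I) : R.grπ u (D.ofTV (D.word w)) =
    (R.filt u).symbol n ⟨R.π u (D.ofTV (D.word w)), R.π_mem_filt u (word_mem_deg w)⟩ := by
  induction n with
  | zero =>
    have : D.ofTV (D.word w) = 1 := by simp [word]
    refine (congrArg (R.grπ u) this).trans ?_
    rw [map_one, ← AlgFiltration.symbol_one]
    refine symbol_congr _ ?_
    change 1 = R.π u _
    rw [this, map_one]
  | succ n ih =>
    have h : D.ofTV (D.word w) = D.ofTV (D.word fun s : Fin n => w s.castSucc) *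
        D.X (w (Fin.last n)) := by
      simp only [word]
      rw [List.ofFn_succ', List.concat_eq_append, List.prod_append, List.prod_singleton, map_mul]
      rfl
    refine (congrArg (R.grπ u) h).trans ?_
    rw [map_mul, ih, grπ_X, AlgFiltration.symbol_mul]
    refine symbol_congr _ ?_
    change R.π u _ * R.π u _ = R.π u _
    rw [h, map_mul]

/-- On the component of degree `n`, the map `F → gr (F / (u))` sends an element to the class of its
image in degree `n`. -/
theorem grπ_apply (u : I → I → D.F) {n : ℕ} {a : D.F} (ha : a ∈ D.deg n) :
    R.grπ u a = (R.filt u).symbol n ⟨R.π u a, R.π_mem_filt u ha⟩ := by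
  induction ha using Submodule.span_induction with
  | zero =>
    rw [map_zero, ← map_zero ((R.filt u).symbol n)]
    exact symbol_congr _ (map_zero _).symm
  | add a b ha hb h h' =>
    rw [map_add, h, h', ← map_add]
    exact symbol_congr _ (map_add _ _ _).symm
  | smul r a ha h =>
    rw [map_smul, h, ← map_smul]
    exact symbol_congr _ (map_smul _ _ _).symm
  | mem a ha =>
    obtain ⟨w, g, rfl⟩ := ha
    rw [map_mul, grπ_word, grπ_ofΓ, AlgFiltration.symbol_mul]
    exact symbol_congr _ (map_mul _ _ _).symm

theorem homog_le_deg {l : ℕ} {g : Γ} {y : D.TV} (hy : y ∈ D.homog l g) : D.ofTV y ∈ D.deg l := by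
  induction hy using Submodule.span_induction with
  | zero => simp
  | add a b _ _ ha hb => rw [map_add]; exact Submodule.add_mem _ ha hb
  | smul r a _ ha => rw [map_smul]; exact Submodule.smul_mem _ _ ha
  | mem v hv =>
    obtain ⟨w, -, rfl⟩ := hv
    exact word_mem_deg w

theorem ad_mem_deg (i j : I) : D.ofTV (D.ad i j) ∈ D.deg 2 := by
  have h : ∀ i j, D.ofTV (D.x i * D.x j) ∈ D.deg 2 := fun i j => by
    have e : D.ofTV (D.x i * D.x j) = D.X i * D.X j := map_mul D.ofTV _ _
    have h2 := D.deg_mul (D.X_mem_deg i) (D.X_mem_deg j)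
    rw [e]
    exact h2
  rw [ad, map_sub, map_smul]
  exact Submodule.sub_mem _ (h i j) (Submodule.smul_mem _ _ (h j i))

theorem grπ_eq_zero (u : I → I → D.F) {n : ℕ} {a : D.F} (ha : a ∈ D.deg n)
    (h : R.π u a ∈ (R.filt u).below n) : R.grπ u a = 0 :=
  (R.grπ_apply u ha).trans (AlgFiltration.symbol_eq_zero _ _ h)

theorem grπ_relator (u : I → I → D.F) {y : D.TV} (hy : y ∈ R.carrier) :
    R.grπ u (D.ofTV y) = 0 := by
  obtain ⟨l, g, -, hg⟩ := D.exists_mem_homog R hy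
  refine R.grπ_eq_zero u (homog_le_deg hg) ?_
  rw [R.π_relator u hy]
  exact Submodule.zero_mem _

theorem grπ_ad (u : I → I → D.F) (hu : ∀ i j, u i j ∈ D.deg 0) {i j : I}
    (hij : D.block j < D.block i) : R.grπ u (D.ofTV (D.ad i j)) = 0 := by
  refine R.grπ_eq_zero u (ad_mem_deg i j) ?_
  rw [R.π_ad u hij]
  exact (R.filt u).mono (Nat.zero_le 1) (R.π_mem_filt u (hu i j))

theorem grπ_ideal (u : I → I → D.F) (hu : ∀ i j, u i j ∈ D.deg 0) :
    ∀ a ∈ R.ideal 0, R.grπ u a = 0 :=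
  R.eq_zero_of_mem_ideal (R.grπ u) (fun _ hy => R.grπ_relator u hy)
    (fun _ _ hij => (R.grπ_ad u hu hij).trans (map_zero (R.grπ u)).symm)

/-- Algebra maps out of `H⁰`, from algebra maps out of `F`. -/
def descend {B : Type*} [Ring B] [Algebra k B] (f : D.F →ₐ[k] B) (h : ∀ a ∈ R.ideal 0, f a = 0) :
    R.H0 →ₐ[k] B :=
  Ideal.Quotient.liftₐ (R.ideal 0) f h

/-- The natural graded algebra map `H⁰ → gr (F / (u))` through which `F → gr (F / (u))` factors,
when the `u i j` lie in degree `0`. -/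
def natGr (u : I → I → D.F) (hu : ∀ i j, u i j ∈ D.deg 0) : R.H0 →ₐ[k] (R.filt u).Gr :=
  R.descend (R.grπ u) (R.grπ_ideal u hu)

theorem natGr_π (u : I → I → D.F) (hu : ∀ i j, u i j ∈ D.deg 0) (a : D.F) :
    R.natGr u hu (R.π 0 a) = R.grπ u a := rfl

theorem uA_mem_deg (lam : Xi D → k) (i j : I) : uA lam i j ∈ D.deg 0 :=
  Submodule.smul_mem _ _ (D.ofΓ_mem_deg _)

theorem uH_mem_deg (lam : Xi D → k) (i j : I) : uH lam i j ∈ D.deg 0 :=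
  Submodule.smul_mem _ _ (Submodule.sub_mem _ (D.ofΓ_mem_deg _) D.one_mem_deg)

/-- The associated graded algebra of `A(lam)`. -/
abbrev grA (lam : Xi D → k) : Type (max u v w) := (R.filt (uA lam)).Gr

/-- The associated graded algebra of `H^lam`. -/
abbrev grH (lam : Xi D → k) : Type (max u v w) := (R.filt (uH lam)).Gr

/-- The natural graded algebra map `H⁰ → gr A(lam)`. -/
def natA (lam : Xi D → k) : R.H0 →ₐ[k] R.grA lam := R.natGr (uA lam) (uA_mem_deg lam)

/-- The natural graded algebra map `H⁰ → gr H^lam`. -/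
def natH (lam : Xi D → k) : R.H0 →ₐ[k] R.grH lam := R.natGr (uH lam) (uH_mem_deg lam)

/-- `𝓗` is the Hopf algebra structure on `gr H^lam` induced by the filtered Hopf algebra `H^lam`. -/
def IsInducedHopf (lam : Xi D → k) (𝓗 : HopfStr k (R.grH lam)) : Prop :=
  InducesOnGr (R.filt (uH lam)).symbols (R.filt (uH lam)).symbols (R.filt (uH lam)).symbols
    (Coalgebra.comul (R := k) (A := R.Hlam lam)) 𝓗.comul.toLinearMap ∧
  ∀ n (a : (R.filt (uH lam)).fil n), 𝓗.counit ((R.filt (uH lam)).symbol n a) =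
    if n = 0 then Coalgebra.counit (R := k) (a : R.Hlam lam) else 0

end Relators

end LiftedHopf

end

/-!
The point is that `A(lam)` and `H^lam` are not smaller than `H⁰`: there are linear maps from them to
`H⁰` that are the identity up to terms of lower degree. Everything else follows formally.

*Contraction.* The coproduct of `F` induces a map `A(lam) → H⁰ ⊗ A(lam)`. Given a linear functional
`e` on `A(lam)` with `e g = 1` for all `g ∈ Γ`, the map `a ↦ a₁ e (a₂)` is a linear map
`A(lam) → H⁰`; lifted to `F`, it sends a word of length `n` to itself plus terms of lower degree
(`Datum.isUnitriangular_rContract`). The antipode turns `e` into a functional on the quotient `B` of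
`F` with the relations `ad i j = -lam i j`, and since the coproduct also induces maps
`H^lam → B ⊗ A(lam)` and `B → B ⊗ H⁰`, two contractions lead from `H^lam` to `H⁰`
(`Relators.isDeformation_uH`).

*The functional.* It is built block by block. Let `lam'` be obtained from `lam` by keeping only the
parameters `lam i j` with `i` in the first `r` blocks, and let `F` act on `H^lam'` as follows: `Γ`
and the `x j` of the first `r` blocks by left multiplication, an `x i` of the next block by
`b ↦ (g i) b₁ p (b₂)`, where `p` is the skew derivation `H^lam' → k` with `x j ↦ lam i j`, and the
other `x i` by zero (`Relators.stepRep`). Such skew derivations exist, being entries of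
representations by triangular matrices of size two (`Relators.skewExt`). The braided commutators
of these operators with left multiplications are the required multiples of `g i g j`. The relators
act by zero: by induction along the chain, a relator in the letters of the new block has vanishing
derivatives, being primitive modulo relators known to act by zero; so it commutes up to scalars with
left multiplications, and it kills `1` (`Relators.skewRep_relator`). Composing the action on `1`
with the counit gives a functional, and the convolution product of the functionals of all blocks is
`e` (`Relators.hasUnitFunctional_uA`).

*Consequences.* The maps to `H⁰`, composed with the projections of the graded algebra `H⁰`, invert
the natural maps `H⁰ → gr A(lam)` and `H⁰ → gr H^lam` (`Relators.IsDeformation.natGr_bijective`),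
and they extend the symbol maps of the two filtrations to linear maps that vanish on terms of lower
degree. The Hopf algebra structure and the coactions on the associated graded algebras are
transported from the coproduct of `H⁰`, which makes them cleft. That they are induced by the given
structures is seen with the extended symbol maps, which give sense to leading terms in tensor
products over a ring that need not be a field (`inducesOnGr`).
-/

noncomputable section

namespace LiftedHopf

universe u v w

/-! ### Words and relators -/

namespace Datum

variable {k : Type u} {Γ : Type v} {I : Type w} [CommRing k] [CommGroup Γ] (D : Datum k Γ I)

/-- The braid group permutes the letters of a word, up to scalars. -/
theorem tensorPow_mem_span_perm {l : ℕ} (w : Fin l → I) {ξ : Module.End k ((Fin l → I) →₀ k)}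
    (hξ : ξ ∈ D.braidAlg l) :
    D.tensorPow l (ξ (Finsupp.single w 1)) ∈
      Submodule.span k {a | ∃ e : Equiv.Perm (Fin l), a = D.word (w ∘ e)} := by
  let M : Submodule k ((Fin l → I) →₀ k) :=
    Submodule.span k {v | ∃ e : Equiv.Perm (Fin l), v = Finsupp.single (w ∘ e) 1}
  have hM : ∀ ξ ∈ D.braidAlg l, M ≤ M.comap ξ := by
    intro ξ hξ
    induction hξ using Algebra.adjoin_induction with
    | mem c hc =>
      refine Submodule.span_le.2 ?_
      rintro _ ⟨e, rfl⟩
      obtain ⟨s, h, rfl | rfl⟩ := hc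
      all_goals
        simp only [braidGen, braidGenInv, SetLike.mem_coe, Submodule.mem_comap,
          Finsupp.linearCombination_single, one_smul]
        rw [← mul_one (Units.val _), ← smul_eq_mul, ← Finsupp.smul_single]
        exact M.smul_mem _ (Submodule.subset_span
          ⟨(Equiv.swap (⟨s, by omega⟩ : Fin l) ⟨s + 1, h⟩).trans e, rfl⟩)
    | algebraMap r => exact fun v hv => M.smul_mem r hv
    | add a b _ _ ha hb => exact fun v hv => M.add_mem (ha hv) (hb hv)
    | mul a b _ _ ha hb => exact fun v hv => ha (hb hv)
  have hT : M ≤ Submodule.comap (D.tensorPow l)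
      (Submodule.span k {a | ∃ e : Equiv.Perm (Fin l), a = D.word (w ∘ e)}) := by
    refine Submodule.span_le.2 ?_
    rintro _ ⟨e, rfl⟩
    refine Submodule.subset_span ⟨e, ?_⟩
    simp [tensorPow]
  exact hT (hM ξ hξ (Submodule.subset_span ⟨Equiv.refl _, rfl⟩))

theorem map_word {E : Type*} [Ring E] [Algebra k E] (f : D.TV →ₐ[k] E) {l : ℕ} (w : Fin l → I) :
    f (D.word w) = (List.ofFn fun s => f (D.x (w s))).prod := by
  rw [word, map_list_prod, List.map_ofFn]
  rfl

/-- Two algebra maps on `TV` whose values on the letters of a word are proportional have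
proportional values on all combinations of the rearrangements of that word. -/
theorem map_eq_smul_of_mem_span_perm {E : Type*} [Ring E] [Algebra k E] (f φ : D.TV →ₐ[k] E)
    (c : I → k) {l : ℕ} {w : Fin l → I} (h : ∀ t, φ (D.x (w t)) = c (w t) • f (D.x (w t)))
    {y : D.TV} (hy : y ∈ Submodule.span k {a | ∃ e : Equiv.Perm (Fin l), a = D.word (w ∘ e)}) :
    φ y = (∏ t, c (w t)) • f y := by
  have key : ∀ (l : ℕ) (v : Fin l → I), (∀ t, φ (D.x (v t)) = c (v t) • f (D.x (v t))) →
      φ (D.word v) = (∏ t, c (v t)) • f (D.word v) := by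
    intro l
    induction l with
    | zero => intro v _; simp [word]
    | succ l ih =>
      intro v hv
      have := ih (fun t => v t.succ) (fun t => hv _)
      rw [map_word, map_word] at this ⊢
      rw [List.ofFn_succ, List.ofFn_succ, List.prod_cons, List.prod_cons, this, hv,
        smul_mul_smul_comm, Fin.prod_univ_succ]
  induction hy using Submodule.span_induction with
  | zero => simp
  | add a b _ _ ha hb => rw [map_add, map_add, ha, hb, smul_add]
  | smul r a _ ha => rw [map_smul, map_smul, ha, smul_comm]
  | mem v hv =>
    obtain ⟨e, rfl⟩ := hv
    rw [key l (w ∘ e) (fun t => h (e t))]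
    congr 1
    exact Equiv.prod_comp e fun t => c (w t)

/-- Every relator is a combination of the rearrangements of one word in the letters of one block. -/
theorem exists_word (R : Relators D) {y : D.TV} (hy : y ∈ R.carrier) :
    ∃ (s : Fin D.N) (l : ℕ) (w : Fin l → I), (∀ t, D.block (w t) = s) ∧
      y ∈ Submodule.span k {a | ∃ e : Equiv.Perm (Fin l), a = D.word (w ∘ e)} := by
  obtain ⟨l, w, hl, hw, ξ, hξ, rfl⟩ := R.form y hy
  exact ⟨D.block (w ⟨0, by omega⟩), l, w, fun t => hw _ _, D.tensorPow_mem_span_perm w hξ⟩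

theorem ofTV_word_succ {l : ℕ} (w : Fin (l + 1) → I) :
    D.ofTV (D.word w) = D.X (w 0) * D.ofTV (D.word fun t => w t.succ) := by
  rw [word, List.ofFn_succ, List.prod_cons, map_mul]
  rfl

theorem ofTV_word_last {l : ℕ} (w : Fin (l + 1) → I) :
    D.ofTV (D.word w) = D.ofTV (D.word fun t => w t.castSucc) * D.X (w (Fin.last l)) := by
  simp only [word]
  rw [List.ofFn_succ', List.concat_eq_append, List.prod_append, List.prod_singleton, map_mul]
  rfl

/-- An algebra map that kills the words of length two kills all homogeneous elements of degree at
least two. -/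
theorem map_homog_eq_zero {E : Type*} [Ring E] [Algebra k E] (f : D.F →ₐ[k] E)
    (h : ∀ i j, f (D.X i) * f (D.X j) = 0) {l : ℕ} (hl : 2 ≤ l) {g : Γ} {y : D.TV}
    (hy : y ∈ D.homog l g) : f (D.ofTV y) = 0 := by
  induction hy using Submodule.span_induction with
  | zero => simp
  | add a b _ _ ha hb => simp [ha, hb]
  | smul r a _ ha => simp [ha]
  | mem v hv =>
    obtain ⟨w, -, rfl⟩ := hv
    obtain ⟨m, rfl⟩ : ∃ m, l = m + 1 + 1 := ⟨l - 2, by omega⟩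
    rw [ofTV_word_succ, ofTV_word_succ, ← mul_assoc, map_mul, map_mul, h, zero_mul]

theorem map_homog_apply_eq_zero {M : Type*} [AddCommGroup M] [Module k M]
    (f : D.F →ₐ[k] Module.End k M) {m : M}
    (h : ∀ i, f (D.X i) m = 0) {l : ℕ} (hl : 1 ≤ l) {g : Γ} {y : D.TV}
    (hy : y ∈ D.homog l g) : f (D.ofTV y) m = 0 := by
  induction hy using Submodule.span_induction with
  | zero => simp
  | add a b _ _ ha hb => simp [ha, hb]
  | smul r a _ ha => simp [ha]
  | mem v hv =>
    obtain ⟨w, -, rfl⟩ := hv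
    obtain ⟨m, rfl⟩ : ∃ m, l = m + 1 := ⟨l - 1, by omega⟩
    rw [ofTV_word_last, map_mul, Module.End.mul_apply, h, map_zero]

/-! ### Two-dimensional representations -/

section triangular

variable (α β : Γ →* kˣ) (c : I → k)
  (h : ∀ g j, (α g : k) * c j = (D.χ j g : k) * (β g : k) * c j)

/-- The representation of `F` by upper triangular matrices in which `g` acts by
`diag (α g, β g)` and `x j` by `c j` times the matrix unit in the upper right corner. Its upper
right entry is an `(α, β)`-skew derivation `F → k` with `x j ↦ c j`. -/
def triRep : D.F →ₐ[k] Matrix (Fin 2) (Fin 2) k :=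
  D.liftF (fun j => !![0, c j; 0, 0])
    { toFun := fun g => !![(α g : k), 0; 0, (β g : k)]
      map_one' := by simp [Matrix.one_fin_two]
      map_mul' := fun g g' => by simp }
    (by
      intro g j
      ext a b
      fin_cases a <;> fin_cases b <;> simp [h g j]
      ring)

theorem triRep_X (j : I) : D.triRep α β c h (D.X j) = !![0, c j; 0, 0] := D.liftF_X _ _ _ j

theorem triRep_ofΓ (g : Γ) : D.triRep α β c h (D.ofΓ g) = !![(α g : k), 0; 0, (β g : k)] :=
  D.liftF_ofΓ _ _ _ g

/-- Relators have degree at least two, and the product of two strictly upper triangular matrices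
of size two vanishes. -/
theorem triRep_relator (R : Relators D) {y : D.TV} (hy : y ∈ R.carrier) :
    D.triRep α β c h (D.ofTV y) = 0 := by
  obtain ⟨l, g, hl, hg⟩ := D.exists_mem_homog R hy
  refine D.map_homog_eq_zero _ (fun i j => ?_) hl hg
  rw [triRep_X, triRep_X]
  ext a b
  fin_cases a <;> fin_cases b <;> simp

variable {B : Type*} [Ring B] [Algebra k B] (f : D.F →ₐ[k] B)

/-- The algebra map `a ↦ f (a₁) p (a₂)`, where `p` is the triangular representation `triRep`. -/
def triExt : D.F →ₐ[k] Matrix (Fin 2) (Fin 2) B :=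
  (matrixEquivTensor (Fin 2) k B).symm.toAlgHom.comp
    ((Algebra.TensorProduct.map f (D.triRep α β c h)).comp D.comulF)

theorem triExt_apply (a : D.F) : D.triExt α β c h f a = (matrixEquivTensor (Fin 2) k B).symm
    (Algebra.TensorProduct.map f (D.triRep α β c h) (D.comulF a)) := rfl

theorem triExt_X (j : I) : D.triExt α β c h f (D.X j) =
    !![f (D.X j), c j • f (D.ofΓ (D.g j)); 0, f (D.X j)] := by
  rw [triExt_apply, comulF_X, map_add, map_add, Algebra.TensorProduct.map_tmul,
    Algebra.TensorProduct.map_tmul, triRep_X, map_one, matrixEquivTensor_apply_symm,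
    matrixEquivTensor_apply_symm]
  ext a b
  fin_cases a <;> fin_cases b <;> simp [Algebra.smul_def, Algebra.commutes]

theorem triExt_ofΓ (g : Γ) : D.triExt α β c h f (D.ofΓ g) =
    !![(α g : k) • f (D.ofΓ g), 0; 0, (β g : k) • f (D.ofΓ g)] := by
  rw [triExt_apply, comulF_ofΓ, Algebra.TensorProduct.map_tmul, triRep_ofΓ,
    matrixEquivTensor_apply_symm]
  ext a b
  fin_cases a <;> fin_cases b <;> simp [Algebra.smul_def, Algebra.commutes]

theorem triExt_relator (R : Relators D) (hf : ∀ y ∈ R.carrier, f (D.ofTV y) = 0) {y : D.TV}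
    (hy : y ∈ R.carrier) : D.triExt α β c h f (D.ofTV y) = 0 := by
  rw [triExt_apply, D.map_comulF_relator R f _ hf
    (fun _ hy => D.triRep_relator α β c h R hy) hy, map_zero]

end triangular

end Datum

namespace Datum

variable {k : Type u} {Γ : Type v} {I : Type w} [CommRing k] [CommGroup Γ] (D : Datum k Γ I)

/-! ### Twists and intertwining relations -/

/-- The automorphism `a ↦ α (a₁) a₂` of `F`, where the character `α` of `Γ` is extended to `F` by
`α (x i) = 0`. -/
def twist (α : Γ →* kˣ) : D.F →ₐ[k] D.F :=
  D.liftF (fun i => (α (D.g i) : k) • D.X i)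
    { toFun := fun g => (α g : k) • D.ofΓ g
      map_one' := by simp
      map_mul' := fun g h => by
        rw [map_mul, map_mul, Units.val_mul, smul_mul_smul_comm] }
    (fun g i => by
      simp only [MonoidHom.coe_mk, OneHom.coe_mk, smul_mul_smul_comm, ofΓ_mul_X, smul_smul]
      congr 1
      ring)

theorem twist_X (α : Γ →* kˣ) (i : I) : D.twist α (D.X i) = (α (D.g i) : k) • D.X i :=
  D.liftF_X _ _ _ i

theorem twist_ofΓ (α : Γ →* kˣ) (g : Γ) : D.twist α (D.ofΓ g) = (α g : k) • D.ofΓ g :=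
  D.liftF_ofΓ _ _ _ g

/-- Intertwining relations between algebra maps on `F` may be checked on generators. -/
theorem mulVec_intertwine {n : Type*} [Fintype n] [DecidableEq n] {E : Type*} [Ring E]
    [Algebra k E] (v : D.F →ₐ[k] Matrix n n E) (f : D.F →ₐ[k] E) (C : n → E)
    (hX : ∀ i s, (v (D.X i)).mulVec C s = C s * f (D.X i))
    (hg : ∀ g s, (v (D.ofΓ g)).mulVec C s = C s * f (D.ofΓ g)) (a : D.F) (s : n) :
    (v a).mulVec C s = C s * f a := by
  revert s
  refine D.F_induction (p := fun a => ∀ s, (v a).mulVec C s = C s * f a) ?_ hX hg ?_ ?_ a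
  · intro c s
    rw [AlgHom.commutes, AlgHom.commutes, Algebra.algebraMap_eq_smul_one,
      Algebra.algebraMap_eq_smul_one, Matrix.smul_mulVec, Matrix.one_mulVec]
    simp
  · intro a b ha hb s
    rw [map_mul, map_mul, ← Matrix.mulVec_mulVec, ← mul_assoc, ← ha]
    simp only [Matrix.mulVec, dotProduct] at hb ⊢
    simp only [hb, Finset.sum_mul, mul_assoc]
  · intro a b ha hb s
    rw [map_add, map_add, Matrix.add_mulVec, Pi.add_apply, ha, hb, mul_add]

/-- A relation `ad i j = t (g i g j - 1)` that holds for `f` also holds for `triExt`, provided that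
`t α (g i g j) = t`. The upper right entries cancel because `q i j * q j i = 1`. -/
theorem triExt_ad {B : Type*} [Ring B] [Algebra k B] (f : D.F →ₐ[k] B) (α : Γ →* kˣ) (c : I → k)
    (h : ∀ g j, (α g : k) * c j = (D.χ j g : k) * ((1 : Γ →* kˣ) g : kˣ) * c j) {i j : I}
    (hij : D.block j < D.block i) {t : k}
    (hf : f (D.ofTV (D.ad i j)) = t • (f (D.ofΓ (D.g i * D.g j)) - 1))
    (ht : t * (α (D.g i * D.g j) : k) = t) :
    D.triExt α 1 c h f (D.ofTV (D.ad i j)) =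
      t • (D.triExt α 1 c h f (D.ofΓ (D.g i * D.g j)) - 1) := by
  have e : D.ofTV (D.ad i j) = D.X i * D.X j - (D.q i j : k) • (D.X j * D.X i) := by
    simp [ad, X]
  have h1 := congrArg f (D.ofΓ_mul_X (D.g i) j)
  have h2 := congrArg f (D.ofΓ_mul_X (D.g j) i)
  have hq : (D.q i j : k) * (D.χ i (D.g j) : k) = 1 := by
    rw [← Units.val_mul]
    exact congrArg Units.val (D.disconnected i j hij.ne')
  have hd : (D.χ j (D.g i) : k) = D.q i j := rfl
  rw [map_mul, map_smul, map_mul] at h1 h2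
  rw [e, map_sub, map_smul, map_mul, map_mul] at hf
  rw [e, map_sub, map_smul, map_mul, map_mul, triExt_X, triExt_X, triExt_ofΓ]
  ext a b
  fin_cases a <;> fin_cases b
  · simp [hf, smul_sub, smul_smul, ht, -map_mul]
  · simp [smul_smul, h1, h2, smul_add, hd]
    rw [mul_comm (c i), mul_left_comm, hq]
    simp [mul_comm]
    abel
  · simp
  · simp [hf, smul_sub]

end Datum

/-! ### Skew derivations of the quotients `H^lam` -/

namespace Relators

variable {k : Type u} {Γ : Type v} {I : Type w} [CommRing k] [CommGroup Γ] {D : Datum k Γ I}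
  (R : Relators D)

open Datum

theorem ext_ne_zero {lam : Xi D → k} {i j : I} (h : ext lam i j ≠ 0) :
    D.block j < D.block i ∧ ∀ g, (D.χ i g : k) * D.χ j g = 1 := by
  unfold ext at h
  split_ifs at h with h'
  · exact ⟨h'.1, fun g => by rw [← Units.val_mul, ← MonoidHom.mul_apply, h'.2]; rfl⟩
  · exact absurd rfl h

/-- The parameters `lam i j` with `i` in one of the blocks `0, …, r - 1`, the other ones being
replaced with zero. -/
def trunc (r : ℕ) (lam : Xi D → k) : Xi D → k :=
  fun p => if (D.block p.1.1 : ℕ) < r then lam p else 0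

theorem ext_trunc (r : ℕ) (lam : Xi D → k) (i j : I) :
    ext (trunc r lam) i j = if (D.block i : ℕ) < r then ext lam i j else 0 := by
  unfold ext trunc
  split_ifs <;> rfl

variable (r : ℕ) (lam : Xi D → k)

/-- This is where the condition `χ i * χ j = 1` on the support of `lam` is used: a skew derivation
with values `x j ↦ lam i j` needs the diagonal characters `(χ i)⁻¹` and `ε`. -/
theorem skew_compat (i : I) (g : Γ) (j : I) :
    ((D.χ i)⁻¹ g : kˣ) * ext lam i j =
      (D.χ j g : k) * ((1 : Γ →* kˣ) g : kˣ) * ext lam i j := by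
  by_cases h : ext lam i j = 0
  · rw [h, mul_zero, mul_zero]
  · have h1 := (ext_ne_zero h).2 g
    rw [MonoidHom.one_apply, Units.val_one, mul_one, MonoidHom.inv_apply]
    congr 1
    rw [← mul_one (Units.val _), ← h1, ← mul_assoc, Units.inv_mul, one_mul]

/-- On `F`, the map `a ↦ a₁ P (a₂)` with values in matrices over `H^lam'`, where `lam'` is the
truncation of `lam` and `P` is the triangular representation with diagonal characters `(χ i)⁻¹`,
`ε` and upper right entry `x j ↦ lam i j`. -/
def skewExtF (i : I) : D.F →ₐ[k] Matrix (Fin 2) (Fin 2) (R.Hlam (trunc r lam)) :=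
  D.triExt (D.χ i)⁻¹ 1 (ext lam i) (skew_compat lam i) (R.π (uH (trunc r lam)))

theorem skewExtF_X (i j : I) : R.skewExtF r lam i (D.X j) =
    !![R.π _ (D.X j), ext lam i j • R.π _ (D.ofΓ (D.g j)); 0, R.π _ (D.X j)] :=
  D.triExt_X _ _ _ _ _ j

theorem skewExtF_ofΓ (i : I) (g : Γ) : R.skewExtF r lam i (D.ofΓ g) =
    !![(((D.χ i g)⁻¹ : kˣ) : k) • R.π _ (D.ofΓ g), 0; 0, R.π _ (D.ofΓ g)] := by
  refine (D.triExt_ofΓ _ _ _ _ _ g).trans ?_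
  rw [MonoidHom.one_apply, Units.val_one, one_smul]
  rfl

/-- `skewExtF i` respects the relations of `H^lam'`. Where the parameter of such a relation is not
zero, its letters lie in blocks before that of `i`, and then `χ i (g j g l) = 1`. -/
theorem skewExtF_ad {i : I} (hi : (D.block i : ℕ) = r) {j l : I} (hjl : D.block l < D.block j) :
    R.skewExtF r lam i (D.ofTV (D.ad j l)) = R.skewExtF r lam i (uH (trunc r lam) j l) := by
  have had := R.π_ad (uH (trunc r lam)) hjl
  have e : ∀ {C : Type (max u v w)} [Ring C] [Algebra k C] (f : D.F →ₐ[k] C),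
      f (uH (trunc r lam) j l) = ext (trunc r lam) j l • (f (D.ofΓ (D.g j * D.g l)) - 1) :=
    fun f => by rw [uH, map_smul, map_sub, map_one]
  rw [e] at had ⊢
  refine D.triExt_ad _ _ _ _ hjl had ?_
  by_cases h : ext (trunc r lam) j l = 0
  · rw [h, zero_mul]
  · have hb : (D.block j : ℕ) < r := by
      by_contra h'
      exact h (by rw [ext_trunc, if_neg h'])
    have hji : D.block j ≠ D.block i := fun h' => by rw [h', hi] at hb; omega
    have hli : D.block l ≠ D.block i := fun h' => by
      have := Fin.lt_def.1 hjl; rw [h'] at this; omega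
    have k1 : D.χ i (D.g j * D.g l) * (D.χ j (D.g i) * D.χ l (D.g i)) = 1 := by
      rw [map_mul, mul_mul_mul_comm, D.disconnected j i hji, D.disconnected l i hli, one_mul]
    have k2 : D.χ j (D.g i) * D.χ l (D.g i) = 1 := by
      ext
      rw [Units.val_mul]
      exact (ext_ne_zero h).2 (D.g i)
    rw [k2, mul_one] at k1
    rw [MonoidHom.inv_apply, k1]
    simp

end Relators

namespace Datum

variable {k : Type u} {Γ : Type v} {I : Type w} [CommRing k] [CommGroup Γ] (D : Datum k Γ I)

/-- If conjugation by `L` satisfies on generators the rule of a skew derivation, with derivatives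
recorded by `triExt`, then any `a` with zero derivative commutes with `L` up to a twist. -/
theorem mul_eq_mul_twist {E : Type*} [Ring E] [Algebra k E] (f : D.F →ₐ[k] E) {j : I} (c : I → k)
    (h : ∀ g i, (((1 : Γ →* kˣ) g : kˣ) : k) * c i = (D.χ i g : k) * (D.χ j g : k) * c i)
    (a : D.F) (ha : D.triExt 1 (D.χ j) c h f a = f a • (1 : Matrix (Fin 2) (Fin 2) E)) {L G : E}
    (hX : ∀ i, f (D.X i) * L = (D.q i j : k) • (L * f (D.X i)) + c i • (f (D.ofΓ (D.g i)) * G))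
    (hXG : ∀ i, f (D.X i) * G = (D.q i j : k) • (G * f (D.X i)))
    (hgL : ∀ g, f (D.ofΓ g) * L = (D.χ j g : k) • (L * f (D.ofΓ g)))
    (hgG : ∀ g, f (D.ofΓ g) * G = G * f (D.ofΓ g)) :
    f a * L = L * f (D.twist (D.χ j) a) := by
  have hd : ∀ i, (D.χ j (D.g i) : k) = D.q i j := fun _ => rfl
  have key := D.mulVec_intertwine (D.triExt 1 (D.χ j) c h f) (f.comp (D.twist (D.χ j))) ![L, -G]
    (by
      intro i s
      rw [AlgHom.comp_apply, twist_X, map_smul, triExt_X]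
      fin_cases s
      · simp [Matrix.mulVec, dotProduct, Fin.sum_univ_two, hX, hd]
      · simp [Matrix.mulVec, dotProduct, Fin.sum_univ_two, hXG, hd])
    (by
      intro g s
      rw [AlgHom.comp_apply, twist_ofΓ, map_smul, triExt_ofΓ]
      fin_cases s
      · simp [Matrix.mulVec, dotProduct, Fin.sum_univ_two, hgL]
      · simp [Matrix.mulVec, dotProduct, Fin.sum_univ_two, hgG]) a 0
  rw [ha, Matrix.smul_one_eq_diagonal, Matrix.mulVec_diagonal] at key
  exact key

end Datum

namespace Relators

variable {k : Type u} {Γ : Type v} {I : Type w} [CommRing k] [CommGroup Γ] {D : Datum k Γ I}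
  (R : Relators D) (r : ℕ) (lam : Xi D → k)

open Datum

/-- The algebra map on `H^lam'` induced by `skewExtF`, for `i` in the first block not involved
in the truncation `lam'` of `lam`. -/
def skewExt {i : I} (hi : (D.block i : ℕ) = r) :
    R.Hlam (trunc r lam) →ₐ[k] Matrix (Fin 2) (Fin 2) (R.Hlam (trunc r lam)) :=
  Ideal.Quotient.liftₐ _ (R.skewExtF r lam i)
    (R.eq_zero_of_mem_ideal _
      (fun _ hy => D.triExt_relator _ _ _ _ _ R (fun _ => R.π_relator _) hy)
      (fun _ _ hjl => R.skewExtF_ad r lam hi hjl))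

theorem skewExt_π {i : I} (hi : (D.block i : ℕ) = r) (a : D.F) :
    R.skewExt r lam hi (R.π _ a) = R.skewExtF r lam i a := rfl

theorem skewExt_lower {i : I} (hi : (D.block i : ℕ) = r) (b : R.Hlam (trunc r lam)) :
    R.skewExt r lam hi b 1 0 = 0 ∧ R.skewExt r lam hi b 1 1 = b := by
  obtain ⟨a, rfl⟩ := Ideal.Quotient.mk_surjective b
  refine D.F_induction (p := fun a => R.skewExt r lam hi (R.π _ a) 1 0 = 0 ∧
    R.skewExt r lam hi (R.π _ a) 1 1 = R.π _ a) ?_ ?_ ?_ ?_ ?_ a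
  · intro c
    rw [AlgHom.commutes, AlgHom.commutes, Algebra.algebraMap_eq_smul_one,
      Algebra.algebraMap_eq_smul_one]
    simp
  · intro j
    rw [skewExt_π, skewExtF_X]
    simp
  · intro g
    rw [skewExt_π, skewExtF_ofΓ]
    simp
  · intro a b ha hb
    rw [map_mul, map_mul, Matrix.mul_apply, Matrix.mul_apply, Fin.sum_univ_two, Fin.sum_univ_two,
      ha.1, ha.2, hb.1, hb.2]
    simp
  · intro a b ha hb
    rw [map_add, map_add, Matrix.add_apply, Matrix.add_apply, ha.1, ha.2, hb.1, hb.2]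
    simp

open Classical in
/-- The operator `b ↦ (g i) b₁ p (b₂)` on `H^lam'` by which `x i` will act if it belongs to the
first block not involved in the truncation `lam'`; here `p` is the skew derivation with
`x j ↦ lam i j`. It is set to zero for the other `i`. -/
def skewOp (i : I) : Module.End k (R.Hlam (trunc r lam)) :=
  if hi : (D.block i : ℕ) = r then
    LinearMap.mulLeft k (R.π _ (D.ofΓ (D.g i))) ∘ₗ Matrix.entryLinearMap k _ 0 1 ∘ₗ
      (R.skewExt r lam hi).toLinearMap
  else 0

theorem skewOp_apply {i : I} (hi : (D.block i : ℕ) = r) (b : R.Hlam (trunc r lam)) :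
    R.skewOp r lam i b = R.π _ (D.ofΓ (D.g i)) * R.skewExt r lam hi b 0 1 := by
  rw [skewOp, dif_pos hi]
  rfl

theorem skewOp_eq_zero {i : I} (hi : (D.block i : ℕ) ≠ r) : R.skewOp r lam i = 0 := dif_neg hi

/-- The parameters `lam i j` with `i` in the block `r`. -/
def slice (i j : I) : k := if (D.block i : ℕ) = r then ext lam i j else 0

theorem slice_ne_zero {r : ℕ} {lam : Xi D → k} {i j : I} (h : slice r lam i j ≠ 0) :
    (D.block i : ℕ) = r ∧ ext lam i j ≠ 0 := by
  unfold slice at h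
  split_ifs at h with h'
  · exact ⟨h', h⟩
  · exact absurd rfl h

theorem skewOp_one (i : I) : R.skewOp r lam i 1 = 0 := by
  by_cases hi : (D.block i : ℕ) = r
  · rw [R.skewOp_apply r lam hi, map_one]
    simp
  · rw [R.skewOp_eq_zero r lam hi, LinearMap.zero_apply]

/-- Left multiplication on `H^lam'`, as a representation of `F`. -/
def regRep : D.F →ₐ[k] Module.End k (R.Hlam (trunc r lam)) :=
  (Algebra.lmul k (R.Hlam (trunc r lam))).comp (R.π _)

theorem regRep_apply (a : D.F) (b : R.Hlam (trunc r lam)) :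
    R.regRep r lam a b = R.π _ a * b := rfl

theorem regRep_ofΓ_mul_skewOp (g : Γ) (i : I) :
    R.regRep r lam (D.ofΓ g) * R.skewOp r lam i =
      (D.χ i g : k) • (R.skewOp r lam i * R.regRep r lam (D.ofΓ g)) := by
  refine LinearMap.ext fun b => ?_
  by_cases hi : (D.block i : ℕ) = r
  · have hc : D.ofΓ g * D.ofΓ (D.g i) = D.ofΓ (D.g i) * D.ofΓ g := by
      rw [← map_mul, mul_comm, map_mul]
    have hc' := congrArg (R.π (uH (trunc r lam))) hc
    rw [map_mul, map_mul] at hc'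
    rw [LinearMap.smul_apply, Module.End.mul_apply, Module.End.mul_apply, regRep_apply,
      regRep_apply, R.skewOp_apply r lam hi, R.skewOp_apply r lam hi, map_mul, skewExt_π,
      skewExtF_ofΓ, Matrix.mul_apply, Fin.sum_univ_two, ← mul_assoc, hc']
    simp [smul_smul, mul_assoc]
  · rw [R.skewOp_eq_zero r lam hi]
    simp

/-- The operators `skewOp i` satisfy the relations of `A(lam)` with left multiplications. -/
theorem skewOp_mul_regRep_X (i j : I) :
    R.skewOp r lam i * R.regRep r lam (D.X j) =
      (D.q i j : k) • (R.regRep r lam (D.X j) * R.skewOp r lam i) +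
        slice r lam i j • (R.regRep r lam (D.ofΓ (D.g i)) * R.regRep r lam (D.ofΓ (D.g j))) := by
  refine LinearMap.ext fun b => ?_
  by_cases hi : (D.block i : ℕ) = r
  · have h1 := congrArg (R.π (uH (trunc r lam))) (D.ofΓ_mul_X (D.g i) j)
    rw [map_mul, map_smul, map_mul] at h1
    simp only [LinearMap.add_apply, LinearMap.smul_apply, Module.End.mul_apply, regRep_apply]
    rw [R.skewOp_apply r lam hi, R.skewOp_apply r lam hi, map_mul, skewExt_π, skewExtF_X,
      Matrix.mul_apply, Fin.sum_univ_two, (R.skewExt_lower r lam hi b).2, slice, if_pos hi]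
    simp only [Matrix.of_apply, Matrix.cons_val_zero, Matrix.cons_val_one, mul_add,
      smul_mul_assoc, mul_smul_comm]
    congr 1
    rw [← mul_assoc, h1, smul_mul_assoc, mul_assoc]
    rfl
  · rw [R.skewOp_eq_zero r lam hi, slice, if_neg hi]
    simp

/-- The representation of `F` on `H^lam'` in which `x i` acts by `skewOp i`. -/
def skewRep : D.F →ₐ[k] Module.End k (R.Hlam (trunc r lam)) :=
  D.liftF (R.skewOp r lam) ((R.regRep r lam : D.F →* _).comp D.ofΓ)
    (R.regRep_ofΓ_mul_skewOp r lam)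

theorem skewRep_X (i : I) : R.skewRep r lam (D.X i) = R.skewOp r lam i := D.liftF_X _ _ _ i

theorem skewRep_ofΓ (g : Γ) : R.skewRep r lam (D.ofΓ g) = R.regRep r lam (D.ofΓ g) :=
  D.liftF_ofΓ _ _ _ g

/-- Relators are combinations of words in one block: they are killed by any algebra map that
agrees on each block with an algebra map that kills them. -/
theorem map_relator_of_block {E : Type*} [Ring E] [Algebra k E] (f : D.F →ₐ[k] E)
    (h : ∀ s : Fin D.N, ∃ φ : D.F →ₐ[k] E, (∀ y ∈ R.carrier, φ (D.ofTV y) = 0) ∧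
      ∀ i, D.block i = s → f (D.X i) = φ (D.X i)) {y : D.TV} (hy : y ∈ R.carrier) :
    f (D.ofTV y) = 0 := by
  obtain ⟨s, l, w, hw, hyw⟩ := D.exists_word R hy
  obtain ⟨φ, hφ, hf⟩ := h s
  have := D.map_eq_smul_of_mem_span_perm (φ.comp D.ofTV) (f.comp D.ofTV) (fun _ => 1)
    (fun t => by
      rw [one_smul]
      exact hf _ (hw t)) hyw
  rw [AlgHom.comp_apply, AlgHom.comp_apply, hφ y hy, smul_zero] at this
  exact this

theorem slice_compat (j : I) (g : Γ) (i : I) :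
    (((1 : Γ →* kˣ) g : kˣ) : k) * slice r lam i j =
      (D.χ i g : k) * (D.χ j g : k) * slice r lam i j := by
  by_cases h : slice r lam i j = 0
  · rw [h, mul_zero, mul_zero]
  · rw [(ext_ne_zero (slice_ne_zero h).2).2 g, MonoidHom.one_apply, Units.val_one]

/-- If the relators in `s` act by zero, then the action of a relator that is primitive modulo `s`
commutes, up to scalars, with left multiplication by the `x j`. -/
theorem skewRep_mul_regRep_X {s : Set D.TV} (hs : s ⊆ R.carrier)
    (h0 : ∀ y ∈ s, R.skewRep r lam (D.ofTV y) = 0) {y : D.TV} (hy : y ∈ R.carrier)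
    (hp : D.IsPrimitiveMod s y) (j : I) :
    ∃ c : k, R.skewRep r lam (D.ofTV y) * R.regRep r lam (D.X j) =
      c • (R.regRep r lam (D.X j) * R.skewRep r lam (D.ofTV y)) := by
  obtain ⟨l, g, hl, hg⟩ := D.exists_mem_homog R hy
  obtain ⟨-, l', w, -, hyw⟩ := D.exists_word R hy
  set f := R.skewRep r lam with hf
  set v := D.triExt 1 (D.χ j) (fun i => slice r lam i j) (slice_compat r lam j) f with hv
  -- The derivative of `y` in the direction of `x j` vanishes, since `y` is primitive.
  have hvy : v (D.ofTV y) = f (D.ofTV y) • (1 : Matrix (Fin 2) (Fin 2) _) := by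
    rw [hv, D.triExt_apply, D.map_comulF_primitive f _ h0
      (fun y h => D.triRep_relator _ _ _ _ R (hs h))
      (fun y h => by
        obtain ⟨l, g, -, hg⟩ := D.exists_mem_homog R (hs h)
        exact ⟨l, g, hg⟩) hp hg, D.triRep_relator _ _ _ _ R hy, TensorProduct.tmul_zero,
      add_zero, matrixEquivTensor_apply_symm, Matrix.map_one _ (map_zero _) (map_one _)]
  have key : f (D.ofTV y) * R.regRep r lam (D.X j) =
      R.regRep r lam (D.X j) * f (D.twist (D.χ j) (D.ofTV y)) := by
    have hgX : ∀ g, f (D.ofΓ g) * R.regRep r lam (D.X j) =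
        (D.χ j g : k) • (R.regRep r lam (D.X j) * f (D.ofΓ g)) := fun g => by
      rw [hf, skewRep_ofΓ, ← map_mul, ofΓ_mul_X, map_smul, map_mul]
    by_cases hj : (D.block j : ℕ) < r
    · refine D.mul_eq_mul_twist f _ (slice_compat r lam j) (D.ofTV y) hvy
        (G := R.regRep r lam (D.ofΓ (D.g j))) (fun i => ?_) (fun i => ?_) hgX (fun g => ?_)
      · rw [hf, skewRep_X, skewRep_ofΓ]
        exact R.skewOp_mul_regRep_X r lam i j
      · rw [hf, skewRep_X, R.regRep_ofΓ_mul_skewOp, smul_smul]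
        by_cases hi : (D.block i : ℕ) = r
        · have hq : (D.q i j : k) * (D.χ i (D.g j) : k) = 1 := by
            rw [← Units.val_mul]
            exact congrArg Units.val (D.disconnected i j (fun h => by rw [h] at hi; omega))
          rw [hq, one_smul]
        · rw [R.skewOp_eq_zero r lam hi, zero_mul, smul_zero]
      · rw [hf, skewRep_ofΓ, ← map_mul, ← map_mul, ← map_mul, ← map_mul, mul_comm]
    · refine D.mul_eq_mul_twist f _ (slice_compat r lam j) (D.ofTV y) hvy
        (G := 0) (fun i => ?_) (fun i => ?_) hgX (fun g => ?_)
      · have : slice r lam i j = 0 := by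
          by_contra h
          obtain ⟨h1, h2⟩ := slice_ne_zero h
          have := Fin.lt_def.1 (ext_ne_zero h2).1
          omega
        rw [hf, skewRep_X, R.skewOp_mul_regRep_X, this, zero_smul, zero_smul]
      · rw [zero_mul, mul_zero, smul_zero]
      · rw [zero_mul, mul_zero]
  have htw := D.map_eq_smul_of_mem_span_perm (f.comp D.ofTV)
    ((f.comp (D.twist (D.χ j))).comp D.ofTV) (fun i => (D.χ j (D.g i) : k))
    (fun t => by
      change f (D.twist (D.χ j) (D.X _)) = _ • f (D.X _)
      rw [twist_X, map_smul]) hyw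
  refine ⟨∏ t, (D.χ j (D.g (w t)) : k), ?_⟩
  refine key.trans ?_
  change _ * ((f.comp (D.twist (D.χ j))).comp D.ofTV) y = _
  rw [htw, mul_smul_comm]
  rfl

end Relators

/-! ### Vanishing of the relators -/

namespace Relators

variable {k : Type u} {Γ : Type v} {I : Type w} [CommRing k] [CommGroup Γ] {D : Datum k Γ I}
  (R : Relators D) (r : ℕ) (lam : Xi D → k)

open Datum

/-- Induction along the chain `R_(0) ⊆ R_(1) ⊆ ⋯` of sets of relators. -/
theorem relator_induction {P : D.TV → Prop}
    (h : ∀ s ⊆ R.carrier, (∀ y ∈ s, P y) → ∀ y ∈ R.carrier, D.IsPrimitiveMod s y → P y) :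
    ∀ y ∈ R.carrier, P y := by
  obtain ⟨L, Rh, h0, hL, hmono, hp⟩ := R.primitive
  have hsub : ∀ m n, m + n = L → Rh m ⊆ R.carrier := by
    intro m n
    induction n generalizing m with
    | zero => intro h; rw [← hL, ← h]; rfl
    | succ n ih => exact fun h => (hmono m (by omega)).trans (ih (m + 1) (by omega))
  have main : ∀ n, n ≤ L → ∀ y ∈ Rh n, P y := by
    intro n
    induction n with
    | zero => intro _ y hy; rw [h0] at hy; exact hy.elim
    | succ n ih =>
      intro hn y hy
      exact h (Rh n) (hsub n (L - n) (by omega)) (ih (by omega)) y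
        (hsub (n + 1) (L - (n + 1)) (by omega) hy) (hp n (by omega) y hy)
  intro y hy
  rw [← hL] at hy
  exact main L le_rfl y hy

theorem skewRep_mul_regRep_ofΓ {y : D.TV} (hy : y ∈ R.carrier) (g : Γ) :
    ∃ c : k, R.skewRep r lam (D.ofTV y) * R.regRep r lam (D.ofΓ g) =
      c • (R.regRep r lam (D.ofΓ g) * R.skewRep r lam (D.ofTV y)) := by
  obtain ⟨-, l, w, -, hyw⟩ := D.exists_word R hy
  have h := D.map_eq_smul_of_mem_span_perm ((R.skewRep r lam).comp D.ofTV)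
    (((R.skewRep r lam).comp D.ofTV).comp (D.act g⁻¹)) (fun i => (D.χ i g⁻¹ : k))
    (fun t => by rw [AlgHom.comp_apply, act_x, map_smul]) hyw
  have h1 := congrArg (R.skewRep r lam) (D.ofΓ_mul_ofTV g (D.act g⁻¹ y))
  rw [smul_def, ← AlgHom.comp_apply (D.act g), ← act_mul, mul_inv_cancel, act_one] at h1
  rw [map_mul, map_mul, skewRep_ofΓ] at h1
  refine ⟨∏ t, (D.χ (w t) g⁻¹ : k), h1.symm.trans
    ((congrArg (R.regRep r lam (D.ofΓ g) * ·) h).trans ?_)⟩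
  exact mul_smul_comm _ _ _

/-- Each relator kills `1`, since the last letter of every word does; and it commutes, up to
scalars, with the left multiplications, which generate the module from `1`. -/
theorem skewRep_relator : ∀ y ∈ R.carrier, R.skewRep r lam (D.ofTV y) = 0 := by
  refine R.relator_induction fun s hs h0 y hy hp => LinearMap.ext fun b => ?_
  obtain ⟨l, g, hl, hg⟩ := D.exists_mem_homog R hy
  obtain ⟨a, rfl⟩ := Ideal.Quotient.mk_surjective b
  -- `y` kills `1`, since the last letter of every word does, and `1` generates the module.
  have h1 : R.skewRep r lam (D.ofTV y) 1 = 0 :=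
    D.map_homog_apply_eq_zero _ (fun i => by rw [skewRep_X, skewOp_one]) (by omega) hg
  have key : ∀ a : D.F, ∀ b, R.skewRep r lam (D.ofTV y) b = 0 →
      R.skewRep r lam (D.ofTV y) (R.regRep r lam a b) = 0 := by
    have hcomm : ∀ (a : D.F), (∃ c : k, R.skewRep r lam (D.ofTV y) * R.regRep r lam a =
        c • (R.regRep r lam a * R.skewRep r lam (D.ofTV y))) → ∀ b,
        R.skewRep r lam (D.ofTV y) b = 0 →
        R.skewRep r lam (D.ofTV y) (R.regRep r lam a b) = 0 := by
      rintro a ⟨c, hc⟩ b hb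
      rw [← Module.End.mul_apply, hc, LinearMap.smul_apply, Module.End.mul_apply, hb, map_zero,
        smul_zero]
    intro a
    refine D.F_induction (p := fun a => ∀ b, R.skewRep r lam (D.ofTV y) b = 0 →
      R.skewRep r lam (D.ofTV y) (R.regRep r lam a b) = 0) ?_ ?_ ?_ ?_ ?_ a
    · intro c b hb
      rw [AlgHom.commutes, Module.algebraMap_end_apply, map_smul, hb, smul_zero]
    · exact fun i => hcomm _ (R.skewRep_mul_regRep_X r lam hs h0 hy hp i)
    · exact fun g => hcomm _ (R.skewRep_mul_regRep_ofΓ r lam hy g)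
    · intro a a' ha ha' b hb
      rw [map_mul, Module.End.mul_apply]
      exact ha _ (ha' b hb)
    · intro a a' ha ha' b hb
      rw [map_add, LinearMap.add_apply, map_add, ha b hb, ha' b hb, add_zero]
  have h2 := key a 1 h1
  rw [regRep_apply, mul_one] at h2
  exact h2

/-! ### Functionals that are equal to one on the group -/

/-- The elements `lam i j (g i g j) - lam' i j`, where `lam'` is the truncation of `lam` to the
first `r` blocks and `lam` is truncated to the first `r + 1` blocks. -/
def uStep (i j : I) : D.F :=
  ext (trunc (r + 1) lam) i j • D.ofΓ (D.g i * D.g j) - ext (trunc r lam) i j • 1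

/-- The representation of `F` on `H^lam'` in which `x i` acts by left multiplication if `i` belongs
to the first `r` blocks, as a skew derivation if it belongs to the next one, and by zero
otherwise. -/
def stepRep : D.F →ₐ[k] Module.End k (R.Hlam (trunc r lam)) :=
  D.liftF (fun i => if (D.block i : ℕ) < r then R.regRep r lam (D.X i) else R.skewOp r lam i)
    ((R.regRep r lam : D.F →* _).comp D.ofΓ) (fun g i => by
      split_ifs with h
      · change R.regRep r lam _ * _ = _ • (_ * R.regRep r lam _)
        rw [← map_mul, ← map_mul, ← map_smul, ofΓ_mul_X]
      · exact R.regRep_ofΓ_mul_skewOp r lam g i)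

theorem stepRep_X (i : I) : R.stepRep r lam (D.X i) =
    if (D.block i : ℕ) < r then R.regRep r lam (D.X i) else R.skewOp r lam i := D.liftF_X _ _ _ i

theorem stepRep_ofΓ (g : Γ) : R.stepRep r lam (D.ofΓ g) = R.regRep r lam (D.ofΓ g) :=
  D.liftF_ofΓ _ _ _ g

/-- Each relator involves one block only, and on each block `stepRep` agrees with left
multiplication or with `skewRep`. -/
theorem stepRep_relator {y : D.TV} (hy : y ∈ R.carrier) : R.stepRep r lam (D.ofTV y) = 0 := by
  refine R.map_relator_of_block (R.stepRep r lam) (fun s => ?_) hy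
  by_cases hs : (s : ℕ) < r
  · refine ⟨R.regRep r lam, fun y hy => ?_, fun i hi => ?_⟩
    · rw [regRep, AlgHom.comp_apply, R.π_relator _ hy, map_zero]
    · rw [stepRep_X, hi, if_pos hs]
  · refine ⟨R.skewRep r lam, R.skewRep_relator r lam, fun i hi => ?_⟩
    rw [stepRep_X, hi, if_neg hs, skewRep_X]

theorem stepRep_ad {i j : I} (hij : D.block j < D.block i) :
    R.stepRep r lam (D.ofTV (D.ad i j)) = R.stepRep r lam (uStep r lam i j) := by
  have hlt := Fin.lt_def.1 hij
  have e : D.ofTV (D.ad i j) = D.X i * D.X j - (D.q i j : k) • (D.X j * D.X i) := by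
    simp [ad, X]
  have hu : R.stepRep r lam (uStep r lam i j) =
      ext (trunc (r + 1) lam) i j • R.regRep r lam (D.ofΓ (D.g i * D.g j)) -
        ext (trunc r lam) i j • 1 := by
    rw [uStep, map_sub, map_smul, map_smul, map_one, stepRep_ofΓ]
  have he : R.stepRep r lam (D.ofTV (D.ad i j)) = R.stepRep r lam (D.X i) *
      R.stepRep r lam (D.X j) -
        (D.q i j : k) • (R.stepRep r lam (D.X j) * R.stepRep r lam (D.X i)) := by
    rw [e, map_sub, map_smul, map_mul, map_mul]
  rw [hu, he, stepRep_X, stepRep_X, ext_trunc, ext_trunc]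
  rcases lt_trichotomy (D.block i : ℕ) r with h | h | h
  · rw [if_pos h, if_pos (hlt.trans h), if_pos h, if_pos (by omega), ← map_mul, ← map_mul,
      ← map_smul, ← map_sub, ← e, regRep, AlgHom.comp_apply, R.π_ad _ hij, uH, ext_trunc,
      if_pos h, map_smul, map_sub, map_one, smul_sub, map_sub, map_smul, map_smul, map_one]
    rfl
  · rw [if_neg h.not_lt, if_pos (by omega), if_neg h.not_lt, if_pos (by omega), zero_smul,
      sub_zero, skewOp_mul_regRep_X, slice, if_pos h, add_sub_cancel_left, map_mul, map_mul]
  · rw [if_neg (by omega : ¬(D.block i : ℕ) < r), if_neg (by omega : ¬(D.block i : ℕ) < r + 1),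
      R.skewOp_eq_zero r lam (by omega : (D.block i : ℕ) ≠ r)]
    simp [h.le]

/-- A linear functional on the quotient `F / (u)` which takes the value `1` on all elements of
`Γ`. -/
def HasUnitFunctional (u : I → I → D.F) : Prop :=
  ∃ e : (D.F ⧸ R.ideal u) →ₗ[k] k, ∀ g, e (R.π u (D.ofΓ g)) = 1

/-- The functional is `a ↦ ε (a 1)`, where `a` acts by `stepRep` on `1 ∈ H^lam'`. -/
theorem hasUnitFunctional_uStep : R.HasUnitFunctional (uStep r lam) := by
  let f : (D.F ⧸ R.ideal (uStep r lam)) →ₐ[k] Module.End k (R.Hlam (trunc r lam)) :=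
    Ideal.Quotient.liftₐ _ (R.stepRep r lam) (R.eq_zero_of_mem_ideal _
      (fun _ => R.stepRep_relator r lam) (fun _ _ => R.stepRep_ad r lam))
  refine ⟨Coalgebra.counit (R := k) (A := R.Hlam (trunc r lam)) ∘ₗ
    LinearMap.applyₗ 1 ∘ₗ f.toLinearMap, fun g => ?_⟩
  have h : f (R.π _ (D.ofΓ g)) = R.regRep r lam (D.ofΓ g) := R.stepRep_ofΓ r lam g
  change Coalgebra.counit (R := k) (f (R.π _ (D.ofΓ g)) 1) = 1
  rw [h, regRep_apply, mul_one]
  exact D.counitF_ofΓ g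

variable {R} in
/-- The convolution product of two functionals that are equal to one on `Γ` is a third one. -/
theorem HasUnitFunctional.of_comulQuot {u v w : I → I → D.F}
    (h : ∀ i j, D.block j < D.block i →
      D.comulF (u i j) = v i j ⊗ₜ 1 + D.ofΓ (D.g i * D.g j) ⊗ₜ w i j)
    (hv : R.HasUnitFunctional v) (hw : R.HasUnitFunctional w) : R.HasUnitFunctional u := by
  obtain ⟨e, he⟩ := hv
  obtain ⟨e', he'⟩ := hw
  refine ⟨LinearMap.mul' k k ∘ₗ TensorProduct.map e e' ∘ₗ (R.comulQuot u v w h).toLinearMap,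
    fun g => ?_⟩
  simp only [LinearMap.comp_apply, AlgHom.toLinearMap_apply, comulQuot_π, comulF_ofΓ,
    Algebra.TensorProduct.map_tmul, TensorProduct.map_tmul, LinearMap.mul'_apply, he, he', mul_one]

/-- The coproduct of `F` induces a map from `A` for the first `r + 1` blocks to the tensor product
of `A` for the first `r` blocks with `F / (uStep)`, so that one block is added at a time. -/
theorem hasUnitFunctional_trunc : ∀ r, R.HasUnitFunctional (uA (trunc r lam))
  | 0 => by
    have h0 : uA (trunc 0 lam) = 0 := by
      funext i j
      simp [uA, ext_trunc]
    rw [h0]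
    exact ⟨Coalgebra.counit (R := k) (A := R.H0), D.counitF_ofΓ⟩
  | r + 1 => .of_comulQuot (fun i j _ => by
      simp only [uA, uStep, map_smul, comulF_ofΓ, TensorProduct.tmul_sub, TensorProduct.tmul_smul,
        ← TensorProduct.smul_tmul']
      abel) (hasUnitFunctional_trunc r) (R.hasUnitFunctional_uStep r lam)

theorem hasUnitFunctional_uA : R.HasUnitFunctional (uA lam) := by
  have h : trunc D.N lam = lam := funext fun p => if_pos (D.block p.1.1).isLt
  have := R.hasUnitFunctional_trunc lam D.N
  rwa [h] at this

end Relators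

/-! ### Contraction of the coproduct with a functional -/

namespace Datum

variable {k : Type u} {Γ : Type v} {I : Type w} [CommRing k] [CommGroup Γ] (D : Datum k Γ I)

theorem filF_le {n : ℕ} {M : Submodule k D.F} (h : ∀ m ≤ n, D.deg m ≤ M) : D.filF.fil n ≤ M :=
  iSup_le fun m => iSup_le fun hm => h m hm

theorem below_le {n : ℕ} {M : Submodule k D.F} (h : ∀ m < n, D.deg m ≤ M) :
    D.filF.below n ≤ M := by
  cases n with
  | zero => exact bot_le
  | succ n => exact D.filF_le fun m hm => h m (by omega)

theorem deg_le_below {m n : ℕ} (h : m < n) : D.deg m ≤ D.filF.below n := by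
  cases n with
  | zero => omega
  | succ n => exact D.deg_le_fil (by omega)

theorem exists_mem_fil (a : D.F) : ∃ n, a ∈ D.filF.fil n := by
  refine D.F_induction (p := fun a => ∃ n, a ∈ D.filF.fil n) ?_ ?_ ?_ ?_ ?_ a
  · intro c
    rw [Algebra.algebraMap_eq_smul_one]
    exact ⟨0, Submodule.smul_mem _ _ D.filF.one_mem⟩
  · exact fun i => ⟨1, D.deg_le_fil le_rfl (D.X_mem_deg i)⟩
  · exact fun g => ⟨0, D.deg_le_fil le_rfl (D.ofΓ_mem_deg g)⟩
  · rintro a b ⟨m, hm⟩ ⟨n, hn⟩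
    exact ⟨m + n, D.filF.mul_mem hm hn⟩
  · rintro a b ⟨m, hm⟩ ⟨n, hn⟩
    exact ⟨max m n, Submodule.add_mem _ (D.filF.mono (le_max_left m n) hm)
      (D.filF.mono (le_max_right m n) hn)⟩

/-- The map `a ↦ a₁ e (a₂)`. -/
def rContract (e : D.F →ₗ[k] k) : D.F →ₗ[k] D.F :=
  (TensorProduct.rid k D.F).toLinearMap ∘ₗ e.lTensor D.F ∘ₗ D.comulF.toLinearMap

/-- The map `a ↦ e (a₁) a₂`. -/
def lContract (e : D.F →ₗ[k] k) : D.F →ₗ[k] D.F :=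
  (TensorProduct.lid k D.F).toLinearMap ∘ₗ e.rTensor D.F ∘ₗ D.comulF.toLinearMap

theorem rContract_ofΓ (e : D.F →ₗ[k] k) (g : Γ) :
    D.rContract e (D.ofΓ g) = e (D.ofΓ g) • D.ofΓ g := by
  simp [rContract, comulF_ofΓ]

theorem lContract_ofΓ (e : D.F →ₗ[k] k) (g : Γ) :
    D.lContract e (D.ofΓ g) = e (D.ofΓ g) • D.ofΓ g := by
  simp [lContract, comulF_ofΓ]

theorem rContract_X_mul (e : D.F →ₗ[k] k) (i : I) (a : D.F) : D.rContract e (D.X i * a) =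
    D.X i * D.rContract e a +
      D.ofΓ (D.g i) * D.rContract (e ∘ₗ LinearMap.mulLeft k (D.X i)) a := by
  simp only [rContract, LinearMap.comp_apply, AlgHom.toLinearMap_apply, map_mul, comulF_X]
  generalize D.comulF a = t
  induction t using TensorProduct.induction_on with
  | zero => simp
  | add s t hs ht => simp only [mul_add, map_add, hs, ht]; abel
  | tmul b c => simp [add_mul]

theorem lContract_X_mul (e : D.F →ₗ[k] k) (i : I) (a : D.F) : D.lContract e (D.X i * a) =
    D.lContract (e ∘ₗ LinearMap.mulLeft k (D.X i)) a +
      D.X i * D.lContract (e ∘ₗ LinearMap.mulLeft k (D.ofΓ (D.g i))) a := by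
  simp only [lContract, LinearMap.comp_apply, AlgHom.toLinearMap_apply, map_mul, comulF_X]
  generalize D.comulF a = t
  induction t using TensorProduct.induction_on with
  | zero => simp
  | add s t hs ht => simp only [mul_add, map_add, hs, ht]; abel
  | tmul b c => simp [add_mul]

theorem X_mul_mem_fil (i : I) {n : ℕ} {a : D.F} (ha : a ∈ D.filF.fil n) :
    D.X i * a ∈ D.filF.fil (n + 1) := by
  rw [add_comm]
  exact D.filF.mul_mem (D.deg_le_fil le_rfl (D.X_mem_deg i)) ha

theorem X_mul_mem_below (i : I) {n : ℕ} {a : D.F} (ha : a ∈ D.filF.below n) :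
    D.X i * a ∈ D.filF.below (n + 1) := by
  rw [add_comm]
  exact D.filF.mul_mem_below_right (D.deg_le_fil le_rfl (D.X_mem_deg i)) ha

theorem ofΓ_mul_mem_fil (g : Γ) {n : ℕ} {a : D.F} (ha : a ∈ D.filF.fil n) :
    D.ofΓ g * a ∈ D.filF.fil n := by
  rw [← zero_add n]
  exact D.filF.mul_mem (D.deg_le_fil le_rfl (D.ofΓ_mem_deg g)) ha

/-- The linear endomorphism `ψ` of `F` is filtered and induces the identity on `gr F`. -/
def IsUnitriangular (ψ : D.F →ₗ[k] D.F) : Prop :=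
  ∀ n, ∀ a ∈ D.deg n, ψ a - a ∈ D.filF.below n

variable {D}

theorem IsUnitriangular.of_word {ψ : D.F →ₗ[k] D.F}
    (h : ∀ (n : ℕ) (w : Fin n → I) (g : Γ), ψ (D.ofTV (D.word w) * D.ofΓ g) -
      D.ofTV (D.word w) * D.ofΓ g ∈ D.filF.below n) : D.IsUnitriangular ψ := by
  intro n
  change D.deg n ≤ (D.filF.below n).comap (ψ - LinearMap.id)
  refine Submodule.span_le.2 ?_
  rintro _ ⟨w, g, rfl⟩
  exact h n w g

theorem IsUnitriangular.map_below {ψ : D.F →ₗ[k] D.F} (h : D.IsUnitriangular ψ) (n : ℕ) :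
    D.filF.below n ≤ (D.filF.below n).comap ψ := by
  refine D.below_le fun m hm a ha => ?_
  have h1 : ψ a - a ∈ D.filF.below n :=
    D.below_le (fun l hl => D.deg_le_below (hl.trans hm)) (h m a ha)
  rw [Submodule.mem_comap, ← sub_add_cancel (ψ a) a]
  exact Submodule.add_mem _ h1 (D.deg_le_below hm ha)

theorem IsUnitriangular.comp {ψ φ : D.F →ₗ[k] D.F} (hψ : D.IsUnitriangular ψ)
    (hφ : D.IsUnitriangular φ) : D.IsUnitriangular (ψ ∘ₗ φ) := by
  intro n a ha
  have h1 : ψ (φ a - a) ∈ D.filF.below n := hψ.map_below n (hφ n a ha)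
  rw [map_sub] at h1
  rw [LinearMap.comp_apply, ← sub_add_sub_cancel _ (ψ a)]
  exact Submodule.add_mem _ h1 (hψ n a ha)

variable (D)

theorem rContract_mem_fil (e : D.F →ₗ[k] k) {n : ℕ} (w : Fin n → I) (g : Γ) :
    D.rContract e (D.ofTV (D.word w) * D.ofΓ g) ∈ D.filF.fil n := by
  induction n generalizing e with
  | zero =>
    rw [show D.ofTV (D.word w) = 1 by simp [word], one_mul, rContract_ofΓ]
    exact Submodule.smul_mem _ _ (D.deg_le_fil le_rfl (D.ofΓ_mem_deg g))
  | succ n ih =>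
    rw [ofTV_word_succ, mul_assoc, rContract_X_mul]
    exact Submodule.add_mem _ (D.X_mul_mem_fil _ (ih _ _))
      (D.filF.mono n.le_succ (D.ofΓ_mul_mem_fil _ (ih _ _)))

theorem lContract_mem_fil (e : D.F →ₗ[k] k) {n : ℕ} (w : Fin n → I) (g : Γ) :
    D.lContract e (D.ofTV (D.word w) * D.ofΓ g) ∈ D.filF.fil n := by
  induction n generalizing e with
  | zero =>
    rw [show D.ofTV (D.word w) = 1 by simp [word], one_mul, lContract_ofΓ]
    exact Submodule.smul_mem _ _ (D.deg_le_fil le_rfl (D.ofΓ_mem_deg g))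
  | succ n ih =>
    rw [ofTV_word_succ, mul_assoc, lContract_X_mul]
    exact Submodule.add_mem _ (D.filF.mono n.le_succ (ih _ _)) (D.X_mul_mem_fil _ (ih _ _))

/-- Let `a` be the product of a word and some `h ∈ Γ`. In the coproduct of `a`, every term but
`a ⊗ h` has a first tensor factor of lower degree. -/
theorem isUnitriangular_rContract {e : D.F →ₗ[k] k} (he : ∀ g, e (D.ofΓ g) = 1) :
    D.IsUnitriangular (D.rContract e) := by
  refine .of_word fun n => ?_
  induction n with
  | zero =>
    intro w g
    rw [show D.ofTV (D.word w) = 1 by simp [word], one_mul, rContract_ofΓ, he, one_smul, sub_self]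
    exact Submodule.zero_mem _
  | succ n ih =>
    intro w g
    rw [ofTV_word_succ, mul_assoc, rContract_X_mul, add_sub_right_comm, ← mul_sub]
    exact Submodule.add_mem _ (D.X_mul_mem_below _ (ih _ g))
      (D.ofΓ_mul_mem_fil _ (D.rContract_mem_fil _ _ g))

/-- Let `a` be the product of a word and some `h ∈ Γ`. In the coproduct of `a`, every term but
one of the form `g ⊗ a` with `g ∈ Γ` has a second tensor factor of lower degree. -/
theorem isUnitriangular_lContract {e : D.F →ₗ[k] k} (he : ∀ g, e (D.ofΓ g) = 1) :
    D.IsUnitriangular (D.lContract e) := by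
  refine .of_word fun n => ?_
  induction n generalizing e with
  | zero =>
    intro w g
    rw [show D.ofTV (D.word w) = 1 by simp [word], one_mul, lContract_ofΓ, he, one_smul, sub_self]
    exact Submodule.zero_mem _
  | succ n ih =>
    intro w g
    rw [ofTV_word_succ, mul_assoc, lContract_X_mul, add_sub_assoc, ← mul_sub]
    refine Submodule.add_mem _ (D.lContract_mem_fil _ _ g)
      (D.X_mul_mem_below _ (ih (fun h => ?_) _ g))
    rw [LinearMap.comp_apply, LinearMap.mulLeft_apply, ← map_mul, he]

end Datum

/-! ### Deformations of `H⁰` -/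

namespace Relators

variable {k : Type u} {Γ : Type v} {I : Type w} [CommRing k] [CommGroup Γ] {D : Datum k Γ I}
  (R : Relators D) (lam : Xi D → k)

open Datum

/-- The elements `-lam i j` of degree zero. -/
def uInv (i j : I) : D.F := -(ext lam i j • 1)

/-- The antipode turns functionals on `A(lam)` into functionals on the quotient of `F` in which the
braided commutators are equal to `-lam i j`. -/
theorem hasUnitFunctional_uInv : R.HasUnitFunctional (uInv lam) := by
  obtain ⟨e, he⟩ := R.hasUnitFunctional_uA lam
  have h3 : ∀ a, D.antipodeF a = MulOpposite.op (D.S a) := fun a => rfl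
  let f : (D.F ⧸ R.ideal (uInv lam)) →ₐ[k] (R.A lam)ᵐᵒᵖ :=
    Ideal.Quotient.liftₐ _ ((R.π (uA lam)).op.comp D.antipodeF) (R.eq_zero_of_mem_ideal _
      (fun y hy => by
        rw [AlgHom.comp_apply, h3]
        exact MulOpposite.unop_injective
          (D.map_antipode_relator R (R.π _) (fun _ => R.π_relator _) hy))
      (fun i j hij => by
        rw [AlgHom.comp_apply, AlgHom.comp_apply, h3, h3, (D.isSkewPrim_ad hij).antipode]
        refine MulOpposite.unop_injective ?_
        change R.π (uA lam) (-(_ * _)) = R.π (uA lam) (D.S (-(ext lam i j • 1)))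
        rw [map_neg, map_mul, R.π_ad _ hij, ← map_mul, uA, mul_smul_comm, ← map_mul,
          inv_mul_cancel, map_one, map_neg D.S, map_smul D.S, S_one, map_neg]))
  refine ⟨e ∘ₗ (MulOpposite.opLinearEquiv k).symm.toLinearMap ∘ₗ f.toLinearMap, fun g => ?_⟩
  have : (f (R.π _ (D.ofΓ g))).unop = R.π _ (D.ofΓ g⁻¹) := congrArg (R.π _) (D.S_ofΓ g)
  exact (congrArg e this).trans (he _)

/-- If the coproduct of `F` induces a map `F / (u) → F / (v) ⊗ F / (w)`, then contraction with a
functional on `F / (w)` induces a map `F / (u) → F / (v)`. -/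
theorem rContract_mem_ideal {u v w : I → I → D.F}
    (h : ∀ i j, D.block j < D.block i →
      D.comulF (u i j) = v i j ⊗ₜ 1 + D.ofΓ (D.g i * D.g j) ⊗ₜ w i j)
    (e : (D.F ⧸ R.ideal w) →ₗ[k] k) {a : D.F} (ha : a ∈ R.ideal u) :
    D.rContract (e ∘ₗ (R.π w).toLinearMap) a ∈ R.ideal v := by
  have h1 : R.π u a = 0 := Ideal.Quotient.eq_zero_iff_mem.2 ha
  have h2 := R.comulQuot_π h a
  rw [h1, map_zero] at h2
  refine Ideal.Quotient.eq_zero_iff_mem.1 ?_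
  have h3 : ∀ t : D.F ⊗[k] D.F,
      R.π v (TensorProduct.rid k D.F ((e ∘ₗ (R.π w).toLinearMap).lTensor D.F t)) =
      TensorProduct.rid k _ (e.lTensor _ (Algebra.TensorProduct.map (R.π v) (R.π w) t)) := by
    intro t
    induction t using TensorProduct.induction_on with
    | zero => simp
    | add s t hs ht => simp only [map_add, hs, ht]
    | tmul b c => simp
  refine (h3 (D.comulF a)).trans ?_
  rw [← h2, map_zero, map_zero]

theorem lContract_mem_ideal {u v w : I → I → D.F}
    (h : ∀ i j, D.block j < D.block i →
      D.comulF (u i j) = v i j ⊗ₜ 1 + D.ofΓ (D.g i * D.g j) ⊗ₜ w i j)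
    (e : (D.F ⧸ R.ideal v) →ₗ[k] k) {a : D.F} (ha : a ∈ R.ideal u) :
    D.lContract (e ∘ₗ (R.π v).toLinearMap) a ∈ R.ideal w := by
  have h1 : R.π u a = 0 := Ideal.Quotient.eq_zero_iff_mem.2 ha
  have h2 := R.comulQuot_π h a
  rw [h1, map_zero] at h2
  refine Ideal.Quotient.eq_zero_iff_mem.1 ?_
  have h3 : ∀ t : D.F ⊗[k] D.F,
      R.π w (TensorProduct.lid k D.F ((e ∘ₗ (R.π v).toLinearMap).rTensor D.F t)) =
      TensorProduct.lid k _ (e.rTensor _ (Algebra.TensorProduct.map (R.π v) (R.π w) t)) := by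
    intro t
    induction t using TensorProduct.induction_on with
    | zero => simp
    | add s t hs ht => simp only [map_add, hs, ht]
    | tmul b c => simp
  refine (h3 (D.comulF a)).trans ?_
  rw [← h2, map_zero, map_zero]

/-- Some unitriangular endomorphism of `F` induces a map `F / (u) → H⁰`. -/
def IsDeformation (u : I → I → D.F) : Prop :=
  ∃ ψ : D.F →ₗ[k] D.F, D.IsUnitriangular ψ ∧ ∀ a ∈ R.ideal u, ψ a ∈ R.ideal 0

theorem isDeformation_uA : R.IsDeformation (uA lam) := by
  obtain ⟨e, he⟩ := R.hasUnitFunctional_uA lam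
  exact ⟨_, D.isUnitriangular_rContract (e := e ∘ₗ (R.π _).toLinearMap) he, fun a ha =>
    R.rContract_mem_ideal (w := uA lam) (fun i j _ => by simp [uA, comulF_ofΓ]) e ha⟩

/-- The map `H^lam → H⁰` goes through the quotient of `F` by the relations `ad i j = -lam i j`: two
contractions, on the right and on the left, change the parameters to zero one after the other. -/
theorem isDeformation_uH : R.IsDeformation (uH lam) := by
  obtain ⟨e, he⟩ := R.hasUnitFunctional_uA lam
  obtain ⟨e', he'⟩ := R.hasUnitFunctional_uInv lam
  refine ⟨_, (D.isUnitriangular_lContract (e := e' ∘ₗ (R.π _).toLinearMap) he').comp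
    (D.isUnitriangular_rContract (e := e ∘ₗ (R.π _).toLinearMap) he),
    fun a ha => ?_⟩
  refine R.lContract_mem_ideal (u := uInv lam) (v := uInv lam)
    (fun i j _ => ?_) e' (R.rContract_mem_ideal (v := uInv lam) (w := uA lam)
      (fun i j _ => ?_) e ha)
  · simp [uInv, Algebra.TensorProduct.one_def, TensorProduct.neg_tmul, TensorProduct.smul_tmul']
  · simp only [uInv, uA, uH, map_smul, map_sub, map_one, comulF_ofΓ, TensorProduct.neg_tmul,
      ← TensorProduct.smul_tmul', Algebra.TensorProduct.one_def, TensorProduct.tmul_smul, smul_sub]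
    abel

end Relators

/-! ### The grading of `F` -/

namespace Datum

variable {k : Type u} {Γ : Type v} {I : Type w} [CommRing k] [CommGroup Γ] (D : Datum k Γ I)

theorem exists_leading {n : ℕ} {b : D.F} (hb : b ∈ D.filF.fil n) :
    ∃ c ∈ D.deg n, b - c ∈ D.filF.below n := by
  have h : D.filF.fil n ≤ D.deg n ⊔ D.filF.below n := D.filF_le fun m hm => by
    rcases hm.lt_or_eq with h | rfl
    · exact (D.deg_le_below h).trans le_sup_right
    · exact le_sup_left
  obtain ⟨c, hc, d, hd, rfl⟩ := Submodule.mem_sup.1 (h hb)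
  exact ⟨c, hc, by rwa [add_sub_cancel_left]⟩

section gradeMap

theorem C_mul_monomial_one {k B : Type*} [CommRing k] [Ring B] [Algebra k B] {c : k} {x g : B}
    (h : g * x = c • (x * g)) : Polynomial.C g * Polynomial.monomial 1 x =
      c • (Polynomial.monomial 1 x * Polynomial.C g) := by
  rw [Polynomial.C_mul_monomial, Polynomial.monomial_mul_C, h, Polynomial.smul_monomial]

variable {B : Type*} [Ring B] [Algebra k B] (f : D.F →ₐ[k] B)

/-- The map `F → B[T]` that sends `a` of degree `n` to `f a Tⁿ`. -/
def gradeMap : D.F →ₐ[k] Polynomial B :=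
  D.liftF (fun i => Polynomial.monomial 1 (f (D.X i)))
    { toFun := fun g => Polynomial.C (f (D.ofΓ g))
      map_one' := by rw [map_one, map_one, Polynomial.C_1]
      map_mul' := fun g h => by rw [map_mul, map_mul, Polynomial.C_mul] }
    (fun g i => by
      have h := congrArg f (D.ofΓ_mul_X g i)
      rw [map_mul, map_smul, map_mul] at h
      exact C_mul_monomial_one h)

theorem gradeMap_apply {n : ℕ} {a : D.F} (ha : a ∈ D.deg n) :
    D.gradeMap f a = Polynomial.monomial n (f a) := by
  have hX : ∀ i, D.gradeMap f (D.X i) = Polynomial.monomial 1 (f (D.X i)) := D.liftF_X _ _ _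
  have hΓ : ∀ g, D.gradeMap f (D.ofΓ g) = Polynomial.C (f (D.ofΓ g)) := D.liftF_ofΓ _ _ _
  have key : ∀ (n : ℕ) (w : Fin n → I) (g : Γ), D.gradeMap f (D.ofTV (D.word w) * D.ofΓ g) =
      Polynomial.monomial n (f (D.ofTV (D.word w) * D.ofΓ g)) := by
    intro n
    induction n with
    | zero =>
      intro w g
      rw [show D.ofTV (D.word w) = 1 by simp [word], one_mul, hΓ, Polynomial.monomial_zero_left]
    | succ n ih =>
      intro w g
      rw [ofTV_word_succ, mul_assoc, map_mul, ih, hX, Polynomial.monomial_mul_monomial, ← map_mul,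
        add_comm 1 n]
  induction ha using Submodule.span_induction with
  | zero => simp
  | add a b _ _ ha hb => rw [map_add, map_add, map_add, ha, hb]
  | smul c a _ ha => rw [map_smul, ha, Polynomial.smul_monomial, map_smul f]
  | mem a ha =>
    obtain ⟨w, g, rfl⟩ := ha
    exact key n w g

end gradeMap

/-- The component of degree `n` of the graded module `F ⊗ F`. -/
def degTensor (n : ℕ) : Submodule k (D.F ⊗[k] D.F) :=
  Submodule.span k {t | ∃ i j, i + j = n ∧ ∃ b ∈ D.deg i, ∃ c ∈ D.deg j, t = b ⊗ₜ c}

/-- The coproduct of `F` is graded. -/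
theorem comulF_mem_degTensor {n : ℕ} {a : D.F} (ha : a ∈ D.deg n) :
    D.comulF a ∈ D.degTensor n := by
  have key : ∀ (n : ℕ) (w : Fin n → I) (g : Γ),
      D.comulF (D.ofTV (D.word w) * D.ofΓ g) ∈ D.degTensor n := by
    intro n
    induction n with
    | zero =>
      intro w g
      rw [show D.ofTV (D.word w) = 1 by simp [word], one_mul, comulF_ofΓ]
      exact Submodule.subset_span ⟨0, 0, rfl, _, D.ofΓ_mem_deg g, _, D.ofΓ_mem_deg g, rfl⟩
    | succ n ih =>
      intro w g
      have h : ∀ i, D.degTensor n ≤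
          (D.degTensor (n + 1)).comap (LinearMap.mulLeft k (D.comulF (D.X i))) := fun i => by
        refine Submodule.span_le.2 ?_
        rintro _ ⟨i', j', hij, b, hb, c, hc, rfl⟩
        rw [SetLike.mem_coe, Submodule.mem_comap, LinearMap.mulLeft_apply, comulF_X, add_mul,
          Algebra.TensorProduct.tmul_mul_tmul, Algebra.TensorProduct.tmul_mul_tmul, one_mul]
        exact Submodule.add_mem _
          (Submodule.subset_span ⟨1 + i', j', by omega, _, D.deg_mul (D.X_mem_deg i) hb,
            _, hc, rfl⟩)
          (Submodule.subset_span ⟨0 + i', 1 + j', by omega, _, D.deg_mul (D.ofΓ_mem_deg _) hb,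
            _, D.deg_mul (D.X_mem_deg i) hc, rfl⟩)
      rw [ofTV_word_succ, mul_assoc, map_mul]
      exact h _ (ih _ g)
  have h : D.deg n ≤ (D.degTensor n).comap D.comulF.toLinearMap := by
    refine Submodule.span_le.2 ?_
    rintro _ ⟨w, g, rfl⟩
    exact key n w g
  exact h ha

theorem counitF_deg {n : ℕ} (hn : n ≠ 0) {a : D.F} (ha : a ∈ D.deg n) : D.counitF a = 0 := by
  have h : D.deg n ≤ LinearMap.ker D.counitF.toLinearMap := by
    refine Submodule.span_le.2 ?_
    rintro _ ⟨w, g, rfl⟩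
    obtain ⟨m, rfl⟩ := Nat.exists_eq_succ_of_ne_zero hn
    change D.counitF _ = 0
    rw [ofTV_word_succ, mul_assoc, map_mul, counitF_X, zero_mul]
  exact h ha

end Datum

/-! ### Maps induced on associated graded modules -/

section Splitting

variable {k : Type u} {Γ : Type v} {I : Type w} [CommRing k] [CommGroup Γ] (D : Datum k Γ I)

/-- The filtered (or graded) module `P`, with symbols in `P'`, has a linear map `π` from `F` that
respects degrees and induces `γ : F → P'`; and its symbol maps extend to linear maps `s n`,
defined on the whole of `P`, that vanish on the terms of degree `< n`. Such extensions exist if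
the filtration splits, and they make maps to tensor products over a general ring `k` manageable. -/
structure SplitsSymbols {P P' : Type*} [AddCommGroup P] [Module k P] [AddCommGroup P']
    [Module k P'] (sP : Symbols k P P') (π : D.F →ₗ[k] P) (γ : D.F →ₗ[k] P')
    (s : ℕ → P →ₗ[k] P') : Prop where
  mem : ∀ {n a}, a ∈ D.deg n → π a ∈ sP.piece n
  sym : ∀ n (p : sP.piece n), s n p = sP.sym n p
  eq_zero : ∀ {m n}, m < n → ∀ p ∈ sP.piece m, s n p = 0
  apply_eq : ∀ {n a}, a ∈ D.deg n → s n (π a) = γ a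

variable {P P' Q Q' : Type*} [AddCommGroup P] [Module k P] [AddCommGroup P'] [Module k P']
  [AddCommGroup Q] [Module k Q] [AddCommGroup Q'] [Module k Q']
  {sP : Symbols k P P'} {sQ : Symbols k Q Q'}
  {πP : D.F →ₗ[k] P} {γP : D.F →ₗ[k] P'} {πQ : D.F →ₗ[k] Q} {γQ : D.F →ₗ[k] Q'}
  {s : ℕ → P →ₗ[k] P'} {s' : ℕ → Q →ₗ[k] Q'}

/-- The symbol map of degree `n` on a tensor product. -/
def tensorSym (s : ℕ → P →ₗ[k] P') (s' : ℕ → Q →ₗ[k] Q') (n : ℕ) :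
    P ⊗[k] Q →ₗ[k] P' ⊗[k] Q' :=
  ∑ p : Finset.HasAntidiagonal.antidiagonal n, TensorProduct.map (s p.1.1) (s' p.1.2)

variable {D}

theorem tensorSym_tmul (hP : SplitsSymbols D sP πP γP s) (hQ : SplitsSymbols D sQ πQ γQ s')
    {i j n : ℕ} (h : i + j ≤ n) {x : P} (hx : x ∈ sP.piece i) {y : Q} (hy : y ∈ sQ.piece j) :
    tensorSym s s' n (x ⊗ₜ y) = if i + j = n then s i x ⊗ₜ s' j y else 0 := by
  have hz : ∀ p : Finset.HasAntidiagonal.antidiagonal n, p.1 ≠ (i, j) →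
      s p.1.1 x ⊗ₜ[k] s' p.1.2 y = 0 := by
    rintro ⟨⟨i', j'⟩, hp⟩ hne
    rw [Finset.HasAntidiagonal.mem_antidiagonal] at hp
    simp only at hp
    by_cases h1 : i < i'
    · rw [hP.eq_zero h1 x hx, TensorProduct.zero_tmul]
    · have h2 : j < j' := by
        by_contra h2
        exact hne (by ext <;> simp <;> omega)
      rw [hQ.eq_zero h2 y hy, TensorProduct.tmul_zero]
  simp only [tensorSym, LinearMap.sum_apply, TensorProduct.map_tmul]
  split_ifs with hn
  · exact Finset.sum_eq_single (⟨(i, j), Finset.HasAntidiagonal.mem_antidiagonal.2 hn⟩ :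
      Finset.HasAntidiagonal.antidiagonal n) (fun p _ hp => hz p fun h => hp (Subtype.ext h))
      (fun h => absurd (Finset.mem_univ _) h)
  · exact Finset.sum_eq_zero fun p _ => hz p fun h => hn (by
      have := Finset.HasAntidiagonal.mem_antidiagonal.1 p.2
      rwa [h] at this)

theorem tensorSym_map_comulF_of_lt (hP : SplitsSymbols D sP πP γP s)
    (hQ : SplitsSymbols D sQ πQ γQ s') {m n : ℕ} (h : m < n) {a : D.F} (ha : a ∈ D.deg m) :
    tensorSym s s' n (TensorProduct.map πP πQ (D.comulF a)) = 0 := by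
  have h1 := D.comulF_mem_degTensor ha
  generalize D.comulF a = t at h1 ⊢
  induction h1 using Submodule.span_induction with
  | zero => simp
  | add x y _ _ hx hy => rw [map_add, map_add, hx, hy, add_zero]
  | smul c x _ hx => rw [map_smul, map_smul, hx, smul_zero]
  | mem x hx =>
    obtain ⟨i, j, hij, b, hb, c, hc, rfl⟩ := hx
    rw [TensorProduct.map_tmul, tensorSym_tmul hP hQ (by omega) (hP.mem hb) (hQ.mem hc),
      if_neg (by omega)]

/-- On the coproduct of a homogeneous element, `tensorSym` computes the map induced on symbols. -/
theorem tensorSym_map_comulF (hP : SplitsSymbols D sP πP γP s)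
    (hQ : SplitsSymbols D sQ πQ γQ s') {n : ℕ} {a : D.F} (ha : a ∈ D.deg n) :
    tensorSym s s' n (TensorProduct.map πP πQ (D.comulF a)) =
      TensorProduct.map γP γQ (D.comulF a) := by
  have h1 := D.comulF_mem_degTensor ha
  generalize D.comulF a = t at h1 ⊢
  induction h1 using Submodule.span_induction with
  | zero => simp
  | add x y _ _ hx hy => rw [map_add, map_add, map_add, hx, hy]
  | smul c x _ hx => rw [map_smul, map_smul, map_smul, hx]
  | mem x hx =>
    obtain ⟨i, j, hij, b, hb, c, hc, rfl⟩ := hx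
    rw [TensorProduct.map_tmul, tensorSym_tmul hP hQ hij.le (hP.mem hb) (hQ.mem hc),
      if_pos hij, hP.apply_eq hb, hQ.apply_eq hc, TensorProduct.map_tmul]

theorem tensorSym_map_subtype (hP : SplitsSymbols D sP πP γP s)
    (hQ : SplitsSymbols D sQ πQ γQ s') {i j n : ℕ} (h : i + j = n)
    (t : sP.piece i ⊗[k] sQ.piece j) :
    tensorSym s s' n (TensorProduct.map (sP.piece i).subtype (sQ.piece j).subtype t) =
      TensorProduct.map (sP.sym i) (sQ.sym j) t := by
  induction t using TensorProduct.induction_on with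
  | zero => simp
  | add x y hx hy => rw [map_add, map_add, map_add, hx, hy]
  | tmul x y =>
    rw [TensorProduct.map_tmul, TensorProduct.map_tmul, Submodule.subtype_apply,
      Submodule.subtype_apply, tensorSym_tmul hP hQ h.le x.2 y.2, if_pos h, hP.sym, hQ.sym]

theorem exists_sum_map_subtype (hP : SplitsSymbols D sP πP γP s)
    (hQ : SplitsSymbols D sQ πQ γQ s') (hmono : Monotone sQ.piece) {n : ℕ} {a : D.F}
    (ha : a ∈ D.filF.fil n) :
    ∃ t : ∀ p : Finset.HasAntidiagonal.antidiagonal n, sP.piece p.1.1 ⊗[k] sQ.piece p.1.2,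
      TensorProduct.map πP πQ (D.comulF a) =
        ∑ p, TensorProduct.map (sP.piece p.1.1).subtype (sQ.piece p.1.2).subtype (t p) := by
  let S : (∀ p : Finset.HasAntidiagonal.antidiagonal n, sP.piece p.1.1 ⊗[k] sQ.piece p.1.2) →ₗ[k]
      P ⊗[k] Q := ∑ p : Finset.HasAntidiagonal.antidiagonal n,
        TensorProduct.map (sP.piece p.1.1).subtype (sQ.piece p.1.2).subtype ∘ₗ LinearMap.proj p
  have hS : ∀ t, S t =
      ∑ p, TensorProduct.map (sP.piece p.1.1).subtype (sQ.piece p.1.2).subtype (t p) := by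
    intro t
    simp only [S, LinearMap.sum_apply]
    rfl
  suffices h : D.filF.fil n ≤ (LinearMap.range S).comap
      (TensorProduct.map πP πQ ∘ₗ D.comulF.toLinearMap) by
    obtain ⟨t, ht⟩ := h ha
    exact ⟨t, ht.symm.trans (hS t)⟩
  refine D.filF_le fun m hm b hb => ?_
  have h1 := D.comulF_mem_degTensor hb
  rw [Submodule.mem_comap]
  change TensorProduct.map πP πQ (D.comulF b) ∈ _
  generalize D.comulF b = t at h1 ⊢
  induction h1 using Submodule.span_induction with
  | zero => simp
  | add x y _ _ hx hy => rw [map_add]; exact Submodule.add_mem _ hx hy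
  | smul c x _ hx => rw [map_smul]; exact Submodule.smul_mem _ _ hx
  | mem x hx =>
    obtain ⟨i, j, hij, b, hb, c, hc, rfl⟩ := hx
    let p : Finset.HasAntidiagonal.antidiagonal n :=
      ⟨(i, n - i), Finset.HasAntidiagonal.mem_antidiagonal.2 (show i + (n - i) = n by omega)⟩
    refine ⟨Pi.single p (⟨πP b, hP.mem hb⟩ ⊗ₜ
      ⟨πQ c, hmono (show j ≤ n - i by omega) (hQ.mem hc)⟩), ?_⟩
    rw [hS, Finset.sum_eq_single p]
    · rw [Pi.single_eq_same]
      rfl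
    · intro p' _ hp'
      rw [Pi.single_eq_of_ne hp', map_zero]
    · exact fun h => absurd (Finset.mem_univ _) h

/-- A map that is covered by the coproduct of `F` is filtered, and the induced map on the
associated graded modules is the one that is covered by the coproduct of `F`. -/
theorem inducesOnGr {M M' : Type*} [AddCommGroup M] [Module k M] [AddCommGroup M'] [Module k M']
    {sM : Symbols k M M'} {πM : D.F →ₗ[k] M} {γM : D.F →ₗ[k] M'}
    (hM : ∀ n (m : sM.piece n), ∃ b ∈ D.filF.fil n, ∃ c ∈ D.deg n, b - c ∈ D.filF.below n ∧
      πM b = m ∧ sM.sym n m = γM c)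
    (hP : SplitsSymbols D sP πP γP s) (hQ : SplitsSymbols D sQ πQ γQ s')
    (hmono : Monotone sQ.piece) {f : M →ₗ[k] P ⊗[k] Q} {f' : M' →ₗ[k] P' ⊗[k] Q'}
    (hf : ∀ a, f (πM a) = TensorProduct.map πP πQ (D.comulF a))
    (hf' : ∀ a, f' (γM a) = TensorProduct.map γP γQ (D.comulF a)) :
    InducesOnGr sM sP sQ f f' := by
  intro n m
  obtain ⟨b, hb, c, hc, hbc, hm, hsm⟩ := hM n m
  have hS : tensorSym s s' n (f m) = f' (sM.sym n m) := by
    have h1 : D.filF.below n ≤ LinearMap.ker (tensorSym s s' n ∘ₗ TensorProduct.map πP πQ ∘ₗ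
        D.comulF.toLinearMap) :=
      D.below_le fun m hm a ha => tensorSym_map_comulF_of_lt hP hQ hm ha
    have h2 := h1 hbc
    rw [LinearMap.mem_ker, map_sub, sub_eq_zero] at h2
    rw [← hm, hf, hsm, hf']
    exact h2.trans (tensorSym_map_comulF hP hQ hc)
  refine ⟨?_, fun t ht => ?_⟩
  · rw [← hm, hf]
    exact exists_sum_map_subtype hP hQ hmono hb
  · rw [← hS, ht, map_sum]
    exact Finset.sum_congr rfl fun p _ =>
      tensorSym_map_subtype hP hQ (Finset.HasAntidiagonal.mem_antidiagonal.1 p.2) (t p)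

end Splitting

/-! ### The grading of `H⁰` -/

namespace Relators

variable {k : Type u} {Γ : Type v} {I : Type w} [CommRing k] [CommGroup Γ] {D : Datum k Γ I}
  (R : Relators D)

open Datum

/-- The map `H⁰ → H⁰[T]` that sends `a` of degree `n` to `a Tⁿ`. -/
def grade : R.H0 →ₐ[k] Polynomial R.H0 :=
  R.descend (D.gradeMap (R.π 0)) (R.eq_zero_of_mem_ideal _
    (fun y hy => by
      obtain ⟨l, g, -, hg⟩ := D.exists_mem_homog R hy
      rw [D.gradeMap_apply _ (homog_le_deg hg), R.π_relator 0 hy, map_zero])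
    (fun i j hij => by
      rw [D.gradeMap_apply _ (ad_mem_deg i j), R.π_ad _ hij, Pi.zero_apply, Pi.zero_apply, map_zero,
        map_zero, map_zero]))

/-- The projection of `H⁰` to its component of degree `n`. -/
def proj (n : ℕ) : R.H0 →ₗ[k] R.H0 where
  toFun h := (R.grade h).coeff n
  map_add' a b := by rw [map_add, Polynomial.coeff_add]
  map_smul' c a := by rw [map_smul, Polynomial.coeff_smul, RingHom.id_apply]

theorem proj_π (n : ℕ) {m : ℕ} {a : D.F} (ha : a ∈ D.deg m) :
    R.proj n (R.π 0 a) = if m = n then R.π 0 a else 0 :=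
  (congrArg (fun p => Polynomial.coeff p n) (D.gradeMap_apply _ ha)).trans Polynomial.coeff_monomial

theorem splitsSymbols_H0 : SplitsSymbols D (Symbols.ofGraded R.H0deg) (R.π 0).toLinearMap
    (R.π 0).toLinearMap R.proj where
  mem ha := ⟨_, ha, rfl⟩
  sym := by
    rintro n ⟨_, a, ha, rfl⟩
    exact (R.proj_π n ha).trans (if_pos rfl)
  eq_zero := by
    rintro m n h _ ⟨a, ha, rfl⟩
    exact (R.proj_π n ha).trans (if_neg h.ne)
  apply_eq ha := (R.proj_π _ ha).trans (if_pos rfl)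

/-! ### Comparison of `H⁰` with associated graded algebras -/

variable {R} in
/-- The components of a map `F / (u) → H⁰` which is the identity up to terms of lower degree. -/
theorem IsDeformation.exists_map {u : I → I → D.F} (h : R.IsDeformation u) :
    ∃ s : ℕ → (D.F ⧸ R.ideal u) →ₗ[k] R.H0, ∀ m n, m ≤ n → ∀ a ∈ D.deg m,
      s n (R.π u a) = if m = n then R.π 0 a else 0 := by
  obtain ⟨ψ, hψ, hI⟩ := h
  let ψ' : (D.F ⧸ R.ideal u) →ₗ[k] R.H0 :=
    Submodule.liftQ ((R.ideal u).restrictScalars k) ((R.π 0).toLinearMap ∘ₗ ψ)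
      (fun a ha => Ideal.Quotient.eq_zero_iff_mem.2 (hI a ha)) ∘ₗ
      (Submodule.Quotient.restrictScalarsEquiv k (R.ideal u)).symm.toLinearMap
  have hψ' : ∀ a, ψ' (R.π u a) = R.π 0 (ψ a) := fun a => rfl
  refine ⟨fun n => R.proj n ∘ₗ ψ', fun m n hmn a ha => ?_⟩
  have h0 : D.filF.below m ≤ LinearMap.ker (R.proj n ∘ₗ (R.π 0).toLinearMap) :=
    D.below_le fun l hl b hb => (R.proj_π n hb).trans (if_neg (by omega))
  have h1 := h0 (hψ m a ha)
  rw [LinearMap.mem_ker, map_sub, sub_eq_zero] at h1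
  rw [LinearMap.comp_apply, hψ']
  exact h1.trans (R.proj_π n ha)

/-- Every element of the filtration of `F / (u)` lifts to `F`, and its symbol is the image of the
leading term of the lift. -/
theorem exists_symbol_eq (u : I → I → D.F) {n : ℕ} (a : (R.filt u).fil n) :
    ∃ b ∈ D.filF.fil n, ∃ c ∈ D.deg n, b - c ∈ D.filF.below n ∧ R.π u b = a ∧
      (R.filt u).symbol n a = R.grπ u c := by
  obtain ⟨_, b, hb, rfl⟩ := a
  obtain ⟨c, hc, hbc⟩ := D.exists_leading hb
  refine ⟨b, hb, c, hc, hbc, rfl, ?_⟩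
  rw [R.grπ_apply u hc, ← sub_eq_zero, ← map_sub]
  refine (R.filt u).symbol_eq_zero _ ?_
  have h : D.filF.below n ≤ ((R.filt u).below n).comap (R.π u).toLinearMap := by
    cases n with
    | zero => exact bot_le
    | succ n => exact fun a ha => ⟨a, ha, rfl⟩
  have h2 := h hbc
  rw [Submodule.mem_comap, map_sub] at h2
  exact h2

theorem map_natGr_H0deg (u : I → I → D.F) (hu : ∀ i j, u i j ∈ D.deg 0) (n : ℕ) :
    (R.H0deg n).map (R.natGr u hu).toLinearMap = (R.filt u).grDeg n := by
  refine le_antisymm ?_ ?_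
  · rintro _ ⟨_, ⟨a, ha, rfl⟩, rfl⟩
    exact ⟨_, (R.grπ_apply u ha).symm⟩
  · rintro _ ⟨a, rfl⟩
    obtain ⟨a, rfl⟩ := (R.filt u).toPiece_surjective n a
    obtain ⟨b, -, c, hc, -, -, h⟩ := R.exists_symbol_eq u a
    exact ⟨R.π 0 c, ⟨c, hc, rfl⟩, h.symm⟩

theorem natGr_surjective (u : I → I → D.F) (hu : ∀ i j, u i j ∈ D.deg 0) :
    Function.Surjective (R.natGr u hu) := by
  intro a
  induction a using DirectSum.induction_on with
  | zero => exact ⟨0, map_zero _⟩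
  | of n a =>
    have h : DirectSum.lof k ℕ (R.filt u).Piece n a ∈ (R.filt u).grDeg n := ⟨a, rfl⟩
    rw [← R.map_natGr_H0deg u hu n] at h
    obtain ⟨b, -, hb⟩ := h
    exact ⟨b, hb⟩
  | add a b ha hb =>
    obtain ⟨a, rfl⟩ := ha
    obtain ⟨b, rfl⟩ := hb
    exact ⟨a + b, map_add _ _ _⟩

variable {R} in
/-- A map `F / (u) → H⁰` that is the identity up to terms of lower degree induces the inverse. -/
theorem IsDeformation.natGr_bijective {u : I → I → D.F} (h : R.IsDeformation u)
    (hu : ∀ i j, u i j ∈ D.deg 0) : Function.Bijective (R.natGr u hu) := by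
  refine ⟨?_, R.natGr_surjective u hu⟩
  obtain ⟨s, hs⟩ := h.exists_map
  have hz : ∀ n, ∀ a ∈ (R.filt u).below n, s n a = 0 := by
    rintro (_ | n) a ha
    · rw [show a = 0 from ha, map_zero]
    · obtain ⟨b, hb, rfl⟩ := ha
      have h0 : D.filF.fil n ≤ LinearMap.ker (s (n + 1) ∘ₗ (R.π u).toLinearMap) :=
        D.filF_le fun m hm b hb => (hs m _ (by omega) b hb).trans (if_neg (by omega))
      exact h0 hb
  let f : (R.filt u).Gr →ₗ[k] R.H0 := DirectSum.toModule k ℕ R.H0 fun n =>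
    (R.filt u).liftPiece (s n ∘ₗ ((R.filt u).fil n).subtype) fun a ha => hz n a ha
  have hf : ∀ n (a : (R.filt u).fil n), f ((R.filt u).symbol n a) = s n a := fun n a =>
    DirectSum.toModule_lof k n _
  refine Function.LeftInverse.injective (g := f) fun b => ?_
  obtain ⟨a, rfl⟩ := Ideal.Quotient.mk_surjective b
  obtain ⟨n, ha⟩ := D.exists_mem_fil a
  have h0 : D.filF.fil n ≤ LinearMap.eqLocus (f ∘ₗ (R.grπ u).toLinearMap) (R.π 0).toLinearMap :=
    D.filF_le fun m _ b hb =>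
      (congrArg f (R.grπ_apply u hb)).trans ((hf _ _).trans ((hs m m le_rfl b hb).trans
        (if_pos rfl)))
  exact h0 ha

variable {R} in
theorem IsDeformation.exists_splitsSymbols {u : I → I → D.F} (h : R.IsDeformation u)
    (hu : ∀ i j, u i j ∈ D.deg 0) : ∃ s, SplitsSymbols D (R.filt u).symbols
      (R.π u).toLinearMap (R.grπ u).toLinearMap s := by
  obtain ⟨s, hs⟩ := h.exists_map
  have happ : ∀ {n : ℕ} {a}, a ∈ D.deg n →
      ((R.natGr u hu).toLinearMap ∘ₗ s n) (R.π u a) = R.grπ u a := by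
    intro n a ha
    rw [LinearMap.comp_apply, hs n n le_rfl a ha, if_pos rfl]
    rfl
  have hz : ∀ n, D.filF.below n ≤ LinearMap.ker
      ((R.natGr u hu).toLinearMap ∘ₗ s n ∘ₗ (R.π u).toLinearMap) := fun n =>
    D.below_le fun m hm b hb => by
      change R.natGr u hu (s n (R.π u b)) = 0
      rw [hs m n hm.le b hb, if_neg hm.ne, map_zero]
  refine ⟨fun n => (R.natGr u hu).toLinearMap ∘ₗ s n, ⟨fun ha => R.π_mem_filt u ha, ?_, ?_, happ⟩⟩
  · intro n p
    obtain ⟨b, hb, c, hc, hbc, hp, h⟩ := R.exists_symbol_eq u p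
    have h2 := hz n hbc
    rw [LinearMap.mem_ker, map_sub, sub_eq_zero] at h2
    refine (congrArg (fun a => ((R.natGr u hu).toLinearMap ∘ₗ s n) a) hp.symm).trans
      (h2.trans ((happ hc).trans h.symm))
  · rintro m n hmn _ ⟨b, hb, rfl⟩
    exact hz n ((D.filF_le fun l hl => D.deg_le_below (by omega)) hb)

end Relators

/-! ### Transport of Hopf algebra structures and coactions -/

section Transport

section Coalgebra

variable {k H : Type*} [CommRing k] [Ring H] [HopfAlgebra k H]
  {U W X Y Z : Type*} [AddCommGroup U] [Module k U] [AddCommGroup W] [Module k W]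
  [AddCommGroup X] [Module k X] [AddCommGroup Y] [Module k Y] [AddCommGroup Z] [Module k Z]

/-- The general form of coassociativity of structures transported from `H`: all maps `c`, `c'` that
correspond to the coproduct of `H` under linear maps on the three factors are compatible. -/
theorem transport_coassoc {f : H →ₗ[k] X} {g : H →ₗ[k] Y} {h : H →ₗ[k] Z} {p : H →ₗ[k] U}
    {q : H →ₗ[k] W} {c : U →ₗ[k] X ⊗[k] Y} {c' : W →ₗ[k] Y ⊗[k] Z}
    (hc : ∀ a, c (p a) = TensorProduct.map f g (Coalgebra.comul a))
    (hc' : ∀ a, c' (q a) = TensorProduct.map g h (Coalgebra.comul a)) (a : H) :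
    TensorProduct.assoc k X Y Z (c.rTensor Z (TensorProduct.map p h (Coalgebra.comul a))) =
      c'.lTensor X (TensorProduct.map f q (Coalgebra.comul a)) := by
  have e1 : c ∘ₗ p = TensorProduct.map f g ∘ₗ Coalgebra.comul := LinearMap.ext hc
  have e2 : c' ∘ₗ q = TensorProduct.map g h ∘ₗ Coalgebra.comul := LinearMap.ext hc'
  have h1 : ∀ t, c.rTensor Z (TensorProduct.map p h t) =
      TensorProduct.map (TensorProduct.map f g) h (Coalgebra.comul.rTensor H t) := fun t => by
    rw [← LinearMap.comp_apply, ← LinearMap.comp_apply (TensorProduct.map _ h),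
      LinearMap.rTensor_comp_map, LinearMap.map_comp_rTensor, e1]
  have h2 : ∀ t, c'.lTensor X (TensorProduct.map f q t) =
      TensorProduct.map f (TensorProduct.map g h) (Coalgebra.comul.lTensor H t) := fun t => by
    rw [← LinearMap.comp_apply, ← LinearMap.comp_apply (TensorProduct.map f _),
      LinearMap.lTensor_comp_map, LinearMap.map_comp_lTensor, e2]
  have h3 : ∀ t, TensorProduct.assoc k X Y Z (TensorProduct.map (TensorProduct.map f g) h t) =
      TensorProduct.map f (TensorProduct.map g h) (TensorProduct.assoc k H H H t) := fun t =>
    (LinearMap.congr_fun (TensorProduct.map_map_comp_assoc_eq f g h) t).symm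
  rw [h1, h2, h3, Coalgebra.coassoc_apply]

theorem transport_counit_left {f : H →ₗ[k] X} (g : H →ₗ[k] Y) {e : X →ₗ[k] k}
    (he : ∀ a, e (f a) = Coalgebra.counit a) (a : H) :
    TensorProduct.lid k Y (e.rTensor Y (TensorProduct.map f g (Coalgebra.comul a))) = g a := by
  have e1 : e ∘ₗ f = Coalgebra.counit := LinearMap.ext he
  rw [← LinearMap.comp_apply, LinearMap.rTensor_comp_map, e1, ← LinearMap.lTensor_comp_rTensor,
    LinearMap.comp_apply, Coalgebra.rTensor_counit_comul, LinearMap.lTensor_tmul,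
    TensorProduct.lid_tmul, one_smul]

theorem transport_counit_right (f : H →ₗ[k] X) {g : H →ₗ[k] Y} {e : Y →ₗ[k] k}
    (he : ∀ a, e (g a) = Coalgebra.counit a) (a : H) :
    TensorProduct.rid k X (e.lTensor X (TensorProduct.map f g (Coalgebra.comul a))) = f a := by
  have e1 : e ∘ₗ g = Coalgebra.counit := LinearMap.ext he
  rw [← LinearMap.comp_apply, LinearMap.lTensor_comp_map, e1, ← LinearMap.rTensor_comp_lTensor,
    LinearMap.comp_apply, Coalgebra.lTensor_counit_comul, LinearMap.rTensor_tmul,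
    TensorProduct.rid_tmul, one_smul]

theorem mul'_map_algHom {A : Type*} [Ring A] [Algebra k A] (f : H →ₐ[k] A) (t : H ⊗[k] H) :
    LinearMap.mul' k A (TensorProduct.map f.toLinearMap f.toLinearMap t) =
      f (LinearMap.mul' k H t) := by
  induction t using TensorProduct.induction_on with
  | zero => simp
  | add x y hx hy => simp only [map_add, hx, hy]
  | tmul x y => simp

theorem mul'_map_antipode_left {A : Type*} [Ring A] [Algebra k A] (f : H →ₐ[k] A) (a : H) :
    LinearMap.mul' k A (TensorProduct.map (f.toLinearMap ∘ₗ HopfAlgebra.antipode k) f.toLinearMap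
      (Coalgebra.comul a)) = algebraMap k A (Coalgebra.counit a) := by
  rw [← LinearMap.comp_id f.toLinearMap, LinearMap.comp_assoc, TensorProduct.map_comp,
    LinearMap.id_comp, LinearMap.comp_apply, mul'_map_algHom]
  exact (congrArg f (HopfAlgebra.mul_antipode_rTensor_comul_apply a)).trans (f.commutes _)

theorem mul'_map_antipode_right {A : Type*} [Ring A] [Algebra k A] (f : H →ₐ[k] A) (a : H) :
    LinearMap.mul' k A (TensorProduct.map f.toLinearMap (f.toLinearMap ∘ₗ HopfAlgebra.antipode k)
      (Coalgebra.comul a)) = algebraMap k A (Coalgebra.counit a) := by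
  rw [← LinearMap.comp_id f.toLinearMap, LinearMap.comp_assoc, TensorProduct.map_comp,
    LinearMap.id_comp, LinearMap.comp_apply, mul'_map_algHom]
  exact (congrArg f (HopfAlgebra.mul_antipode_lTensor_comul_apply a)).trans (f.commutes _)

end Coalgebra

variable {k H A B : Type*} [CommRing k] [Ring H] [HopfAlgebra k H] [Ring A] [Algebra k A]

/-- The Hopf algebra structure on `A` obtained from that of `H` through an isomorphism of
algebras. -/
def HopfStr.transport (Φ : H ≃ₐ[k] A) : HopfStr k A :=
  have hcomul : ∀ h, ((Algebra.TensorProduct.map (Φ : H →ₐ[k] A) (Φ : H →ₐ[k] A)).comp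
      ((Bialgebra.comulAlgHom k H).comp Φ.symm)).toLinearMap (Φ.toLinearMap h) =
        TensorProduct.map Φ.toLinearMap Φ.toLinearMap (Coalgebra.comul h) := fun h => by
    change TensorProduct.map Φ.toLinearMap Φ.toLinearMap (Coalgebra.comul (Φ.symm (Φ h))) = _
    rw [Φ.symm_apply_apply]
  have hcounit : ∀ h, ((Bialgebra.counitAlgHom k H).comp Φ.symm).toLinearMap (Φ.toLinearMap h) =
      Coalgebra.counit (R := k) h := fun h => by
    change Coalgebra.counit (Φ.symm (Φ h)) = _
    rw [Φ.symm_apply_apply]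
  have hanti : (Φ.toLinearMap ∘ₗ HopfAlgebra.antipode k ∘ₗ Φ.symm.toLinearMap) ∘ₗ
      (Φ : H →ₐ[k] A).toLinearMap = (Φ : H →ₐ[k] A).toLinearMap ∘ₗ HopfAlgebra.antipode k :=
    LinearMap.ext fun h => by simp
  { comul := (Algebra.TensorProduct.map (Φ : H →ₐ[k] A) (Φ : H →ₐ[k] A)).comp
      ((Bialgebra.comulAlgHom k H).comp Φ.symm)
    counit := (Bialgebra.counitAlgHom k H).comp Φ.symm
    antipode := Φ.toLinearMap ∘ₗ HopfAlgebra.antipode k ∘ₗ Φ.symm.toLinearMap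
    coassoc := AlgHom.ext fun a => transport_coassoc hcomul hcomul (Φ.symm a)
    counit_left := AlgHom.ext fun a => (TensorProduct.lid k A).injective <| by
      refine (transport_counit_left Φ.toLinearMap hcounit (Φ.symm a)).trans ?_
      simp
    counit_right := AlgHom.ext fun a => (TensorProduct.rid k A).injective <| by
      refine (transport_counit_right Φ.toLinearMap hcounit (Φ.symm a)).trans ?_
      simp
    antipode_left := fun a => by
      refine (congrArg (LinearMap.mul' k A) ?_).trans
        (mul'_map_antipode_left (Φ : H →ₐ[k] A) (Φ.symm a))
      refine (LinearMap.congr_fun (LinearMap.rTensor_comp_map _ _ _ _) _).trans ?_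
      exact congrArg (fun f => TensorProduct.map f (Φ : H →ₐ[k] A).toLinearMap _) hanti
    antipode_right := fun a => by
      refine (congrArg (LinearMap.mul' k A) ?_).trans
        (mul'_map_antipode_right (Φ : H →ₐ[k] A) (Φ.symm a))
      refine (LinearMap.congr_fun (LinearMap.lTensor_comp_map _ _ _ _) _).trans ?_
      exact congrArg (fun f => TensorProduct.map (Φ : H →ₐ[k] A).toLinearMap f _) hanti }

theorem HopfStr.transport_comul (Φ : H ≃ₐ[k] A) (h : H) :
    (HopfStr.transport Φ).comul (Φ h) =
      TensorProduct.map Φ.toLinearMap Φ.toLinearMap (Coalgebra.comul h) := by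
  change TensorProduct.map Φ.toLinearMap Φ.toLinearMap (Coalgebra.comul (Φ.symm (Φ h))) = _
  rw [Φ.symm_apply_apply]

theorem HopfStr.transport_counit (Φ : H ≃ₐ[k] A) (h : H) :
    (HopfStr.transport Φ).counit (Φ h) = Coalgebra.counit (R := k) h := by
  change Coalgebra.counit (Φ.symm (Φ h)) = _
  rw [Φ.symm_apply_apply]

theorem HopfStr.transport_antipode (Φ : H ≃ₐ[k] A) (h : H) :
    (HopfStr.transport Φ).antipode (Φ h) = Φ (HopfAlgebra.antipode k h) := by
  change Φ (HopfAlgebra.antipode k (Φ.symm (Φ h))) = _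
  rw [Φ.symm_apply_apply]

/-- The coaction of `H` on `A` obtained from the coproduct of `H` through an isomorphism of
algebras. -/
def leftCoact (Θ : H ≃ₐ[k] A) : A →ₐ[k] H ⊗[k] A :=
  (Algebra.TensorProduct.map (.id k H) (Θ : H →ₐ[k] A)).comp
    ((Bialgebra.comulAlgHom k H).comp Θ.symm)

theorem leftCoact_apply (Θ : H ≃ₐ[k] A) (h : H) :
    leftCoact Θ (Θ h) = TensorProduct.map LinearMap.id Θ.toLinearMap (Coalgebra.comul h) := by
  change TensorProduct.map LinearMap.id Θ.toLinearMap (Coalgebra.comul (Θ.symm (Θ h))) = _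
  rw [Θ.symm_apply_apply]

/-- `leftCoact` as a comodule algebra structure. -/
def LeftCoaction.transport (Θ : H ≃ₐ[k] A) : LeftCoaction k H A where
  coact := leftCoact Θ
  coassoc a := transport_coassoc (p := LinearMap.id) (c := Coalgebra.comul)
    (c' := (leftCoact Θ).toLinearMap) (fun _ => (LinearMap.congr_fun TensorProduct.map_id _).symm)
    (leftCoact_apply Θ) (Θ.symm a)
  counit a := (transport_counit_left Θ.toLinearMap (f := LinearMap.id) (fun _ => rfl)
    (Θ.symm a)).trans (Θ.apply_symm_apply a)

variable [Ring B] [HopfAlgebra k B]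

/-- The coaction of `B` on `A` obtained from the coproduct of `H` through an isomorphism of algebras
and an isomorphism of bialgebras. -/
def rightCoact (Θ : H ≃ₐ[k] A) (Φ : H ≃ₐc[k] B) : A →ₐ[k] A ⊗[k] B :=
  (Algebra.TensorProduct.map (Θ : H →ₐ[k] A) (Φ : H →ₐ[k] B)).comp
    ((Bialgebra.comulAlgHom k H).comp Θ.symm)

theorem rightCoact_apply (Θ : H ≃ₐ[k] A) (Φ : H ≃ₐc[k] B) (h : H) :
    rightCoact Θ Φ (Θ h) =
      TensorProduct.map Θ.toLinearMap (Φ : H →ₗ[k] B) (Coalgebra.comul h) := by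
  change TensorProduct.map Θ.toLinearMap (Φ : H →ₗ[k] B) (Coalgebra.comul (Θ.symm (Θ h))) = _
  rw [Θ.symm_apply_apply]

/-- `rightCoact` as a comodule algebra structure. -/
def RightCoaction.transport (Θ : H ≃ₐ[k] A) (Φ : H ≃ₐc[k] B) :
    RightCoaction k A B where
  coact := rightCoact Θ Φ
  coassoc a := transport_coassoc (c := (rightCoact Θ Φ).toLinearMap) (c' := Coalgebra.comul)
    (rightCoact_apply Θ Φ) (fun h => (CoalgHomClass.map_comp_comul_apply Φ h).symm) (Θ.symm a)
  counit a := (transport_counit_right Θ.toLinearMap (g := (Φ : H →ₗ[k] B))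
    (CoalgHomClass.counit_comp_apply Φ) (Θ.symm a)).trans (Θ.apply_symm_apply a)

theorem algebraMap_injective_of_algEquiv (Θ : H ≃ₐ[k] A) :
    Function.Injective (algebraMap k A) := fun c d h => by
  rw [← Θ.commutes, ← Θ.commutes, Θ.injective.eq_iff] at h
  simpa using congrArg (Coalgebra.counit (R := k)) h

theorem isCleftObject_leftTransport (Θ : H ≃ₐ[k] A) :
    (LeftCoaction.transport Θ).IsCleftObject := by
  refine ⟨⟨Θ.toLinearMap, leftCoact_apply Θ, Θ.toLinearMap ∘ₗ HopfAlgebra.antipode k,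
    LinearMap.ext (mul'_map_antipode_right (Θ : H →ₐ[k] A)),
    LinearMap.ext (mul'_map_antipode_left (Θ : H →ₐ[k] A))⟩,
    algebraMap_injective_of_algEquiv Θ, fun a => ⟨fun ha => ?_, ?_⟩⟩
  · obtain ⟨h, rfl⟩ := Θ.surjective a
    have h1 := transport_counit_right (LinearMap.id : H →ₗ[k] H) (g := Θ.toLinearMap)
      (e := Coalgebra.counit ∘ₗ Θ.symm.toLinearMap) (fun h => by simp) h
    rw [← leftCoact_apply Θ h] at h1
    have h2 := h1.symm.trans (congrArg (fun t => TensorProduct.rid k H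
      ((Coalgebra.counit ∘ₗ Θ.symm.toLinearMap).lTensor H t)) ha)
    refine ⟨Coalgebra.counit h, ?_⟩
    rw [← Θ.commutes]
    refine congrArg Θ ?_
    simpa [Algebra.algebraMap_eq_smul_one] using h2.symm
  · rintro ⟨c, rfl⟩
    rw [AlgHom.commutes, Algebra.TensorProduct.algebraMap_apply, Algebra.algebraMap_eq_smul_one,
      Algebra.algebraMap_eq_smul_one, TensorProduct.smul_tmul]

theorem isCleftObject_rightTransport (Θ : H ≃ₐ[k] A) (Φ : H ≃ₐc[k] B) :
    (RightCoaction.transport Θ Φ).IsCleftObject := by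
  let φ : B →ₐ[k] A := (Θ : H →ₐ[k] A).comp (Φ.symm : B →ₐ[k] H)
  refine ⟨⟨φ.toLinearMap, fun b => ?_, φ.toLinearMap ∘ₗ HopfAlgebra.antipode k,
    LinearMap.ext (mul'_map_antipode_right φ), LinearMap.ext (mul'_map_antipode_left φ)⟩,
    algebraMap_injective_of_algEquiv Θ, fun a => ⟨fun ha => ?_, ?_⟩⟩
  · obtain ⟨h, rfl⟩ := EquivLike.surjective Φ b
    have h1 : φ.toLinearMap (Φ h) = Θ h := congrArg Θ (Φ.symm_apply_apply h)
    have h2 : φ.toLinearMap ∘ₗ (Φ : H →ₗ[k] B) = Θ.toLinearMap :=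
      LinearMap.ext fun h => congrArg Θ (Φ.symm_apply_apply h)
    rw [h1]
    refine (rightCoact_apply Θ Φ h).trans ?_
    refine Eq.trans ?_ (congrArg _ (CoalgHomClass.map_comp_comul_apply Φ h))
    refine Eq.trans ?_ (LinearMap.congr_fun (LinearMap.rTensor_comp_map _ _ _ _) _).symm
    rw [← h2]
    rfl
  · obtain ⟨h, rfl⟩ := Θ.surjective a
    have h1 := transport_counit_left (f := Θ.toLinearMap) (Φ : H →ₗ[k] B)
      (e := Coalgebra.counit ∘ₗ Θ.symm.toLinearMap) (fun h => by simp) h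
    rw [← rightCoact_apply Θ Φ h] at h1
    have h2 := h1.symm.trans (congrArg (fun t => TensorProduct.lid k B
      ((Coalgebra.counit ∘ₗ Θ.symm.toLinearMap).rTensor B t)) ha)
    have h3 : Φ h = Φ (algebraMap k H (Coalgebra.counit h)) := by
      refine h2.trans ?_
      simp [Algebra.algebraMap_eq_smul_one]
    refine ⟨Coalgebra.counit h, ?_⟩
    rw [← Θ.commutes]
    exact congrArg Θ (Φ.injective h3).symm
  · rintro ⟨c, rfl⟩
    rw [AlgHom.commutes, Algebra.TensorProduct.algebraMap_apply]

theorem isBicleftObject_transport (Θ : H ≃ₐ[k] A) (Φ : H ≃ₐc[k] B) :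
    IsBicleftObject (LeftCoaction.transport Θ) (RightCoaction.transport Θ Φ) :=
  ⟨fun a => transport_coassoc (c := (leftCoact Θ).toLinearMap)
    (c' := (rightCoact Θ Φ).toLinearMap) (leftCoact_apply Θ) (rightCoact_apply Θ Φ) (Θ.symm a),
    isCleftObject_leftTransport Θ, isCleftObject_rightTransport Θ Φ⟩

end Transport

/-! ### The structures on the associated graded algebras -/

namespace Relators

variable {k : Type u} {Γ : Type v} {I : Type w} [CommRing k] [CommGroup Γ] {D : Datum k Γ I}
  (R : Relators D) (lam : Xi D → k)

open Datum

/-- The isomorphism `H⁰ ≃ gr A(lam)`. -/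
def equivA : R.H0 ≃ₐ[k] R.grA lam :=
  AlgEquiv.ofBijective (R.natA lam) ((R.isDeformation_uA lam).natGr_bijective _)

/-- The isomorphism `H⁰ ≃ gr H^lam`. -/
def equivH : R.H0 ≃ₐ[k] R.grH lam :=
  AlgEquiv.ofBijective (R.natH lam) ((R.isDeformation_uH lam).natGr_bijective _)

theorem equivH_π (a : D.F) : R.equivH lam (R.π 0 a) = R.grπ (uH lam) a := rfl

theorem comul_π (u : I → I → D.F) [(R.ideal u).IsHopfIdeal k] (a : D.F) :
    Coalgebra.comul (R := k) (R.π u a) =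
      TensorProduct.map (R.π u).toLinearMap (R.π u).toLinearMap (D.comulF a) := rfl

theorem map_map_comul_π {A B : Type*} [AddCommGroup A] [Module k A] [AddCommGroup B] [Module k B]
    (f : R.H0 →ₗ[k] A) (f' : R.H0 →ₗ[k] B) (a : D.F) :
    TensorProduct.map f f' (Coalgebra.comul (R := k) (R.π 0 a)) =
      TensorProduct.map (f ∘ₗ (R.π 0).toLinearMap) (f' ∘ₗ (R.π 0).toLinearMap) (D.comulF a) := by
  rw [comul_π, TensorProduct.map_comp]
  rfl

theorem isInducedHopf_transport : R.IsInducedHopf lam (HopfStr.transport (R.equivH lam)) := by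
  obtain ⟨s, hs⟩ := (R.isDeformation_uH lam).exists_splitsSymbols (uH_mem_deg lam)
  refine ⟨inducesOnGr (πM := (R.π (uH lam)).toLinearMap)
    (γM := (R.grπ (uH lam)).toLinearMap) (fun _ m => R.exists_symbol_eq (uH lam) m) hs hs
    (R.filt _).mono (R.comul_π (uH lam)) (fun a => ?_), fun n a => ?_⟩
  · exact (HopfStr.transport_comul (R.equivH lam) (R.π 0 a)).trans (R.map_map_comul_π _ _ a)
  · obtain ⟨b, hb, c, hc, hbc, hba, h⟩ := R.exists_symbol_eq (uH lam) a
    have h1 : (HopfStr.transport (R.equivH lam)).counit ((R.filt (uH lam)).symbol n a) =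
        D.counitF c := by
      rw [h, ← equivH_π]
      exact HopfStr.transport_counit (R.equivH lam) (R.π 0 c)
    rw [h1]
    split_ifs with hn
    · subst hn
      rw [← hba, sub_eq_zero.1 (show b - c = 0 from hbc)]
      rfl
    · exact D.counitF_deg hn hc

end Relators

end LiftedHopf
end

theorem proposition4p4 {k Γ I : Type*} [CommRing k] [Nontrivial k]
    [CommGroup Γ] [Finite I] [Nonempty I]
    (D : LiftedHopf.Datum k Γ I) (R : LiftedHopf.Relators D) (lam : LiftedHopf.Relators.Xi D → k) :
    ∃ 𝓗 : LiftedHopf.HopfStr k (R.grH lam),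
      R.IsInducedHopf lam 𝓗 ∧
      letI := 𝓗.toHopfAlgebra
      (∃ (ρ : LiftedHopf.LeftCoaction k R.H0 (R.grA lam))
          (ρ' : LiftedHopf.RightCoaction k (R.grA lam) (R.grH lam)),
        LiftedHopf.InducesOnGr (R.filt (LiftedHopf.Relators.uA lam)).symbols
          (LiftedHopf.Symbols.ofGraded R.H0deg) (R.filt (LiftedHopf.Relators.uA lam)).symbols
          (R.coactL lam).coact.toLinearMap ρ.coact.toLinearMap ∧
        LiftedHopf.InducesOnGr (R.filt (LiftedHopf.Relators.uA lam)).symbols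
          (R.filt (LiftedHopf.Relators.uA lam)).symbols (R.filt (LiftedHopf.Relators.uH lam)).symbols
          (R.coactR lam).coact.toLinearMap ρ'.coact.toLinearMap ∧
        LiftedHopf.IsBicleftObject ρ ρ') ∧
      (Function.Bijective (R.natA lam) ∧
        ∀ n, (R.H0deg n).map (R.natA lam).toLinearMap =
          (R.filt (LiftedHopf.Relators.uA lam)).grDeg n) ∧
      (∃ Φ : R.H0 ≃ₐc[k] R.grH lam, (∀ h, Φ h = R.natH lam h) ∧
        (∀ h, Φ (HopfAlgebra.antipode k h) = HopfAlgebra.antipode k (Φ h)) ∧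
        ∀ n, (R.H0deg n).map (R.natH lam).toLinearMap =
          (R.filt (LiftedHopf.Relators.uH lam)).grDeg n) := by
  obtain ⟨s, hs⟩ := (R.isDeformation_uA lam).exists_splitsSymbols
    (LiftedHopf.Relators.uA_mem_deg lam)
  obtain ⟨s', hs'⟩ := (R.isDeformation_uH lam).exists_splitsSymbols
    (LiftedHopf.Relators.uH_mem_deg lam)
  refine ⟨.transport (R.equivH lam), R.isInducedHopf_transport lam, ?_⟩
  let := (LiftedHopf.HopfStr.transport (R.equivH lam)).toHopfAlgebra
  let Φ : R.H0 ≃ₐc[k] R.grH lam := BialgEquiv.ofAlgEquiv (R.equivH lam)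
    (AlgHom.ext fun h => LiftedHopf.HopfStr.transport_counit (R.equivH lam) h)
    (AlgHom.ext fun h => (LiftedHopf.HopfStr.transport_comul (R.equivH lam) h).symm)
  refine ⟨⟨.transport (R.equivA lam), .transport (R.equivA lam) Φ, ?_, ?_,
    LiftedHopf.isBicleftObject_transport _ _⟩,
    ⟨(R.equivA lam).bijective, R.map_natGr_H0deg _ _⟩,
    Φ, fun _ => rfl, fun h => ?_, R.map_natGr_H0deg _ _⟩
  · refine LiftedHopf.inducesOnGr (πM := (R.π (LiftedHopf.Relators.uA lam)).toLinearMap)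
      (γM := (R.grπ (LiftedHopf.Relators.uA lam)).toLinearMap)
      (fun _ m => R.exists_symbol_eq (LiftedHopf.Relators.uA lam) m)
      R.splitsSymbols_H0 hs (R.filt _).mono
      (fun _ => rfl) fun a => ?_
    exact (LiftedHopf.leftCoact_apply (R.equivA lam) (R.π 0 a)).trans (R.map_map_comul_π _ _ a)
  · refine LiftedHopf.inducesOnGr (πM := (R.π (LiftedHopf.Relators.uA lam)).toLinearMap)
      (γM := (R.grπ (LiftedHopf.Relators.uA lam)).toLinearMap)
      (fun _ m => R.exists_symbol_eq (LiftedHopf.Relators.uA lam) m)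
      hs hs' (R.filt _).mono
      (fun _ => rfl) fun a => ?_
    exact (LiftedHopf.rightCoact_apply (R.equivA lam) Φ (R.π 0 a)).trans (R.map_map_comul_π _ _ a)
  · exact (LiftedHopf.HopfStr.transport_antipode (R.equivH lam) h).symm
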